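/- Let $G$ be either the additive group $\mathbb{G}_a$ (Hopf algebra $k[x]$, $x\mapsto x\otimes 1+1\otimes x$) or the Heisenberg group $H_1$ of upper unitriangular $3\times 3$ matrices (Hopf algebra $k[x,y,z]$, with $x,y$ primitive and $z\mapsto z\otimes 1+1\otimes z+x\otimes y$). For a field $k$ and a set $J$, let $\mathrm{Rep}_k G^J$ be the category of finite-dimensional representations over $k$ of the direct power $G^J$, i.e. of finite-dimensional comodules over its Hopf algebra (the polynomial algebra in the coordinates of the factors); $G^n$ is the case $|J|=n$ and $G^\infty$ the case $J=\mathbb{N}$. Let $(k_i)_{i\in\mathbb{N}}$ be fields of strictly increasing positive characteristic, let $U$ be a non-principal ultrafilter on $\mathbb{N}$, and let $k=\prod_U k_i$ be the ultraproduct of the fields. The ultraproduct of the categories $\mathrm{Rep}_{k_i}G$ has as objects the classes $[X_i]$ of families of objects $X_i$ of $\mathrm{Rep}_{k_i}G$, and as morphisms the classes $[f_i]$ of families of morphisms modulo equality for almost every $i$, with all operations (composition, $k$-linear structure, tensor product, symmetry) taken componentwise. The restricted ultraproduct $\prod_R\mathrm{Rep}_{k_i}G$ is its full subcategory of objects $[X_i]$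 for which $\dim X_i$ is bounded for almost every $i$. Let $\omega:\prod_R\mathrm{Rep}_{k_i}G\to\mathrm{Vec}_k$, $[X_i]\mapsto\prod_U X_i$, be the functor sending an object to the ultraproduct of its underlying vector spaces. The height of a representation $M$ of $G$ over a field of characteristic $p>0$ is the largest $m\ge 1$ such that, for some coordinate $x$ of $G$, the monomial $x^{p^{m-1}}$ occurs with non-zero coefficient in an entry of the matrix formula of $M$ (the matrix of its comodule map in a basis), and it is $0$ if there is no such $m$. The height of $[X_i]$ is the essential supremum of the heights of the $X_i$ with respect to $U$. Let $\prod_H\mathrm{Rep}_{k_i}G$ be the full subcategory of $\prod_R\mathrm{Rep}_{k_i}G$ of objects of finite height, and $\prod_{H\le n}\mathrm{Rep}_{k_i}G$ the full subcategory of objects of height at most $n$. Then: 1. $\prod_H\mathrm{Rep}_{k_i}G$ is closed under tensor products and contains the unit object, its inclusion into $\prod_R\mathrm{Rep}_{k_i}G$ is exact, and it is a neutral tannakian category over $k$ whose fibre functor is the restriction of $\omega$. That is: it is a rigid abelian symmetric monoidal category with bi-additive tensor product, $\mathrm{End}(\mathbf 1)=k$, and the restriction of $\omega$ is an exact, faithful,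 $k$-linear symmetric monoidal functor to finite-dimensional $k$-vector spaces. 2. There is a $k$-linear symmetric (strong) monoidal equivalence of categories from $\prod_H\mathrm{Rep}_{k_i}G$ to $\mathrm{Rep}_k G^\infty$. 3. For every integer $n\ge 0$, $\prod_{H\le n}\mathrm{Rep}_{k_i}G$ is closed under tensor products and contains the unit object, and there is a $k$-linear symmetric (strong) monoidal equivalence of categories from it to $\mathrm{Rep}_k G^n$. -/

import Mathlib

open CategoryTheory MonoidalCategory Limits TensorProduct

universe v u

noncomputable section

/-- The two unipotent algebraic groups under consideration: the additive group `G_a` and the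
Heisenberg group `H_1` of upper unitriangular `3 × 3` matrices. -/
inductive UnipotentGroup : Type
  | Ga : UnipotentGroup
  | H1 : UnipotentGroup

namespace UnipotentGroup

/-- The number of coordinates of the group. -/
def dim : UnipotentGroup → ℕ
  | Ga => 1
  | H1 => 3

/-- The group law in coordinates.  For `G_a` it is addition.  A point `(x, y, z)` of `H_1` is the
matrix with rows `(1, x, z)`, `(0, 1, y)`, `(0, 0, 1)`, and the law is the matrix product. -/
def mul {R : Type*} [CommRing R] :
    (G : UnipotentGroup) → (Fin G.dim → R) → (Fin G.dim → R) → (Fin G.dim → R)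
  | Ga, a, b => fun i => a i + b i
  | H1, a, b => (![a (0 : Fin 3) + b (0 : Fin 3), a (1 : Fin 3) + b (1 : Fin 3),
      a (2 : Fin 3) + b (2 : Fin 3) + a (0 : Fin 3) * b (1 : Fin 3)] : Fin 3 → R)

/-- The inverse in coordinates. -/
def inv {R : Type*} [CommRing R] : (G : UnipotentGroup) → (Fin G.dim → R) → (Fin G.dim → R)
  | Ga, a => fun i => -a i
  | H1, a => (![-a (0 : Fin 3), -a (1 : Fin 3),
      -a (2 : Fin 3) + a (0 : Fin 3) * a (1 : Fin 3)] : Fin 3 → R)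

section Law

variable {R : Type*} [CommRing R]

theorem mul_assoc' (G : UnipotentGroup) (a b c : Fin G.dim → R) :
    G.mul (G.mul a b) c = G.mul a (G.mul b c) := by
  cases G
  · funext i; simp only [mul]; ring
  · funext i
    change Fin 3 at i
    fin_cases i <;> simp [mul] <;> ring

theorem mul_zero' (G : UnipotentGroup) (a : Fin G.dim → R) : G.mul a (fun _ => 0) = a := by
  cases G
  · funext i; simp only [mul]; ring
  · funext i
    change Fin 3 at i
    fin_cases i <;> simp [mul]

theorem zero_mul' (G : UnipotentGroup) (a : Fin G.dim → R) : G.mul (fun _ => 0) a = a := by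
  cases G
  · funext i; simp only [mul]; ring
  · funext i
    change Fin 3 at i
    fin_cases i <;> simp [mul]

theorem inv_mul' (G : UnipotentGroup) (a : Fin G.dim → R) :
    G.mul (G.inv a) a = fun _ => 0 := by
  cases G
  · funext i; simp only [mul, inv]; ring
  · funext i
    change Fin 3 at i
    fin_cases i <;> simp [mul, inv]

theorem mul_inv' (G : UnipotentGroup) (a : Fin G.dim → R) :
    G.mul a (G.inv a) = fun _ => 0 := by
  cases G
  · funext i; simp only [mul, inv]; ring
  · funext i
    change Fin 3 at i
    fin_cases i <;> simp [mul, inv]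

theorem map_mul' {S : Type*} [CommRing S] (f : R →+* S) (G : UnipotentGroup)
    (a b : Fin G.dim → R) (c : Fin G.dim) :
    f (G.mul a b c) = G.mul (fun i => f (a i)) (fun i => f (b i)) c := by
  cases G
  · simp only [mul, map_add]
  · change Fin 3 at c
    fin_cases c <;> simp [mul]

end Law

/-- The Hopf algebra of the direct power `G^J` over `k`: the polynomial algebra in the coordinates
of the factors, with comultiplication given by the group law in each factor. -/
def HopfAlg (G : UnipotentGroup) (J : Type) (k : Type u) [Field k] : Type u :=
  MvPolynomial (J × Fin G.dim) k

namespace HopfAlg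

variable (G : UnipotentGroup) (J : Type) (k : Type u) [Field k]

instance : CommRing (HopfAlg G J k) :=
  inferInstanceAs (CommRing (MvPolynomial (J × Fin G.dim) k))

instance : Algebra k (HopfAlg G J k) :=
  inferInstanceAs (Algebra k (MvPolynomial (J × Fin G.dim) k))

variable {G J} in
/-- The `c`-th coordinate of the `j`-th factor. -/
def coord (j : J) (c : Fin G.dim) : HopfAlg G J k :=
  (MvPolynomial.X (j, c) : MvPolynomial (J × Fin G.dim) k)

variable {G J} in
/-- The coefficient of the monomial with exponent `d`. -/
def lcoeff (d : J × Fin G.dim →₀ ℕ) : HopfAlg G J k →ₗ[k] k :=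
  (MvPolynomial.lcoeff k d : MvPolynomial (J × Fin G.dim) k →ₗ[k] k)

variable {G J k} in
/-- The algebra homomorphism with prescribed values on the coordinates. -/
def lift {B : Type*} [CommRing B] [Algebra k B] (f : J → Fin G.dim → B) :
    HopfAlg G J k →ₐ[k] B :=
  (MvPolynomial.aeval fun x => f x.1 x.2 : MvPolynomial (J × Fin G.dim) k →ₐ[k] B)

variable {G J k} in
@[simp] theorem lift_coord {B : Type*} [CommRing B] [Algebra k B] (f : J → Fin G.dim → B)
    (j : J) (c : Fin G.dim) : lift f (coord k j c) = f j c :=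
  MvPolynomial.aeval_X (R := k) (fun x : J × Fin G.dim => f x.1 x.2) (j, c)

variable {G J k} in
theorem algHom_ext {B : Type*} [Semiring B] [Algebra k B] {f g : HopfAlg G J k →ₐ[k] B}
    (h : ∀ j c, f (coord k j c) = g (coord k j c)) : f = g :=
  MvPolynomial.algHom_ext (σ := J × Fin G.dim) (fun x => h x.1 x.2)

/-- Comultiplication: the group law applied to the two copies of the coordinates. -/
def comulHom : HopfAlg G J k →ₐ[k] HopfAlg G J k ⊗[k] HopfAlg G J k :=
  lift fun j => G.mul (fun c => coord k j c ⊗ₜ 1) (fun c => 1 ⊗ₜ coord k j c)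

/-- Counit: evaluation at the neutral element, all of whose coordinates are `0`. -/
def counitHom : HopfAlg G J k →ₐ[k] k := lift fun _ _ => 0

/-- Antipode: the inverse of the group. -/
def antipodeHom : HopfAlg G J k →ₐ[k] HopfAlg G J k := lift fun j => G.inv (coord k j)

theorem map_mul'' {B C : Type*} [CommRing B] [CommRing C] [Algebra k B] [Algebra k C]
    (f : B →ₐ[k] C) (a b : Fin G.dim → B) (c : Fin G.dim) :
    f (G.mul a b c) = G.mul (fun i => f (a i)) (fun i => f (b i)) c :=
  map_mul' (f : B →+* C) G a b c

instance : Bialgebra k (HopfAlg G J k) :=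
  .ofAlgHom (comulHom G J k) (counitHom G J k)
    (by
      refine algHom_ext fun j c => ?_
      have h := congrFun (mul_assoc' G
        (fun c => coord k j c ⊗ₜ[k] ((1 : HopfAlg G J k) ⊗ₜ[k] (1 : HopfAlg G J k)))
        (fun c => (1 : HopfAlg G J k) ⊗ₜ[k] (coord k j c ⊗ₜ[k] (1 : HopfAlg G J k)))
        (fun c => (1 : HopfAlg G J k) ⊗ₜ[k] ((1 : HopfAlg G J k) ⊗ₜ[k] coord k j c))) c
      have e1 := map_mul'' G k (Algebra.TensorProduct.includeRight :
        HopfAlg G J k ⊗[k] HopfAlg G J k →ₐ[k]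
          HopfAlg G J k ⊗[k] (HopfAlg G J k ⊗[k] HopfAlg G J k))
        (fun c => coord k j c ⊗ₜ 1) (fun c => 1 ⊗ₜ coord k j c)
      have e2 := map_mul'' G k (((Algebra.TensorProduct.assoc k k k (HopfAlg G J k)
        (HopfAlg G J k) (HopfAlg G J k)).toAlgHom).comp (Algebra.TensorProduct.includeLeft :
        HopfAlg G J k ⊗[k] HopfAlg G J k →ₐ[k]
          (HopfAlg G J k ⊗[k] HopfAlg G J k) ⊗[k] HopfAlg G J k))
        (fun c => coord k j c ⊗ₜ 1) (fun c => 1 ⊗ₜ coord k j c)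
      simp only [AlgHom.coe_comp, Function.comp_apply,
        Algebra.TensorProduct.includeLeft_apply, Algebra.TensorProduct.includeRight_apply] at e1 e2
      simp only [AlgHom.coe_comp, Function.comp_apply,
        comulHom, lift_coord, map_mul'', Algebra.TensorProduct.map_tmul, map_one, AlgHom.coe_id,
        id_eq, Algebra.TensorProduct.one_def, e1, e2]
      exact h)
    (by
      refine algHom_ext fun j c => ?_
      have e := map_mul'' G k (Algebra.TensorProduct.includeRight :
        HopfAlg G J k →ₐ[k] k ⊗[k] HopfAlg G J k) (fun _ => 0) (coord k j) c
      rw [zero_mul'] at e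
      simp only [AlgHom.coe_comp, Function.comp_apply, comulHom, counitHom, lift_coord,
        map_mul'', Algebra.TensorProduct.map_tmul, map_one, AlgHom.coe_id, id_eq,
        TensorProduct.zero_tmul]
      simpa using e.symm)
    (by
      refine algHom_ext fun j c => ?_
      have e := map_mul'' G k (Algebra.TensorProduct.includeLeft :
        HopfAlg G J k →ₐ[k] HopfAlg G J k ⊗[k] k) (coord k j) (fun _ => 0) c
      rw [mul_zero'] at e
      simp only [AlgHom.coe_comp, Function.comp_apply, comulHom, counitHom, lift_coord,
        map_mul'', Algebra.TensorProduct.map_tmul, map_one, AlgHom.coe_id, id_eq,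
        TensorProduct.tmul_zero]
      simpa using e.symm)

instance : HopfAlgebra k (HopfAlg G J k) where
  antipode := (antipodeHom G J k).toLinearMap
  mul_antipode_rTensor_comul := by
    have h : ((Algebra.TensorProduct.lmul' k : HopfAlg G J k ⊗[k] HopfAlg G J k →ₐ[k] _).comp
        ((Algebra.TensorProduct.map (antipodeHom G J k) (AlgHom.id k _)).comp
          (comulHom G J k))) = (Algebra.ofId k _).comp (counitHom G J k) := by
      refine algHom_ext fun j c => ?_
      have e := congrFun (inv_mul' G (coord k j)) c
      simp only [AlgHom.coe_comp, Function.comp_apply, comulHom, counitHom, antipodeHom,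
        lift_coord, map_mul'', Algebra.TensorProduct.map_tmul, map_one, AlgHom.coe_id, id_eq,
        Algebra.TensorProduct.lmul'_apply_tmul, mul_one, one_mul, map_zero]
      exact e
    exact congr(($h).toLinearMap)
  mul_antipode_lTensor_comul := by
    have h : ((Algebra.TensorProduct.lmul' k : HopfAlg G J k ⊗[k] HopfAlg G J k →ₐ[k] _).comp
        ((Algebra.TensorProduct.map (AlgHom.id k _) (antipodeHom G J k)).comp
          (comulHom G J k))) = (Algebra.ofId k _).comp (counitHom G J k) := by
      refine algHom_ext fun j c => ?_
      have e := congrFun (mul_inv' G (coord k j)) c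
      simp only [AlgHom.coe_comp, Function.comp_apply, comulHom, counitHom, antipodeHom,
        lift_coord, map_mul'', Algebra.TensorProduct.map_tmul, map_one, AlgHom.coe_id, id_eq,
        Algebra.TensorProduct.lmul'_apply_tmul, mul_one, one_mul, map_zero]
      exact e
    exact congr(($h).toLinearMap)

end HopfAlg

end UnipotentGroup


/-- A finite-dimensional (right) comodule over the `k`-bialgebra `A`. -/
structure FDComod (k : Type u) [Field k] (A : Type u) [CommRing A] [Bialgebra k A] where
  /-- the underlying vector space -/
  carrier : Type u
  [addCommGroup : AddCommGroup carrier]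
  [module : Module k carrier]
  [finite : Module.Finite k carrier]
  /-- the comodule map -/
  coact : carrier →ₗ[k] carrier ⊗[k] A
  coassoc : (TensorProduct.assoc k carrier A A).toLinearMap ∘ₗ coact.rTensor A ∘ₗ coact =
    (Coalgebra.comul (R := k) (A := A)).lTensor carrier ∘ₗ coact
  counit_coact : (TensorProduct.rid k carrier).toLinearMap ∘ₗ
    (Coalgebra.counit (R := k) (A := A)).lTensor carrier ∘ₗ coact = LinearMap.id

namespace FDComod

attribute [instance] addCommGroup module finite

variable {k : Type u} [Field k] {A : Type u} [CommRing A] [Bialgebra k A]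

instance : CoeSort (FDComod k A) (Type u) := ⟨carrier⟩

/-- Morphisms of comodules. -/
@[ext]
structure Hom (V W : FDComod k A) where
  /-- the underlying linear map -/
  lin : V →ₗ[k] W
  comm : W.coact ∘ₗ lin = lin.rTensor A ∘ₗ V.coact

instance : Category (FDComod k A) where
  Hom := Hom
  id V := ⟨LinearMap.id, by ext; simp⟩
  comp f g := ⟨g.lin ∘ₗ f.lin, by
    rw [← LinearMap.comp_assoc, g.comm, LinearMap.comp_assoc, f.comm, LinearMap.rTensor_comp,
      LinearMap.comp_assoc]⟩

@[ext] theorem hom_ext {V W : FDComod k A} {f g : V ⟶ W} (h : f.lin = g.lin) : f = g :=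
  Hom.ext h

@[simp] theorem id_lin (V : FDComod k A) : Hom.lin (𝟙 V) = LinearMap.id := rfl

@[simp] theorem comp_lin {V W X : FDComod k A} (f : V ⟶ W) (g : W ⟶ X) :
    (f ≫ g).lin = g.lin ∘ₗ f.lin := rfl

section Preadditive

variable (V W : FDComod k A)

/-- Morphisms of comodules as a subspace of all linear maps. -/
def homSubmodule : Submodule k (V →ₗ[k] W) where
  carrier := {f | W.coact ∘ₗ f = f.rTensor A ∘ₗ V.coact}
  add_mem' {f g} hf hg := by
    simp only [Set.mem_ofPred_eq] at *
    rw [LinearMap.comp_add, hf, hg, LinearMap.rTensor_add, LinearMap.add_comp]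
  zero_mem' := by simp
  smul_mem' a f hf := by
    simp only [Set.mem_ofPred_eq] at *
    rw [LinearMap.comp_smul, hf, LinearMap.rTensor_smul, LinearMap.smul_comp]

/-- Morphisms are the elements of `homSubmodule`. -/
def homEquiv : (V ⟶ W) ≃ homSubmodule V W where
  toFun f := ⟨f.lin, f.comm⟩
  invFun f := ⟨f.1, f.2⟩
  left_inv _ := rfl
  right_inv _ := rfl

instance : AddCommGroup (V ⟶ W) := (homEquiv V W).addCommGroup

instance : Module k (V ⟶ W) := (homEquiv V W).module k

variable {V W}

@[simp] theorem add_lin (f g : V ⟶ W) : (f + g).lin = f.lin + g.lin := rfl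

@[simp] theorem zero_lin : (0 : V ⟶ W).lin = 0 := rfl

@[simp] theorem smul_lin (a : k) (f : V ⟶ W) : (a • f).lin = a • f.lin := rfl

end Preadditive

instance : Preadditive (FDComod k A) where
  add_comp _ _ _ f f' g := by ext1; simp [LinearMap.comp_add]
  comp_add _ _ _ f g g' := by ext1; simp [LinearMap.add_comp]

instance : Linear k (FDComod k A) where
  smul_comp _ _ _ a f g := by ext1; simp [LinearMap.comp_smul]
  comp_smul _ _ _ f a g := by ext1; simp [LinearMap.smul_comp]

variable (k A) in
/-- The forgetful functor to vector spaces. -/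
def forgetToModule : FDComod k A ⥤ ModuleCat.{u} k where
  obj V := ModuleCat.of k V
  map f := ModuleCat.ofHom f.lin

instance : (forgetToModule k A).Faithful where
  map_injective h := hom_ext (congrArg ModuleCat.Hom.hom h)

/-- A linear isomorphism compatible with the comodule maps is an isomorphism of comodules. -/
@[simps]
def isoMk {V W : FDComod k A} (e : V ≃ₗ[k] W)
    (h : W.coact ∘ₗ e.toLinearMap = e.toLinearMap.rTensor A ∘ₗ V.coact) : V ≅ W where
  hom := ⟨e.toLinearMap, h⟩
  inv := ⟨e.symm.toLinearMap, by
    have h1 : e.symm.toLinearMap.rTensor A ∘ₗ e.toLinearMap.rTensor A = LinearMap.id := by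
      rw [← LinearMap.rTensor_comp, LinearEquiv.symm_comp, LinearMap.rTensor_id]
    calc V.coact ∘ₗ e.symm.toLinearMap
        = (e.symm.toLinearMap.rTensor A ∘ₗ e.toLinearMap.rTensor A) ∘ₗ V.coact ∘ₗ
            e.symm.toLinearMap := by rw [h1, LinearMap.id_comp]
      _ = e.symm.toLinearMap.rTensor A ∘ₗ (e.toLinearMap.rTensor A ∘ₗ V.coact) ∘ₗ
            e.symm.toLinearMap := by simp only [LinearMap.comp_assoc]
      _ = e.symm.toLinearMap.rTensor A ∘ₗ W.coact := by
        rw [← h, LinearMap.comp_assoc, LinearEquiv.comp_symm, LinearMap.comp_id]⟩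
  hom_inv_id := by ext x; simp
  inv_hom_id := by ext x; simp

section Tensor

/-- The map `(V ⊗ A) ⊗ (W ⊗ A) → (V ⊗ W) ⊗ A`, `(v ⊗ a) ⊗ (w ⊗ b) ↦ (v ⊗ w) ⊗ ab`. -/
def mulMap (k : Type u) [Field k] (A : Type u) [CommRing A] [Algebra k A]
    (V W : Type*) [AddCommGroup V] [Module k V] [AddCommGroup W] [Module k W] :
    (V ⊗[k] A) ⊗[k] (W ⊗[k] A) →ₗ[k] (V ⊗[k] W) ⊗[k] A :=
  (LinearMap.mul' k A).lTensor (V ⊗[k] W) ∘ₗ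
    (TensorProduct.tensorTensorTensorComm k V A W A).toLinearMap

@[simp] theorem mulMap_tmul {V W : Type*} [AddCommGroup V] [Module k V] [AddCommGroup W]
    [Module k W] (v : V) (a : A) (w : W) (b : A) :
    mulMap k A V W ((v ⊗ₜ a) ⊗ₜ (w ⊗ₜ b)) = (v ⊗ₜ w) ⊗ₜ (a * b) := rfl

/-- The comodule map of the tensor product of two comodules. -/
def tensorCoact (V W : FDComod k A) : V ⊗[k] W →ₗ[k] (V ⊗[k] W) ⊗[k] A :=
  mulMap k A V W ∘ₗ TensorProduct.map V.coact W.coact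

@[simp] theorem tensorCoact_tmul (V W : FDComod k A) (v : V) (w : W) :
    tensorCoact V W (v ⊗ₜ w) = mulMap k A V W (V.coact v ⊗ₜ W.coact w) := rfl

theorem coassoc_apply (V : FDComod k A) (v : V) :
    TensorProduct.assoc k V A A (V.coact.rTensor A (V.coact v)) =
      (Coalgebra.comul (R := k) (A := A)).lTensor V (V.coact v) :=
  LinearMap.congr_fun V.coassoc v

theorem counit_apply (V : FDComod k A) (v : V) :
    TensorProduct.rid k V ((Coalgebra.counit (R := k) (A := A)).lTensor V (V.coact v)) = v :=
  LinearMap.congr_fun V.counit_coact v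

theorem tensor_coassoc_aux (V W : FDComod k A) (x : V ⊗[k] A) (y : W ⊗[k] A) :
    TensorProduct.assoc k (V ⊗[k] W) A A
      ((tensorCoact V W).rTensor A (mulMap k A V W (x ⊗ₜ y))) =
    mulMap k (A ⊗[k] A) V W
      (TensorProduct.assoc k V A A (V.coact.rTensor A x) ⊗ₜ
        TensorProduct.assoc k W A A (W.coact.rTensor A y)) := by
  induction x with
  | zero => simp
  | add x x' hx hx' => simp only [TensorProduct.add_tmul, map_add, hx, hx']
  | tmul v a =>
    induction y with
    | zero => simp
    | add y y' hy hy' => simp only [TensorProduct.tmul_add, map_add, hy, hy']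
    | tmul w b =>
      simp only [mulMap_tmul, LinearMap.rTensor_tmul, tensorCoact_tmul]
      generalize V.coact v = x
      generalize W.coact w = y
      induction x with
      | zero => simp
      | add x x' hx hx' => simp only [TensorProduct.add_tmul, map_add, hx, hx']
      | tmul v' a' =>
        induction y with
        | zero => simp
        | add y y' hy hy' => simp only [TensorProduct.tmul_add, TensorProduct.add_tmul,
            map_add, hy, hy']
        | tmul w' b' => simp

theorem comul_mulMap (V W : FDComod k A) (x : V ⊗[k] A) (y : W ⊗[k] A) :
    (Coalgebra.comul (R := k) (A := A)).lTensor (V ⊗[k] W) (mulMap k A V W (x ⊗ₜ y)) =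
    mulMap k (A ⊗[k] A) V W
      ((Coalgebra.comul (R := k) (A := A)).lTensor V x ⊗ₜ
        (Coalgebra.comul (R := k) (A := A)).lTensor W y) := by
  induction x with
  | zero => simp
  | add x x' hx hx' => simp only [TensorProduct.add_tmul, map_add, hx, hx']
  | tmul v a =>
    induction y with
    | zero => simp
    | add y y' hy hy' => simp only [TensorProduct.tmul_add, map_add, hy, hy']
    | tmul w b =>
      simp only [mulMap_tmul, LinearMap.lTensor_tmul, Bialgebra.comul_mul]

theorem counit_mulMap (V W : FDComod k A) (x : V ⊗[k] A) (y : W ⊗[k] A) :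
    TensorProduct.rid k (V ⊗[k] W)
      ((Coalgebra.counit (R := k) (A := A)).lTensor (V ⊗[k] W) (mulMap k A V W (x ⊗ₜ y))) =
    TensorProduct.rid k V ((Coalgebra.counit (R := k) (A := A)).lTensor V x) ⊗ₜ
      TensorProduct.rid k W ((Coalgebra.counit (R := k) (A := A)).lTensor W y) := by
  induction x with
  | zero => simp
  | add x x' hx hx' => simp only [TensorProduct.add_tmul, map_add, hx, hx']
  | tmul v a =>
    induction y with
    | zero => simp
    | add y y' hy hy' => simp only [TensorProduct.tmul_add, map_add, hy, hy']
    | tmul w b =>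
      simp only [mulMap_tmul, LinearMap.lTensor_tmul, Bialgebra.counit_mul,
        TensorProduct.rid_tmul, TensorProduct.smul_tmul_smul]

/-- The tensor product of two comodules. -/
def tensor (V W : FDComod k A) : FDComod k A where
  carrier := V ⊗[k] W
  coact := tensorCoact V W
  coassoc := by
    refine TensorProduct.ext' fun v w => ?_
    simp only [LinearMap.coe_comp, LinearEquiv.coe_coe, Function.comp_apply, tensorCoact_tmul]
    rw [tensor_coassoc_aux, comul_mulMap, coassoc_apply, coassoc_apply]
  counit_coact := by
    refine TensorProduct.ext' fun v w => ?_
    simp only [LinearMap.coe_comp, LinearEquiv.coe_coe, Function.comp_apply, tensorCoact_tmul]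
    rw [counit_mulMap, counit_apply, counit_apply, LinearMap.id_apply]

variable (k A) in
/-- The trivial comodule `k`, with comodule map `1 ↦ 1 ⊗ 1`. -/
def triv : FDComod k A where
  carrier := k
  coact := (TensorProduct.mk k k A).flip 1
  coassoc := by ext; simp [Algebra.TensorProduct.one_def]
  counit_coact := by ext; simp

theorem mulMap_natural {V V' W W' : Type*} [AddCommGroup V] [Module k V] [AddCommGroup W]
    [Module k W] [AddCommGroup V'] [Module k V'] [AddCommGroup W'] [Module k W']
    (f : V →ₗ[k] V') (g : W →ₗ[k] W') (x : V ⊗[k] A) (y : W ⊗[k] A) :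
    mulMap k A V' W' (f.rTensor A x ⊗ₜ g.rTensor A y) =
      (TensorProduct.map f g).rTensor A (mulMap k A V W (x ⊗ₜ y)) := by
  induction x with
  | zero => simp
  | add x x' hx hx' => simp only [TensorProduct.add_tmul, map_add, hx, hx']
  | tmul v a =>
    induction y with
    | zero => simp
    | add y y' hy hy' => simp only [TensorProduct.tmul_add, map_add, hy, hy']
    | tmul w b => rfl

theorem comm_apply {V W : FDComod k A} (f : V ⟶ W) (v : V) :
    W.coact (f.lin v) = f.lin.rTensor A (V.coact v) :=
  LinearMap.congr_fun f.comm v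

/-- The tensor product of two morphisms. -/
def tensorMap {V V' W W' : FDComod k A} (f : V ⟶ V') (g : W ⟶ W') :
    tensor V W ⟶ tensor V' W' where
  lin := TensorProduct.map f.lin g.lin
  comm := by
    refine TensorProduct.ext' fun v w => ?_
    change mulMap k A V' W' (V'.coact (f.lin v) ⊗ₜ W'.coact (g.lin w)) =
      (TensorProduct.map f.lin g.lin).rTensor A (mulMap k A V W (V.coact v ⊗ₜ W.coact w))
    rw [comm_apply, comm_apply, mulMap_natural]

/-- The associativity isomorphism. -/
def assocIso (V W X : FDComod k A) : tensor (tensor V W) X ≅ tensor V (tensor W X) :=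
  isoMk (TensorProduct.assoc k V W X) (by
    refine TensorProduct.ext_threefold fun v w x => ?_
    change mulMap k A V (W ⊗[k] X) (V.coact v ⊗ₜ mulMap k A W X (W.coact w ⊗ₜ X.coact x)) =
      (TensorProduct.assoc k V W X).toLinearMap.rTensor A
        (mulMap k A (V ⊗[k] W) X (mulMap k A V W (V.coact v ⊗ₜ W.coact w) ⊗ₜ X.coact x))
    generalize V.coact v = a
    generalize W.coact w = b
    generalize X.coact x = c
    induction a with
    | zero => simp
    | add a a' h h' => simp only [TensorProduct.add_tmul, map_add, h, h']
    | tmul v a =>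
      induction b with
      | zero => simp
      | add a a' h h' => simp only [TensorProduct.add_tmul, TensorProduct.tmul_add, map_add,
          h, h']
      | tmul w b =>
        induction c with
        | zero => simp
        | add a a' h h' => simp only [TensorProduct.tmul_add, map_add, h, h']
        | tmul x c => simp [mul_assoc])

/-- The left unit isomorphism. -/
def leftIso (V : FDComod k A) : tensor (triv k A) V ≅ V :=
  isoMk (TensorProduct.lid k V) (by
    refine TensorProduct.ext' fun (a : k) v => ?_
    change V.coact (a • v) = (TensorProduct.lid k V).toLinearMap.rTensor A
      (mulMap k A k V ((a ⊗ₜ 1) ⊗ₜ V.coact v))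
    rw [map_smul]
    generalize V.coact v = b
    induction b with
    | zero => simp
    | add a a' h h' => simp only [TensorProduct.tmul_add, smul_add, map_add, h, h']
    | tmul w b => simp [TensorProduct.smul_tmul'])

/-- The right unit isomorphism. -/
def rightIso (V : FDComod k A) : tensor V (triv k A) ≅ V :=
  isoMk (TensorProduct.rid k V) (by
    refine TensorProduct.ext' fun v (a : k) => ?_
    change V.coact (a • v) = (TensorProduct.rid k V).toLinearMap.rTensor A
      (mulMap k A V k (V.coact v ⊗ₜ (a ⊗ₜ 1)))
    rw [map_smul]
    generalize V.coact v = b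
    induction b with
    | zero => simp
    | add a a' h h' => simp only [TensorProduct.add_tmul, smul_add, map_add, h, h']
    | tmul w b => simp [TensorProduct.smul_tmul'])

/-- The commutativity isomorphism. -/
def commIso (V W : FDComod k A) : tensor V W ≅ tensor W V :=
  isoMk (TensorProduct.comm k V W) (by
    refine TensorProduct.ext' fun v w => ?_
    change mulMap k A W V (W.coact w ⊗ₜ V.coact v) =
      (TensorProduct.comm k V W).toLinearMap.rTensor A
        (mulMap k A V W (V.coact v ⊗ₜ W.coact w))
    generalize V.coact v = a
    generalize W.coact w = b
    induction a with
    | zero => simp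
    | add a a' h h' => simp only [TensorProduct.add_tmul, TensorProduct.tmul_add, map_add, h, h']
    | tmul v a =>
      induction b with
      | zero => simp
      | add a a' h h' => simp only [TensorProduct.add_tmul, TensorProduct.tmul_add, map_add,
          h, h']
      | tmul w b => simp [mul_comm])

end Tensor

instance : MonoidalCategoryStruct (FDComod k A) where
  tensorObj := tensor
  whiskerLeft V _ _ f := tensorMap (𝟙 V) f
  whiskerRight f W := tensorMap f (𝟙 W)
  tensorHom := tensorMap
  tensorUnit := triv k A
  associator := assocIso
  leftUnitor := leftIso
  rightUnitor := rightIso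

instance : MonoidalCategory (FDComod k A) :=
  Monoidal.induced (forgetToModule k A)
    { μIso := fun V W => Iso.refl (ModuleCat.of k (V ⊗[k] W))
      εIso := Iso.refl (ModuleCat.of k k)
      whiskerLeft_eq := fun _ _ _ _ => rfl
      whiskerRight_eq := fun _ _ => rfl
      tensorHom_eq := fun _ _ => rfl
      associator_eq := fun V W X => by
        apply ModuleCat.hom_ext
        exact TensorProduct.ext_threefold fun _ _ _ => rfl
      leftUnitor_eq := fun V => by
        apply ModuleCat.hom_ext
        exact TensorProduct.ext' fun _ _ => rfl
      rightUnitor_eq := fun V => by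
        apply ModuleCat.hom_ext
        exact TensorProduct.ext' fun _ _ => rfl }

@[simp] theorem tensorHom_lin {V V' W W' : FDComod k A} (f : V ⟶ V') (g : W ⟶ W') :
    (f ⊗ₘ g).lin = TensorProduct.map f.lin g.lin := rfl

@[simp] theorem whiskerLeft_lin (V : FDComod k A) {W W' : FDComod k A} (g : W ⟶ W') :
    (V ◁ g).lin = TensorProduct.map LinearMap.id g.lin := rfl

@[simp] theorem whiskerRight_lin {V V' : FDComod k A} (f : V ⟶ V') (W : FDComod k A) :
    (f ▷ W).lin = TensorProduct.map f.lin LinearMap.id := rfl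

instance : SymmetricCategory (FDComod k A) where
  braiding := commIso
  braiding_naturality_right V W W' f := by
    ext1; exact TensorProduct.ext' fun _ _ => rfl
  braiding_naturality_left f V := by
    ext1; exact TensorProduct.ext' fun _ _ => rfl
  hexagon_forward V W X := by
    ext1; exact TensorProduct.ext_threefold fun _ _ _ => rfl
  hexagon_reverse V W X := by
    ext1
    refine (LinearMap.cancel_right (TensorProduct.assoc k V W X).surjective).1 ?_
    exact TensorProduct.ext_threefold fun _ _ _ => rfl
  symmetry V W := by
    ext1; exact TensorProduct.ext' fun _ _ => rfl

end FDComod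


section Ultraproduct

variable {ι : Type} (U : Ultrafilter ι)

section Field

variable (k : ι → Type u) [∀ i, Field (k i)]

/-- The families of scalars that vanish almost everywhere. -/
def uNullIdeal : Ideal (∀ i, k i) where
  carrier := {a | ∀ᶠ i in U, a i = 0}
  add_mem' ha hb := by
    filter_upwards [ha, hb] with i h h'
    simp [h, h']
  zero_mem' := .of_forall fun _ => rfl
  smul_mem' c a ha := by
    filter_upwards [ha] with i h
    simp [h]

instance : (uNullIdeal U k).IsMaximal := by
  refine Ideal.isMaximal_iff.2 ⟨fun h => ?_, fun I a _ ha haI => ?_⟩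
  · have h' : ∀ᶠ i in U, (1 : ∀ i, k i) i = 0 := h
    obtain ⟨i, hi⟩ := h'.exists
    exact one_ne_zero hi
  · rename_i hI
    have h1 : (1 : ∀ i, k i) - (fun i => (a i)⁻¹) * a ∈ uNullIdeal U k := by
      have ha' : ∀ᶠ i in U, ¬ a i = 0 := Ultrafilter.eventually_not.2 ha
      change ∀ᶠ i in U, ((1 : ∀ i, k i) - (fun i => (a i)⁻¹) * a) i = 0
      filter_upwards [ha'] with i hi
      simp [inv_mul_cancel₀ hi]
    have h2 := I.add_mem (hI h1) (I.mul_mem_left (fun i => (a i)⁻¹) haI)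
    simpa using h2

/-- The ultraproduct of the fields `k i`: families of scalars modulo almost everywhere equality. -/
def UField : Type u := (∀ i, k i) ⧸ uNullIdeal U k

instance : Field (UField U k) := Ideal.Quotient.field (uNullIdeal U k)

end Field

section Vec

variable (k : ι → Type u) [∀ i, Field (k i)]
variable (V : ι → Type u) [∀ i, AddCommGroup (V i)] [∀ i, Module (k i) (V i)]

/-- The families of vectors that vanish almost everywhere. -/
def uNullSubmodule : Submodule (∀ i, k i) (∀ i, V i) where
  carrier := {v | ∀ᶠ i in U, v i = 0}
  add_mem' ha hb := by
    filter_upwards [ha, hb] with i h h'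
    simp [h, h']
  zero_mem' := .of_forall fun _ => rfl
  smul_mem' c a ha := by
    filter_upwards [ha] with i h
    simp [h]

/-- The ultraproduct of the vector spaces `V i`: families of vectors modulo almost everywhere
equality. -/
def UVec : Type u := (∀ i, V i) ⧸ uNullSubmodule U k V

instance : AddCommGroup (UVec U k V) :=
  inferInstanceAs (AddCommGroup ((∀ i, V i) ⧸ uNullSubmodule U k V))

theorem isTorsionBySet_uNull :
    Module.IsTorsionBySet (∀ i, k i) ((∀ i, V i) ⧸ uNullSubmodule U k V) (uNullIdeal U k) := by
  rintro x ⟨a, ha⟩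
  obtain ⟨v, rfl⟩ := Submodule.Quotient.mk_surjective _ x
  rw [← Submodule.Quotient.mk_smul, Submodule.Quotient.mk_eq_zero]
  have ha' : ∀ᶠ i in U, a i = 0 := ha
  change ∀ᶠ i in U, (a • v) i = 0
  filter_upwards [ha'] with i hi
  simp [hi]

/-- Scalar multiplication on the ultraproduct is `[a i] • [v i] = [a i • v i]`. -/
instance : Module (UField U k) (UVec U k V) :=
  (isTorsionBySet_uNull U k V).module

variable {k} in
/-- The class of a family of scalars. -/
def UField.mk (a : ∀ i, k i) : UField U k := Ideal.Quotient.mk (uNullIdeal U k) a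

variable {V} in
/-- The class of a family of vectors. -/
def UVec.mk (v : ∀ i, V i) : UVec U k V := Submodule.Quotient.mk v

variable {k V}

theorem UField.ind {p : UField U k → Prop} (h : ∀ a, p (UField.mk U a)) (x : UField U k) : p x :=
  Quotient.ind h x

theorem UVec.ind {p : UVec U k V → Prop} (h : ∀ v, p (UVec.mk U k v)) (x : UVec U k V) : p x :=
  Quotient.ind h x

theorem UVec.mk_eq_mk {v w : ∀ i, V i} :
    UVec.mk U k v = UVec.mk U k w ↔ ∀ᶠ i in U, v i = w i := by
  refine (Submodule.Quotient.eq _).trans ?_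
  change (∀ᶠ i in U, (v - w) i = 0) ↔ _
  simp only [Pi.sub_apply, sub_eq_zero]

theorem UVec.mk_add (v w : ∀ i, V i) :
    UVec.mk U k v + UVec.mk U k w = UVec.mk U k (fun i => v i + w i) := rfl

theorem UVec.mk_smul (a : ∀ i, k i) (v : ∀ i, V i) :
    UField.mk U a • UVec.mk U k v = UVec.mk U k (fun i => a i • v i) := rfl

variable (k) in
/-- The map on ultraproducts induced by a family of maps. -/
def UVec.map {W : ι → Type u} [∀ i, AddCommGroup (W i)] [∀ i, Module (k i) (W i)]
    (f : ∀ i, V i → W i) : UVec U k V → UVec U k W :=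
  Quotient.lift (fun v => UVec.mk U k fun i => f i (v i)) fun v w h => by
    have h' : UVec.mk U k v = UVec.mk U k w := Quotient.sound h
    rw [UVec.mk_eq_mk] at h' ⊢
    filter_upwards [h'] with i hi
    rw [hi]

variable (k) in
/-- The map on ultraproducts induced by a family of maps in two variables. -/
def UVec.map₂ {W X : ι → Type u} [∀ i, AddCommGroup (W i)] [∀ i, Module (k i) (W i)]
    [∀ i, AddCommGroup (X i)] [∀ i, Module (k i) (X i)]
    (f : ∀ i, V i → W i → X i) : UVec U k V → UVec U k W → UVec U k X :=
  Quotient.lift₂ (fun v w => UVec.mk U k fun i => f i (v i) (w i)) fun v w v' w' h h' => by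
    have h1 : UVec.mk U k v = UVec.mk U k v' := Quotient.sound h
    have h2 : UVec.mk U k w = UVec.mk U k w' := Quotient.sound h'
    rw [UVec.mk_eq_mk] at h1 h2 ⊢
    filter_upwards [h1, h2] with i hi hi'
    rw [hi, hi']

/-- The ultraproduct of almost everywhere boundedly finite-dimensional spaces is
finite-dimensional. -/
theorem UVec.finite [∀ i, Module.Finite (k i) (V i)]
    (h : ∃ d : ℕ, ∀ᶠ i in U, Module.finrank (k i) (V i) ≤ d) :
    Module.Finite (UField U k) (UVec U k V) := by
  classical
  obtain ⟨d, hd⟩ := h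
  have key : ∀ i, ∃ b : Fin d → V i, Module.finrank (k i) (V i) ≤ d →
      ∀ v : V i, ∃ a : Fin d → k i, v = ∑ j, a j • b j := by
    intro i
    by_cases hi : Module.finrank (k i) (V i) ≤ d
    · let B := Module.finBasis (k i) (V i)
      refine ⟨fun j => if hj : (j : ℕ) < Module.finrank (k i) (V i) then B ⟨j, hj⟩ else 0,
        fun _ v => ⟨fun j => if hj : (j : ℕ) < Module.finrank (k i) (V i)
          then B.repr v ⟨j, hj⟩ else 0, ?_⟩⟩
      conv_lhs => rw [← B.sum_repr v]
      refine Finset.sum_of_injOn (Fin.castLE hi) (Fin.castLE_injective hi).injOn (by simp) ?_ ?_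
      · intro j _ hj
        have hj' : ¬ (j : ℕ) < Module.finrank (k i) (V i) := fun hlt =>
          hj ⟨⟨j, hlt⟩, by simp, by ext; simp⟩
        simp [hj']
      · intro j _
        simp
    · exact ⟨fun _ => 0, fun h => absurd h hi⟩
  choose b hb using key
  refine ⟨⟨Finset.univ.image fun j : Fin d => UVec.mk U k fun i => b i j, ?_⟩⟩
  rw [eq_top_iff]
  rintro x -
  revert x
  refine UVec.ind U fun v => ?_
  have hv : ∀ i, ∃ a : Fin d → k i, Module.finrank (k i) (V i) ≤ d → v i = ∑ j, a j • b i j := by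
    intro i
    by_cases hi : Module.finrank (k i) (V i) ≤ d
    · obtain ⟨a, ha⟩ := hb i hi (v i)
      exact ⟨a, fun _ => ha⟩
    · exact ⟨0, fun h => absurd h hi⟩
  choose a ha using hv
  have hsum : ∀ s : Finset (Fin d), UVec.mk U k (fun i => ∑ j ∈ s, a i j • b i j) =
      ∑ j ∈ s, UField.mk U (fun i => a i j) • UVec.mk U k (fun i => b i j) := by
    intro s
    induction s using Finset.cons_induction with
    | empty => simp only [Finset.sum_empty]; rfl
    | cons j s hj ih =>
      simp only [Finset.sum_cons]
      rw [← ih, UVec.mk_smul, UVec.mk_add]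
  have he : UVec.mk U k v = UVec.mk U k (fun i => ∑ j, a i j • b i j) := by
    rw [UVec.mk_eq_mk]
    filter_upwards [hd] with i hi
    exact ha i hi
  rw [he, hsum]
  refine Submodule.sum_mem _ fun j _ => Submodule.smul_mem _ _ (Submodule.subset_span ?_)
  simp

end Vec

section Category

variable (k : ι → Type u) [∀ i, Field (k i)]

/-- Objects of the ultraproduct of the categories `C i` are represented by families of objects. -/
structure UCat (U : Ultrafilter ι) (k : ι → Type u) (C : ι → Type v) : Type v where
  /-- the family of objects -/
  obj : ∀ i, C i

variable {C : ι → Type v} [∀ i, Category.{u} (C i)] [∀ i, Preadditive (C i)]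
  [∀ i, Linear (k i) (C i)]

namespace UCat

/-- A morphism of the ultraproduct is a family of morphisms modulo almost everywhere equality, and
composition is `[f i] ≫ [g i] = [f i ≫ g i]`. -/
instance : Category.{u} (UCat U k C) where
  Hom X Y := UVec U k fun i => X.obj i ⟶ Y.obj i
  id X := UVec.mk U k fun i => 𝟙 (X.obj i)
  comp f g := UVec.map₂ U k (fun _ => CategoryStruct.comp) f g
  id_comp f := by
    revert f
    exact UVec.ind U fun f => congrArg (UVec.mk U k) (funext fun i => Category.id_comp (f i))
  comp_id f := by
    revert f
    exact UVec.ind U fun f => congrArg (UVec.mk U k) (funext fun i => Category.comp_id (f i))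
  assoc f g h := by
    revert f; refine UVec.ind U fun f => ?_
    revert g; refine UVec.ind U fun g => ?_
    revert h; refine UVec.ind U fun h => ?_
    exact congrArg (UVec.mk U k) (funext fun i => Category.assoc (f i) (g i) (h i))

variable {U k}

/-- The class of a family of morphisms. -/
def homMk {X Y : UCat U k C} (f : ∀ i, X.obj i ⟶ Y.obj i) : X ⟶ Y := UVec.mk U k f

theorem hom_ind {X Y : UCat U k C} {p : (X ⟶ Y) → Prop} (h : ∀ f, p (homMk f)) (f : X ⟶ Y) :
    p f := UVec.ind U h f

theorem homMk_eq {X Y : UCat U k C} {f g : ∀ i, X.obj i ⟶ Y.obj i} :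
    (homMk f : X ⟶ Y) = homMk g ↔ ∀ᶠ i in U, f i = g i := UVec.mk_eq_mk U

theorem homMk_congr {X Y : UCat U k C} {f g : ∀ i, X.obj i ⟶ Y.obj i} (h : ∀ i, f i = g i) :
    (homMk f : X ⟶ Y) = homMk g := congrArg homMk (funext h)

theorem homMk_comp {X Y Z : UCat U k C} (f : ∀ i, X.obj i ⟶ Y.obj i)
    (g : ∀ i, Y.obj i ⟶ Z.obj i) :
    (homMk f : X ⟶ Y) ≫ (homMk g : Y ⟶ Z) = homMk fun i => f i ≫ g i := rfl

instance (X Y : UCat U k C) : AddCommGroup (X ⟶ Y) :=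
  inferInstanceAs (AddCommGroup (UVec U k fun i => X.obj i ⟶ Y.obj i))

instance (X Y : UCat U k C) : Module (UField U k) (X ⟶ Y) :=
  inferInstanceAs (Module (UField U k) (UVec U k fun i => X.obj i ⟶ Y.obj i))

instance : Preadditive (UCat U k C) where
  add_comp X Y Z f f' g := by
    revert f; refine hom_ind fun f => ?_
    revert f'; refine hom_ind fun f' => ?_
    revert g; refine hom_ind fun g => ?_
    exact homMk_congr fun i => Preadditive.add_comp _ _ _ (f i) (f' i) (g i)
  comp_add X Y Z f g g' := by
    revert f; refine hom_ind fun f => ?_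
    revert g; refine hom_ind fun g => ?_
    revert g'; refine hom_ind fun g' => ?_
    exact homMk_congr fun i => Preadditive.comp_add _ _ _ (f i) (g i) (g' i)

instance : Linear (UField U k) (UCat U k C) where
  smul_comp X Y Z a f g := by
    revert a; refine UField.ind U fun a => ?_
    revert f; refine hom_ind fun f => ?_
    revert g; refine hom_ind fun g => ?_
    exact homMk_congr fun i => Linear.smul_comp _ _ _ (a i) (f i) (g i)
  comp_smul X Y Z f a g := by
    revert a; refine UField.ind U fun a => ?_
    revert f; refine hom_ind fun f => ?_
    revert g; refine hom_ind fun g => ?_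
    exact homMk_congr fun i => Linear.comp_smul _ _ _ (f i) (a i) (g i)

/-- A family of isomorphisms gives an isomorphism. -/
def isoMk {X Y : UCat U k C} (e : ∀ i, X.obj i ≅ Y.obj i) : X ≅ Y where
  hom := homMk fun i => (e i).hom
  inv := homMk fun i => (e i).inv
  hom_inv_id := homMk_congr fun i => (e i).hom_inv_id
  inv_hom_id := homMk_congr fun i => (e i).inv_hom_id

variable [∀ i, MonoidalCategory (C i)]

/-- The tensor product is `[X i] ⊗ [Y i] = [X i ⊗ Y i]`. -/
instance : MonoidalCategoryStruct (UCat U k C) where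
  tensorObj X Y := ⟨fun i => X.obj i ⊗ Y.obj i⟩
  whiskerLeft X _ _ f := UVec.map U k (fun i => MonoidalCategoryStruct.whiskerLeft (X.obj i)) f
  whiskerRight f Y :=
    UVec.map U k (fun i f => MonoidalCategoryStruct.whiskerRight f (Y.obj i)) f
  tensorHom f g := UVec.map₂ U k (fun _ => MonoidalCategoryStruct.tensorHom) f g
  tensorUnit := ⟨fun i => 𝟙_ (C i)⟩
  associator X Y Z := isoMk fun i => α_ (X.obj i) (Y.obj i) (Z.obj i)
  leftUnitor X := isoMk fun i => λ_ (X.obj i)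
  rightUnitor X := isoMk fun i => ρ_ (X.obj i)

instance : MonoidalCategory (UCat U k C) where
  tensorHom_def f g := by
    revert f; refine hom_ind fun f => ?_
    revert g; refine hom_ind fun g => ?_
    exact homMk_congr fun i => MonoidalCategory.tensorHom_def (f i) (g i)
  id_tensorHom_id X Y := homMk_congr fun i => MonoidalCategory.id_tensorHom_id _ _
  tensorHom_comp_tensorHom f g h l := by
    revert f; refine hom_ind fun f => ?_
    revert g; refine hom_ind fun g => ?_
    revert h; refine hom_ind fun h => ?_
    revert l; refine hom_ind fun l => ?_
    exact homMk_congr fun i =>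
      MonoidalCategory.tensorHom_comp_tensorHom (f i) (g i) (h i) (l i)
  whiskerLeft_id X Y := homMk_congr fun i => MonoidalCategory.whiskerLeft_id _ _
  id_whiskerRight X Y := homMk_congr fun i => MonoidalCategory.id_whiskerRight _ _
  associator_naturality f g h := by
    revert f; refine hom_ind fun f => ?_
    revert g; refine hom_ind fun g => ?_
    revert h; refine hom_ind fun h => ?_
    exact homMk_congr fun i => MonoidalCategory.associator_naturality (f i) (g i) (h i)
  leftUnitor_naturality f := by
    revert f; refine hom_ind fun f => ?_
    exact homMk_congr fun i => MonoidalCategory.leftUnitor_naturality (f i)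
  rightUnitor_naturality f := by
    revert f; refine hom_ind fun f => ?_
    exact homMk_congr fun i => MonoidalCategory.rightUnitor_naturality (f i)
  pentagon W X Y Z := homMk_congr fun i => MonoidalCategory.pentagon _ _ _ _
  triangle X Y := homMk_congr fun i => MonoidalCategory.triangle _ _

instance [∀ i, SymmetricCategory (C i)] : SymmetricCategory (UCat U k C) where
  braiding X Y := isoMk fun i => β_ (X.obj i) (Y.obj i)
  braiding_naturality_right X Y Z f := by
    revert f; refine hom_ind fun f => ?_
    exact homMk_congr fun i => BraidedCategory.braiding_naturality_right _ (f i)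
  braiding_naturality_left f Z := by
    revert f; refine hom_ind fun f => ?_
    exact homMk_congr fun i => BraidedCategory.braiding_naturality_left (f i) _
  hexagon_forward X Y Z := homMk_congr fun i => BraidedCategory.hexagon_forward _ _ _
  hexagon_reverse X Y Z := homMk_congr fun i => BraidedCategory.hexagon_reverse _ _ _
  symmetry X Y := homMk_congr fun i => SymmetricCategory.symmetry _ _

end UCat

end Category

end Ultraproduct


section RestrictedUltraproduct

/-- `Rep_k G^J`: finite-dimensional representations over `k` of the direct power `G^J`, as
comodules over its Hopf algebra. -/
abbrev RepPow (k : Type u) [Field k] (G : UnipotentGroup) (J : Type) : Type (u + 1) :=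
  FDComod k (G.HopfAlg J k)

/-- `Rep_k G`. -/
abbrev RepOne (k : Type u) [Field k] (G : UnipotentGroup) : Type (u + 1) := RepPow k G Unit

/-- Let `(a r s)` be the matrix formula of a representation of `G` in some basis, i.e. the comodule
map is `e s ↦ ∑ r, e r ⊗ a r s`.  The matrix of `coeffMap V d` in that basis is formed by the
coefficients of the monomial with exponent `d` in the polynomials `a r s`. -/
def RepOne.coeffMap {k : Type u} [Field k] {G : UnipotentGroup} (V : RepOne k G)
    (d : Unit × Fin G.dim →₀ ℕ) : V →ₗ[k] V :=
  (TensorProduct.rid k V).toLinearMap ∘ₗ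
    (UnipotentGroup.HopfAlg.lcoeff k d).lTensor V ∘ₗ V.coact

/-- The height of a representation of `G` over a field of characteristic `p > 0`: the largest `m`
such that, for some coordinate `x` of `G`, the monomial `x ^ (p ^ (m - 1))` occurs in the matrix
formula; it is `0` if there is no such `m`. -/
def RepOne.height {k : Type u} [Field k] {G : UnipotentGroup} (V : RepOne k G) : ℕ∞ :=
  ⨆ (m : ℕ) (_ : ∃ c : Fin G.dim,
    V.coeffMap (Finsupp.single ((), c) (ringChar k ^ m)) ≠ 0), ((m + 1 : ℕ) : ℕ∞)

variable {ι : Type} (U : Ultrafilter ι) (k : ι → Type u) [∀ i, Field (k i)]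

section Bounded

variable (A : ι → Type u) [∀ i, CommRing (A i)] [∀ i, Bialgebra (k i) (A i)]

/-- The objects `[X i]` of the ultraproduct whose dimensions are almost everywhere bounded. -/
def boundedDim : ObjectProperty (UCat U k fun i => FDComod (k i) (A i)) := fun X =>
  ∃ d : ℕ, ∀ᶠ i in U, Module.finrank (k i) (X.obj i) ≤ d

instance : (boundedDim U k A).IsMonoidal where
  prop_unit := ⟨1, .of_forall fun i => (Module.finrank_self (k i)).le⟩
  prop_tensor X Y hX hY := by
    obtain ⟨d, hd⟩ := hX
    obtain ⟨e, he⟩ := hY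
    refine ⟨d * e, ?_⟩
    filter_upwards [hd, he] with i h h'
    exact (Module.finrank_tensorProduct (R := k i) (S := k i)
      (M := X.obj i) (M' := Y.obj i)).trans_le (Nat.mul_le_mul h h')

/-- The restricted ultraproduct of the categories of comodules: the full subcategory of the
ultraproduct on the objects of almost everywhere bounded dimension. -/
abbrev RestrProd : Type (u + 1) := (boundedDim U k A).FullSubcategory

/-- The functor `[X i] ↦ ∏_U X i`, `[f i] ↦ ∏_U f i` from the restricted ultraproduct to
finite-dimensional vector spaces over the ultraproduct of the fields. -/
def ultraFibre : RestrProd U k A ⥤ FGModuleCat.{u} (UField U k) where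
  obj X :=
    haveI : Module.Finite (UField U k) (UVec U k fun i => (X.obj.obj i : Type u)) :=
      UVec.finite U X.property
    FGModuleCat.of (UField U k) (UVec U k fun i => (X.obj.obj i : Type u))
  map {X Y} f :=
    haveI : Module.Finite (UField U k) (UVec U k fun i => (X.obj.obj i : Type u)) :=
      UVec.finite U X.property
    haveI : Module.Finite (UField U k) (UVec U k fun i => (Y.obj.obj i : Type u)) :=
      UVec.finite U Y.property
    FGModuleCat.ofHom
      { toFun := fun v => UVec.map₂ U k
          (fun i (g : X.obj.obj i ⟶ Y.obj.obj i) (x : X.obj.obj i) => g.lin x) f.hom v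
        map_add' := by
          obtain ⟨f⟩ := f
          revert f; refine UCat.hom_ind fun f => ?_
          refine UVec.ind U fun v => UVec.ind U fun w => ?_
          exact congrArg (UVec.mk U k) (funext fun i => map_add (f i).lin (v i) (w i))
        map_smul' := by
          obtain ⟨f⟩ := f
          revert f; refine UCat.hom_ind fun f => ?_
          refine UField.ind U fun a => UVec.ind U fun v => ?_
          exact congrArg (UVec.mk U k) (funext fun i => map_smul (f i).lin (a i) (v i)) }
  map_id X := by
    ext v
    revert v
    exact UVec.ind U fun v => rfl
  map_comp {X Y Z} f g := by
    obtain ⟨f⟩ := f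
    obtain ⟨g⟩ := g
    revert f; refine UCat.hom_ind fun f => ?_
    revert g; refine UCat.hom_ind fun g => ?_
    ext v
    revert v
    exact UVec.ind U fun v => rfl

end Bounded

variable (G : UnipotentGroup)

/-- The restricted ultraproduct `∏_R Rep_{k i} G`. -/
abbrev RestrRep : Type (u + 1) := RestrProd U k fun i => G.HopfAlg Unit (k i)

variable {U k G} in
/-- The height of `[X i]` is the essential supremum of the heights of the `X i`: the least `h` with
`height (X i) ≤ h` for almost all `i`. -/
def RestrRep.height (X : RestrRep U k G) : ℕ∞ :=
  Filter.limsup (fun i => RepOne.height (X.obj.obj i : RepOne (k i) G)) (U : Filter ι)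

/-- The objects of finite height. -/
def finiteHeight : ObjectProperty (RestrRep U k G) := fun X => X.height < ⊤

/-- The objects of height at most `n`. -/
def heightLE (n : ℕ) : ObjectProperty (RestrRep U k G) := fun X => X.height ≤ n

/-- The height-restricted ultraproduct `∏_H Rep_{k i} G`. -/
abbrev HeightRestrRep : Type (u + 1) := (finiteHeight U k G).FullSubcategory

/-- The full subcategory `∏_{H ≤ n} Rep_{k i} G`. -/
abbrev HeightLERep (n : ℕ) : Type (u + 1) := (heightLE U k G n).FullSubcategory

end RestrictedUltraproduct

section Tannakian

universe w v₁ u₁ v₂ u₂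

/-- Abelian category, for a given preadditive structure. -/
structure IsAbelianCat (C : Type u₁) [Category.{v₁} C] [Preadditive C] : Prop where
  hasFiniteProducts : HasFiniteProducts C
  hasKernels : HasKernels C
  hasCokernels : HasCokernels C
  normalMono : IsNormalMonoCategory C
  normalEpi : IsNormalEpiCategory C

/-- Tannakian category: a rigid abelian symmetric monoidal category with bi-additive tensor product
in which `End(1)` is a field. -/
structure IsTannakian (C : Type u₁) [Category.{v₁} C] [Preadditive C] [MonoidalCategory C]
    [SymmetricCategory C] : Prop where
  abelian : IsAbelianCat C
  biadditive : MonoidalPreadditive C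
  rigid : Nonempty (RigidCategory C)
  isField : IsField (End (𝟙_ C))

/-- Fibre functor: a `k`-linear, exact, faithful, symmetric (strong) monoidal functor to
finite-dimensional vector spaces over `k`. -/
structure IsFibreFunctor (k : Type w) [Field k] {C : Type u₁} [Category.{v₁} C] [Preadditive C]
    [Linear k C] [MonoidalCategory C] [SymmetricCategory C] (ω : C ⥤ FGModuleCat.{w} k) :
    Prop where
  additive : ω.Additive
  linear : ω.Linear k
  leftExact : PreservesFiniteLimits ω
  rightExact : PreservesFiniteColimits ω
  faithful : ω.Faithful
  symmetric : Nonempty ω.Braided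

/-- Neutral tannakian category over `k` with fibre functor `ω`: a tannakian category in which `k`
is identified with the field `End(1)` by its action on the unit object, together with the fibre
functor `ω`. -/
structure IsNeutralTannakian (k : Type w) [Field k] (C : Type u₁) [Category.{v₁} C]
    [Preadditive C] [Linear k C] [MonoidalCategory C] [SymmetricCategory C]
    (ω : C ⥤ FGModuleCat.{w} k) : Prop where
  tannakian : IsTannakian C
  scalars : Function.Bijective fun a : k => (a • 𝟙 (𝟙_ C) : End (𝟙_ C))
  fibre : IsFibreFunctor k ω

/-- `k`-linear tensor equivalence: an equivalence of categories which is `k`-linear and symmetric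
(strong) monoidal. -/
def TensorEquivalent (k : Type w) [Field k]
    (C : Type u₁) [Category.{v₁} C] [Preadditive C] [Linear k C] [MonoidalCategory C]
    [SymmetricCategory C]
    (D : Type u₂) [Category.{v₂} D] [Preadditive D] [Linear k D] [MonoidalCategory D]
    [SymmetricCategory D] : Prop :=
  ∃ F : C ⥤ D, F.IsEquivalence ∧ F.Additive ∧ F.Linear k ∧ Nonempty F.Braided

end Tannakian

end

/-! In the basis of monomials, a finite-dimensional comodule over the Hopf algebra of `G^J` is a
finitely supported family of endomorphisms `coef V e` with `coef V 0 = id` and `coef V e ∘ coef V f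
= ∑ g, comulCoeff e f g • coef V g` (`coef_zero`, `coef_comp`; conversely `ofCoef`). The constants
`comulCoeff` are integers independent of the field. Hence such families pass to ultraproducts, as
soon as one finite set of exponents serves almost every index. In characteristic `p` the exponents
themselves are not bounded, because powers of `p` occur in them, but their base `p` digits are.

Along a coordinate axis the composite of the coefficients at `m` and `n` is `(m + n).choose m` times
the coefficient at `m + n`. Let `A j` be the coefficient at `p ^ j`. By Lucas' theorem the
coefficient at `n` factors through `A j ^ s`, where `s` is the `j`-th digit of `n`. Since `A j` is
nilpotent, `A j ^ d = 0` for every bound `d` on the dimension. So all digits of an occurring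
exponent are less than `d` (`coef_axis_digit_lt`), and they vanish at the positions `j` with `A j =
0` (`coef_axis_pow_ne_zero`), in particular at those beyond the height. For the Heisenberg group a
general coefficient is a composite of coefficients on the three axes (`coef_axis_ne_zero`). With
bounded dimension and height, every occurring exponent is thus the `twist` of an exponent for `G^J`
from a finite box independent of the index (`exists_twist_eq`): the representation looks like a
pullback along `G → G^J`, `x ↦ (x ^ (p ^ ν j))`. Once `p` exceeds the digits in play there are no
carries, so `twist` is injective on a given finite set, and the structure constants at twisted
exponents are those of `G^J` (`comulCoeff_twist`).

The ultraproduct of the coefficients at twisted exponents defines `toRep`, on the objects of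
`finiteType`. It is full because an intertwiner has to respect only finitely many coefficients. It
is essentially surjective because finitely many matrices and the relations between them lift to
almost every index, where `frobPull` turns them into a representation of `G`. It is monoidal because
tensor products convolve coefficients. Finite height is `finiteType` for `id : ℕ → ℕ`, and height at
most `n` is `finiteType` for `Fin.val : Fin n → ℕ`. The tannakian properties are transported from
comodules over `G^J`, and the inclusion is exact because kernels and cokernels are formed
componentwise. -/

noncomputable section

/-! ### Integral structure constants in the basis of monomials. -/

namespace UnipotentGroup

/-- Exponents of monomials in the coordinates of `G^J`. -/
abbrev Expo (G : UnipotentGroup) (J : Type) : Type := J × Fin G.dim →₀ ℕ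

/-- The universal comultiplication of the monomial with exponent `g`, as an integral polynomial in
two copies of the coordinates. -/
def comulPoly {G : UnipotentGroup} {J : Type} (g : G.Expo J) :
    MvPolynomial ((J × Fin G.dim) ⊕ (J × Fin G.dim)) ℤ :=
  g.prod fun s n => (G.mul (fun c => MvPolynomial.X (Sum.inl (s.1, c)))
    (fun c => MvPolynomial.X (Sum.inr (s.1, c))) s.2) ^ n

/-- The structure constants of the comultiplication in the basis of monomials. -/
def comulCoeff {G : UnipotentGroup} {J : Type} (e f g : G.Expo J) : ℤ :=
  (comulPoly g).coeff (Finsupp.sumFinsuppEquivProdFinsupp.symm (e, f))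

namespace HopfAlg

variable {G : UnipotentGroup} {J : Type} {k : Type u} [Field k]

variable (k) in
/-- The monomial with exponent `e`. -/
def mono (e : G.Expo J) : HopfAlg G J k :=
  (MvPolynomial.monomial e 1 : MvPolynomial (J × Fin G.dim) k)

variable (G J k) in
/-- The basis of monomials. -/
def basis : Module.Basis (G.Expo J) k (HopfAlg G J k) :=
  (MvPolynomial.basisMonomials (J × Fin G.dim) k :)

@[simp] theorem basis_apply (e : G.Expo J) : basis G J k e = mono k e := rfl

theorem basis_repr_apply (a : HopfAlg G J k) (e : G.Expo J) :
    (basis G J k).repr a e = lcoeff k e a := rfl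

theorem mono_add (e f : G.Expo J) : mono k (e + f) = mono k e * mono k f := by
  unfold mono
  exact (by simp [MvPolynomial.monomial_mul] :
    (MvPolynomial.monomial (e + f) 1 : MvPolynomial (J × Fin G.dim) k) =
      MvPolynomial.monomial e 1 * MvPolynomial.monomial f 1)

theorem mono_zero : mono k (0 : G.Expo J) = 1 := rfl

theorem mono_single (j : J) (c : Fin G.dim) (n : ℕ) :
    mono k (Finsupp.single (j, c) n : G.Expo J) = coord k j c ^ n :=
  MvPolynomial.X_pow_eq_monomial.symm

theorem mono_eq_prod (e : G.Expo J) : mono k e = e.prod fun s n => coord k s.1 s.2 ^ n :=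
  MvPolynomial.monomial_eq.trans (by rw [MvPolynomial.C_1, one_mul]; rfl)

theorem lcoeff_mono [DecidableEq J] (e f : G.Expo J) :
    lcoeff k e (mono k f) = if f = e then 1 else 0 :=
  (MvPolynomial.coeff_monomial e f (1 : k) :)

theorem lift_mono {B : Type*} [CommRing B] [Algebra k B] (f : J → Fin G.dim → B) (e : G.Expo J) :
    lift f (mono k e) = e.prod fun s n => f s.1 s.2 ^ n := by
  rw [mono_eq_prod, map_finsuppProd]
  simp

theorem counit_mono [DecidableEq J] (e : G.Expo J) :
    Coalgebra.counit (R := k) (mono k e) = if e = 0 then 1 else 0 := by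
  change lift (fun _ _ => (0 : k)) (mono k e) = _
  rw [lift_mono]
  split_ifs with h
  · subst h; simp
  · obtain ⟨s, hs⟩ := Finsupp.support_nonempty_iff.2 h
    exact Finset.prod_eq_zero hs (zero_pow (Finsupp.mem_support_iff.1 hs))

/-- The coefficient of `X ^ e ⊗ X ^ f`. -/
def lcoeff₂ (e f : G.Expo J) : HopfAlg G J k ⊗[k] HopfAlg G J k →ₗ[k] k :=
  LinearMap.mul' k k ∘ₗ TensorProduct.map (lcoeff k e) (lcoeff k f)

@[simp] theorem lcoeff₂_tmul (e f : G.Expo J) (a b : HopfAlg G J k) :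
    lcoeff₂ e f (a ⊗ₜ b) = lcoeff k e a * lcoeff k f b := rfl

theorem tensorProduct_basis_coord (e f : G.Expo J) :
    ((basis G J k).tensorProduct (basis G J k)).coord (e, f) = lcoeff₂ e f := by
  refine TensorProduct.ext' fun a b => ?_
  simp [Module.Basis.tensorProduct_repr_tmul_apply, basis_repr_apply, mul_comm]

theorem lcoeff₂_ext {x y : HopfAlg G J k ⊗[k] HopfAlg G J k}
    (h : ∀ e f, lcoeff₂ e f x = lcoeff₂ e f y) : x = y := by
  refine ((basis G J k).tensorProduct (basis G J k)).ext_elem fun ⟨e, f⟩ => ?_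
  have := h e f
  rwa [← tensorProduct_basis_coord] at this

/-- The two copies of the coordinates in the tensor square. -/
def twoCoord (s : (J × Fin G.dim) ⊕ (J × Fin G.dim)) : HopfAlg G J k ⊗[k] HopfAlg G J k :=
  s.elim (fun s => coord k s.1 s.2 ⊗ₜ 1) (fun s => 1 ⊗ₜ coord k s.1 s.2)

/-- The group law has integer coefficients, so one polynomial over `ℤ` specialises to the
comultiplication over every field. -/
theorem comul_mono (g : G.Expo J) :
    Coalgebra.comul (R := k) (mono k g) =
      MvPolynomial.eval₂ (Int.castRingHom _) twoCoord (comulPoly g) := by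
  change lift (fun j => G.mul (fun c => coord k j c ⊗ₜ 1) (fun c => 1 ⊗ₜ coord k j c))
    (mono k g) = _
  rw [lift_mono, ← MvPolynomial.coe_eval₂Hom, comulPoly, map_finsuppProd]
  refine Finsupp.prod_congr fun s _ => ?_
  rw [map_pow, map_mul']
  simp [twoCoord]

theorem eval₂_monomial_twoCoord (e f : G.Expo J) (z : ℤ) :
    MvPolynomial.eval₂ (Int.castRingHom (HopfAlg G J k ⊗[k] HopfAlg G J k)) twoCoord
      (MvPolynomial.monomial (Finsupp.sumFinsuppEquivProdFinsupp.symm (e, f)) z) =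
    (z : k) • (mono k e ⊗ₜ[k] mono k f) := by
  rw [MvPolynomial.eval₂_monomial]
  have h : (Finsupp.sumFinsuppEquivProdFinsupp.symm (e, f)).prod
      (fun s n => (twoCoord s : HopfAlg G J k ⊗[k] HopfAlg G J k) ^ n) = mono k e ⊗ₜ mono k f := by
    change (Finsupp.sumElim e f).prod _ = _
    rw [Finsupp.prod_sumElim]
    rw [mono_eq_prod, mono_eq_prod]
    have e1 := map_finsuppProd (Algebra.TensorProduct.includeLeft (R := k) (S := k)
      (A := HopfAlg G J k) (B := HopfAlg G J k)) e (fun s n => coord k s.1 s.2 ^ n)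
    have e2 := map_finsuppProd (Algebra.TensorProduct.includeRight (R := k)
      (A := HopfAlg G J k) (B := HopfAlg G J k)) f (fun s n => coord k s.1 s.2 ^ n)
    simp only [map_pow, Algebra.TensorProduct.includeLeft_apply,
      Algebra.TensorProduct.includeRight_apply] at e1 e2
    refine (congrArg₂ (· * ·) e1.symm e2.symm).trans ?_
    rw [Algebra.TensorProduct.tmul_mul_tmul, mul_one, one_mul]
  rw [h, Algebra.smul_def]
  simp

theorem lcoeff₂_comul_mono (e f g : G.Expo J) :
    lcoeff₂ e f (Coalgebra.comul (R := k) (mono k g)) = (comulCoeff e f g : k) := by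
  classical
  rw [comul_mono, comulCoeff]
  -- Both sides are additive in the integral polynomial, so it suffices to compare them on single
  -- monomials.
  generalize comulPoly g = P
  induction P using MvPolynomial.induction_on' with
  | monomial m z =>
    obtain ⟨⟨e', f'⟩, rfl⟩ := Finsupp.sumFinsuppEquivProdFinsupp.symm.surjective m
    rw [eval₂_monomial_twoCoord, MvPolynomial.coeff_monomial]
    simp only [map_smul, lcoeff₂_tmul, lcoeff_mono, EmbeddingLike.apply_eq_iff_eq, Prod.mk.injEq]
    split_ifs <;> simp_all
  | add p q hp hq => simp [MvPolynomial.eval₂_add, hp, hq]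

end HopfAlg

/-- Up to finitely many exceptions, independent of the field, the structure constants for the
monomials in a finite set vanish. -/
theorem finite_comulCoeff {G : UnipotentGroup} {J : Type} (S : Finset (G.Expo J)) :
    ∃ T : Finset (G.Expo J), ∀ g ∈ S, ∀ e f, comulCoeff e f g ≠ 0 → e ∈ T ∧ f ∈ T := by
  classical
  -- The left and right halves of all exponents occurring in the integral polynomials.
  refine ⟨S.biUnion fun g => (comulPoly g).support.image
      (fun m => (Finsupp.sumFinsuppEquivProdFinsupp m).1) ∪ (comulPoly g).support.image
      (fun m => (Finsupp.sumFinsuppEquivProdFinsupp m).2), fun g hg e f h => ?_⟩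
  have hm := MvPolynomial.mem_support_iff.2 h
  constructor
  · exact Finset.mem_biUnion.2 ⟨g, hg, Finset.mem_union_left _
      (Finset.mem_image.2 ⟨_, hm, by simp⟩)⟩
  · exact Finset.mem_biUnion.2 ⟨g, hg, Finset.mem_union_right _
      (Finset.mem_image.2 ⟨_, hm, by simp⟩)⟩

end UnipotentGroup
end
-- Comodules as finite families of coefficient endomorphisms.
noncomputable section

namespace FDComod

open UnipotentGroup UnipotentGroup.HopfAlg

variable {G : UnipotentGroup} {J : Type} {k : Type u} [Field k]

section Coeff

variable (V : Type*) [AddCommGroup V] [Module k V]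

/-- The coefficient of `X ^ e` of a polynomial with coefficients in `V`. -/
def tcoeff (e : G.Expo J) : V ⊗[k] HopfAlg G J k →ₗ[k] V :=
  (TensorProduct.rid k V).toLinearMap ∘ₗ (lcoeff k e).lTensor V

/-- The coefficient of `X ^ e ⊗ X ^ f`. -/
def tcoeff₂ (e f : G.Expo J) : V ⊗[k] (HopfAlg G J k ⊗[k] HopfAlg G J k) →ₗ[k] V :=
  (TensorProduct.rid k V).toLinearMap ∘ₗ (lcoeff₂ e f).lTensor V

variable {V}

@[simp] theorem tcoeff_tmul (e : G.Expo J) (v : V) (a : HopfAlg G J k) :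
    tcoeff V e (v ⊗ₜ[k] a) = lcoeff k e a • v := rfl

@[simp] theorem tcoeff₂_tmul (e f : G.Expo J) (v : V) (a : HopfAlg G J k ⊗[k] HopfAlg G J k) :
    tcoeff₂ V e f (v ⊗ₜ[k] a) = lcoeff₂ e f a • v := rfl

theorem tcoeff_ext {x y : V ⊗[k] HopfAlg G J k} (h : ∀ e, tcoeff V e x = tcoeff V e y) :
    x = y := by
  classical
  refine (TensorProduct.equivFinsuppOfBasisRight (M := V) (basis G J k)).injective ?_
  ext e
  rw [TensorProduct.equivFinsuppOfBasisRight_apply, TensorProduct.equivFinsuppOfBasisRight_apply]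
  exact h e

theorem tcoeff₂_ext {x y : V ⊗[k] (HopfAlg G J k ⊗[k] HopfAlg G J k)}
    (h : ∀ e f, tcoeff₂ V e f x = tcoeff₂ V e f y) : x = y := by
  classical
  refine (TensorProduct.equivFinsuppOfBasisRight (M := V)
    ((basis G J k).tensorProduct (basis G J k))).injective ?_
  ext ⟨e, f⟩
  rw [TensorProduct.equivFinsuppOfBasisRight_apply, TensorProduct.equivFinsuppOfBasisRight_apply]
  rw [tensorProduct_basis_coord]
  exact h e f

theorem exists_tcoeff (x : V ⊗[k] HopfAlg G J k) :
    ∃ S : Finset (G.Expo J), ∀ e ∉ S, tcoeff V e x = 0 := by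
  classical
  refine ⟨(TensorProduct.equivFinsuppOfBasisRight (M := V) (basis G J k) x).support,
    fun e he => ?_⟩
  rw [Finsupp.notMem_support_iff, TensorProduct.equivFinsuppOfBasisRight_apply] at he
  exact he

theorem tcoeff_sum_tmul_mono {S : Finset (G.Expo J)} {w : G.Expo J → V} (h : ∀ e ∉ S, w e = 0)
    (e : G.Expo J) : tcoeff V e (∑ g ∈ S, w g ⊗ₜ[k] mono k g) = w e := by
  classical
  simp only [map_sum, tcoeff_tmul, lcoeff_mono, ite_smul, one_smul, zero_smul]
  rw [Finset.sum_ite_eq' S e]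
  split_ifs with he
  · rfl
  · exact (h e he).symm

theorem eq_sum_tmul_mono {x : V ⊗[k] HopfAlg G J k} {S : Finset (G.Expo J)}
    (h : ∀ e ∉ S, tcoeff V e x = 0) : x = ∑ g ∈ S, tcoeff V g x ⊗ₜ[k] mono k g :=
  tcoeff_ext fun e => (tcoeff_sum_tmul_mono h e).symm

theorem tcoeff_rTensor {W : Type*} [AddCommGroup W] [Module k W] (f : V →ₗ[k] W)
    (e : G.Expo J) (x : V ⊗[k] HopfAlg G J k) :
    tcoeff W e (f.rTensor _ x) = f (tcoeff V e x) := by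
  induction x with
  | zero => simp
  | add x y hx hy => simp only [map_add, hx, hy]
  | tmul v a => simp

end Coeff

/-- The coefficients of the comodule map of a representation of `G^J`. -/
def coef (V : RepPow k G J) (e : G.Expo J) : V →ₗ[k] V := tcoeff V e ∘ₗ V.coact

theorem coef_apply (V : RepPow k G J) (e : G.Expo J) (v : V) :
    coef V e v = tcoeff V e (V.coact v) := rfl

theorem exists_coef (V : RepPow k G J) : ∃ S : Finset (G.Expo J), ∀ e ∉ S, coef V e = 0 := by
  classical
  choose S hS using fun v => exists_tcoeff (V := V) (V.coact v)
  let b := Module.finBasis k V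
  refine ⟨Finset.univ.biUnion fun i => S (b i), fun e he => b.ext fun i => ?_⟩
  exact hS _ e fun h => he (Finset.mem_biUnion.2 ⟨i, Finset.mem_univ _, h⟩)

theorem coact_eq_sum (V : RepPow k G J) {S : Finset (G.Expo J)} (hS : ∀ e ∉ S, coef V e = 0)
    (v : V) : V.coact v = ∑ g ∈ S, coef V g v ⊗ₜ[k] mono k g :=
  eq_sum_tmul_mono fun e he => LinearMap.congr_fun (hS e he) v

theorem coef_zero (V : RepPow k G J) : coef V 0 = LinearMap.id := by
  classical
  obtain ⟨S, hS⟩ := exists_coef V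
  ext v
  have h := counit_apply V v
  conv_rhs at h => rw [← LinearMap.id_apply (R := k) v]
  rw [← h]
  -- Evaluation at the neutral element, whose coordinates are all `0`, is the constant coefficient.
  have h0 : Coalgebra.counit (R := k) = lcoeff k (0 : G.Expo J) := by
    refine (basis G J k).ext fun e => ?_
    rw [basis_apply, counit_mono, lcoeff_mono]
  rw [h0]
  rfl

theorem tcoeff₂_coact (V : RepPow k G J) (e f : G.Expo J) (x : V ⊗[k] HopfAlg G J k) :
    tcoeff₂ V e f (TensorProduct.assoc k V _ _ (V.coact.rTensor _ x)) =
      coef V e (tcoeff V f x) := by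
  induction x with
  | zero => simp
  | add x y hx hy => simp only [map_add, hx, hy]
  | tmul v a =>
    simp only [LinearMap.rTensor_tmul, tcoeff_tmul, map_smul, coef_apply]
    generalize V.coact v = x
    induction x with
    | zero => simp
    | add x y hx hy => simp only [map_add, TensorProduct.add_tmul, hx, hy, smul_add]
    | tmul v b =>
      rw [TensorProduct.assoc_tmul, tcoeff₂_tmul, lcoeff₂_tmul, tcoeff_tmul, smul_smul, mul_comm]

/-- Coassociativity read off at `X ^ e ⊗ X ^ f`: one side iterates the coaction, the other
comultiplies the monomials. -/
theorem coef_comp (V : RepPow k G J) {S : Finset (G.Expo J)} (hS : ∀ e ∉ S, coef V e = 0)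
    (e f : G.Expo J) :
    coef V e ∘ₗ coef V f = ∑ g ∈ S, (comulCoeff e f g : k) • coef V g := by
  ext v
  have h := congrArg (tcoeff₂ V e f) (coassoc_apply V v)
  rw [tcoeff₂_coact, coact_eq_sum V hS v, tcoeff_sum_tmul_mono fun g hg => by simp [hS g hg]] at h
  simpa [lcoeff₂_comul_mono] using h

/-- The representation of `G^J` with given coefficients. -/
def ofCoef (V : Type u) [AddCommGroup V] [Module k V] [Module.Finite k V]
    (c : G.Expo J → V →ₗ[k] V) (S : Finset (G.Expo J)) (hS : ∀ e ∉ S, c e = 0)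
    (h0 : c 0 = LinearMap.id)
    (hmul : ∀ e f, c e ∘ₗ c f = ∑ g ∈ S, (comulCoeff e f g : k) • c g) : RepPow k G J where
  carrier := V
  coact := ∑ g ∈ S, (TensorProduct.mk k V _).flip (mono k g) ∘ₗ c g
  coassoc := by
    classical
    ext v
    simp only [LinearMap.coe_comp, LinearEquiv.coe_coe, Function.comp_apply, LinearMap.sum_apply,
      LinearMap.flip_apply, TensorProduct.mk_apply, map_sum, LinearMap.rTensor_tmul,
      LinearMap.lTensor_tmul, TensorProduct.sum_tmul, TensorProduct.assoc_tmul]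
    refine tcoeff₂_ext fun e f => ?_
    simp only [map_sum, tcoeff₂_tmul, lcoeff₂_tmul, lcoeff_mono, lcoeff₂_comul_mono]
    have h := LinearMap.congr_fun (hmul e f) v
    simp only [LinearMap.coe_comp, Function.comp_apply, LinearMap.sum_apply,
      LinearMap.smul_apply] at h
    rw [← h]
    -- One term survives in each of the two sums; when `e` or `f` is missing from `S`, the
    -- endomorphism there is `0` anyway.
    rw [Finset.sum_eq_single f, Finset.sum_eq_single e]
    · simp
    · intro g _ hg
      simp [hg]
    · intro he
      simp [hS e he]
    · intro g _ hg
      simp [hg]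
    · intro hf
      simp [hS f hf]
  counit_coact := by
    classical
    ext v
    simp only [LinearMap.coe_comp, LinearEquiv.coe_coe, Function.comp_apply, LinearMap.sum_apply,
      LinearMap.flip_apply, TensorProduct.mk_apply, map_sum,
      LinearMap.lTensor_tmul, counit_mono, TensorProduct.rid_tmul, ite_smul, one_smul, zero_smul,
      LinearMap.id_apply]
    rw [Finset.sum_ite_eq' S 0]
    split_ifs with h
    · rw [h0]; rfl
    · rw [← LinearMap.id_apply (R := k) v, ← h0, hS 0 h]; rfl

theorem coef_ofCoef (V : Type u) [AddCommGroup V] [Module k V] [Module.Finite k V]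
    (c : G.Expo J → V →ₗ[k] V) (S : Finset (G.Expo J)) (hS : ∀ e ∉ S, c e = 0)
    (h0 : c 0 = LinearMap.id)
    (hmul : ∀ e f, c e ∘ₗ c f = ∑ g ∈ S, (comulCoeff e f g : k) • c g) (e : G.Expo J) :
    coef (ofCoef V c S hS h0 hmul) e = c e := by
  refine LinearMap.ext fun (v : V) => ?_
  change tcoeff V e ((∑ g ∈ S, (TensorProduct.mk k V _).flip (mono k g) ∘ₗ c g : V →ₗ[k] _) v) = _
  simp only [LinearMap.sum_apply, LinearMap.comp_apply, LinearMap.flip_apply,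
    TensorProduct.mk_apply]
  exact tcoeff_sum_tmul_mono (w := fun g => c g v) (fun g hg => by simp [hS g hg]) e

theorem coef_comm {V W : RepPow k G J} (f : V ⟶ W) (e : G.Expo J) (v : V) :
    f.lin (coef V e v) = coef W e (f.lin v) := by
  rw [coef_apply, coef_apply, comm_apply, tcoeff_rTensor]

/-- A linear map which commutes with the coefficients is a morphism of representations. -/
def homOfCoef {V W : RepPow k G J} (f : V →ₗ[k] W)
    (h : ∀ e v, f (coef V e v) = coef W e (f v)) : V ⟶ W where
  lin := f
  comm := LinearMap.ext fun v => tcoeff_ext fun e => by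
    rw [LinearMap.comp_apply, LinearMap.comp_apply, tcoeff_rTensor]
    exact (h e v).symm

/-- A linear isomorphism which commutes with the coefficients is an isomorphism of
representations. -/
def isoOfCoef {V W : RepPow k G J} (f : V ≃ₗ[k] W)
    (h : ∀ e v, f (coef V e v) = coef W e (f v)) : V ≅ W :=
  isoMk f (homOfCoef f.toLinearMap h).comm

theorem coef_triv [DecidableEq J] (e : G.Expo J) (a : k) :
    coef (triv k (HopfAlg G J k)) e a = if e = 0 then a else 0 := by
  change tcoeff k e (a ⊗ₜ[k] (1 : HopfAlg G J k)) = _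
  rw [tcoeff_tmul, ← mono_zero, lcoeff_mono]
  split_ifs <;> simp_all

theorem tcoeff_mulMap [DecidableEq J] {V W : Type*} [AddCommGroup V] [Module k V] [AddCommGroup W] [Module k W]
    (e : G.Expo J) (x : V ⊗[k] HopfAlg G J k) (y : W ⊗[k] HopfAlg G J k) :
    tcoeff (V ⊗[k] W) e (mulMap k _ V W (x ⊗ₜ y)) =
      ∑ a ∈ Finset.HasAntidiagonal.antidiagonal e, tcoeff V a.1 x ⊗ₜ[k] tcoeff W a.2 y := by
  classical
  induction x with
  | zero => simp
  | add x x' hx hx' =>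
    simp only [TensorProduct.add_tmul, map_add, hx, hx', Finset.sum_add_distrib]
  | tmul v a =>
    induction y with
    | zero => simp
    | add y y' hy hy' =>
      simp only [TensorProduct.tmul_add, map_add, hy, hy', Finset.sum_add_distrib]
    | tmul w b =>
      simp only [mulMap_tmul, tcoeff_tmul, TensorProduct.smul_tmul_smul]
      rw [← Finset.sum_smul]
      congr 1
      exact MvPolynomial.coeff_mul (σ := J × Fin G.dim) a b e

/-- Matrix entries of a tensor product are products of polynomials, so coefficients are convolved.
-/
theorem coef_tensor [DecidableEq J] (V W : RepPow k G J) (e : G.Expo J) (v : V) (w : W) :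
    coef (tensor V W) e (v ⊗ₜ[k] w) =
      ∑ a ∈ Finset.HasAntidiagonal.antidiagonal e, coef V a.1 v ⊗ₜ[k] coef W a.2 w :=
  tcoeff_mulMap e (V.coact v) (W.coact w)

end FDComod
end
-- Structure constants on the coordinate axes.
noncomputable section

namespace UnipotentGroup

/-- Setting to zero the variables outside a set does not change the coefficients of the monomials in
the variables of the set. -/
theorem coeff_aeval_ite {σ : Type*} (T : σ → Prop) [DecidablePred T] (P : MvPolynomial σ ℤ)
    (e : σ →₀ ℕ) (he : ∀ s, e s ≠ 0 → T s) :
    (MvPolynomial.aeval (fun s => if T s then MvPolynomial.X s else 0) P :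
      MvPolynomial σ ℤ).coeff e = P.coeff e := by
  classical
  induction P using MvPolynomial.induction_on' with
  | monomial m z =>
    rw [MvPolynomial.aeval_monomial]
    by_cases hm : ∀ s, m s ≠ 0 → T s
    · rw [MvPolynomial.monomial_eq]
      congr 2
      refine Finsupp.prod_congr fun s hs => ?_
      rw [if_pos (hm s (Finsupp.mem_support_iff.1 hs))]
    · push Not at hm
      obtain ⟨s, hs, hT⟩ := hm
      have h0 : (m.prod fun s n =>
          (if T s then MvPolynomial.X s else 0 : MvPolynomial σ ℤ) ^ n) = 0 :=
        Finset.prod_eq_zero (Finsupp.mem_support_iff.2 hs) (by simp [hT, hs])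
      rw [h0, mul_zero, MvPolynomial.coeff_zero, MvPolynomial.coeff_monomial, if_neg]
      rintro rfl
      exact hT (he s hs)
  | add p q hp hq => rw [map_add, MvPolynomial.coeff_add, MvPolynomial.coeff_add, hp, hq]

/-- Variables foreign to `e` and `f` may be set to zero before expanding, separately in the left and
the right copy. In the applications below this removes the cross term of the Heisenberg law. -/
theorem comulCoeff_eq_of_support {G : UnipotentGroup} {J : Type} (p q : J × Fin G.dim → Prop)
    [DecidablePred p] [DecidablePred q] {e f : G.Expo J} (he : ∀ s, e s ≠ 0 → p s)
    (hf : ∀ s, f s ≠ 0 → q s) (g : G.Expo J) :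
    comulCoeff e f g = MvPolynomial.coeff (Finsupp.sumFinsuppEquivProdFinsupp.symm (e, f))
      (g.prod fun s n => (G.mul
        (fun c => if p (s.1, c) then MvPolynomial.X (Sum.inl (s.1, c)) else 0)
        (fun c => if q (s.1, c) then MvPolynomial.X (Sum.inr (s.1, c)) else 0) s.2) ^ n :
          MvPolynomial ((J × Fin G.dim) ⊕ (J × Fin G.dim)) ℤ) := by
  have hdec : DecidablePred (Sum.elim p q) := fun s => by
    cases s <;> simp only [Sum.elim_inl, Sum.elim_inr] <;> infer_instance
  rw [comulCoeff, ← coeff_aeval_ite (Sum.elim p q)]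
  · congr 1
    rw [comulPoly, map_finsuppProd]
    refine Finsupp.prod_congr fun s _ => ?_
    rw [map_pow]
    congr 1
    refine (map_mul' (MvPolynomial.aeval (fun s => if Sum.elim p q s then MvPolynomial.X s else 0) :
      MvPolynomial ((J × Fin G.dim) ⊕ (J × Fin G.dim)) ℤ →ₐ[ℤ]
      MvPolynomial ((J × Fin G.dim) ⊕ (J × Fin G.dim)) ℤ).toRingHom G _ _ _).trans ?_
    congr 1 <;> funext c
    · exact (MvPolynomial.aeval_X _ _).trans (if_congr Iff.rfl rfl rfl)
    · exact (MvPolynomial.aeval_X _ _).trans (if_congr Iff.rfl rfl rfl)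
  · rintro (s | s) hs
    · exact he s hs
    · exact hf s hs

/-- The exponent of the `n`-th power of a coordinate of `G`. -/
abbrev axis {G : UnipotentGroup} (c : Fin G.dim) (n : ℕ) : G.Expo Unit := Finsupp.single ((), c) n

/-- Each axis is a copy of the additive group, because the cross term of the Heisenberg law involves
two different axes. -/
theorem mul_axis {R : Type*} [CommRing R] (G : UnipotentGroup) (c : Fin G.dim)
    (a b : Fin G.dim → R) (c' : Fin G.dim) :
    G.mul (fun i => if i = c then a i else 0) (fun i => if i = c then b i else 0) c' =
      if c' = c then a c + b c else 0 := by
  cases G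
  · obtain rfl : c = c' := Subsingleton.elim (α := Fin 1) c c'
    simp only [mul, if_true]
  · have h : ∀ (a b : Fin 3 → R) (c c' : Fin 3), (∀ i, i ≠ c → a i = 0) → (∀ i, i ≠ c → b i = 0) →
        (![a 0 + b 0, a 1 + b 1, a 2 + b 2 + a 0 * b 1] : Fin 3 → R) c' =
          if c' = c then a c + b c else 0 := by
      intro a b c c' ha hb
      fin_cases c <;> fin_cases c' <;> simp [ha, hb]
    have h' := h (fun i : Fin H1.dim => if i = c then a i else 0)
      (fun i : Fin H1.dim => if i = c then b i else 0) c c'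
      (fun i hi => if_neg hi) (fun i hi => if_neg hi)
    rw [if_pos rfl, if_pos rfl] at h'
    exact h'

theorem coeff_add_X_pow {σ : Type*} {s t : σ} (hst : s ≠ t) (m n N : ℕ) :
    ((MvPolynomial.X s + MvPolynomial.X t : MvPolynomial σ ℤ) ^ N).coeff
      (Finsupp.single s m + Finsupp.single t n) = if N = m + n then (N.choose m : ℤ) else 0 := by
  classical
  have key : ∀ i j : ℕ, Finsupp.single s i + Finsupp.single t j =
      Finsupp.single s m + Finsupp.single t n ↔ i = m ∧ j = n := by
    intro i j
    refine ⟨fun h => ⟨?_, ?_⟩, fun h => by rw [h.1, h.2]⟩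
    · have := DFunLike.congr_fun h s
      simpa [hst.symm] using this
    · have := DFunLike.congr_fun h t
      simpa [hst] using this
  have hterm : ∀ i j : ℕ, ∀ z : ℕ, (MvPolynomial.X s ^ i * MvPolynomial.X t ^ j * (z : MvPolynomial σ ℤ)) =
      MvPolynomial.monomial (Finsupp.single s i + Finsupp.single t j) (z : ℤ) := by
    intro i j z
    rw [MvPolynomial.X_pow_eq_monomial, MvPolynomial.X_pow_eq_monomial, MvPolynomial.monomial_mul,
      ← map_natCast (MvPolynomial.C (σ := σ) (R := ℤ)), mul_comm, MvPolynomial.C_mul_monomial]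
    simp
  rw [add_pow, MvPolynomial.coeff_sum]
  simp only [hterm, MvPolynomial.coeff_monomial, key]
  split_ifs with hN
  · subst hN
    rw [Finset.sum_eq_single m]
    · simp
    · intro i _ hi
      rw [if_neg fun h => hi h.1]
    · intro h
      exact absurd (Finset.mem_range.2 (by omega)) h
  · refine Finset.sum_eq_zero fun i hi => if_neg ?_
    rintro ⟨rfl, rfl⟩
    have := Finset.mem_range.1 hi
    omega

/-- On an axis the comultiplication is the binomial expansion of `(X + Y) ^ N`; a variable of `g`
off the axis contributes a factor `0`. -/
theorem comulCoeff_axis {G : UnipotentGroup} (c : Fin G.dim) (m n : ℕ) (g : G.Expo Unit) :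
    comulCoeff (axis c m) (axis c n) g =
      if g = axis c (m + n) then ((m + n).choose m : ℤ) else 0 := by
  have hax : ∀ (n : ℕ) (s : Unit × Fin G.dim), axis c n s ≠ 0 → s.2 = c := by
    rintro n ⟨⟨⟩, c'⟩ h
    by_contra hc
    exact h (Finsupp.single_eq_of_ne (by simpa using hc))
  rw [comulCoeff_eq_of_support (fun s => s.2 = c) (fun s => s.2 = c) (hax m) (hax n)]
  simp only [mul_axis G c (fun i => MvPolynomial.X (Sum.inl ((), i)))
    (fun i => MvPolynomial.X (Sum.inr ((), i)))]
  by_cases hg : ∃ s, g s ≠ 0 ∧ s.2 ≠ c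
  · obtain ⟨s, hs, hc⟩ := hg
    rw [if_neg]
    · have h0 := Finset.prod_eq_zero (s := g.support) (f := fun s => ((if s.2 = c then
        MvPolynomial.X (Sum.inl ((), c)) + MvPolynomial.X (Sum.inr ((), c)) else 0 :
        MvPolynomial ((Unit × Fin G.dim) ⊕ (Unit × Fin G.dim)) ℤ)) ^ g s)
        (Finsupp.mem_support_iff.2 hs) (by rw [if_neg hc, zero_pow hs])
      rw [Finsupp.prod, h0, MvPolynomial.coeff_zero]
    · rintro rfl
      exact hc (hax _ _ hs)
  · push Not at hg
    obtain ⟨N, rfl⟩ : ∃ N, g = axis c N := by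
      refine ⟨g ((), c), ?_⟩
      ext ⟨⟨⟩, c'⟩
      by_cases hc : c' = c
      · subst hc; simp
      · rw [Finsupp.single_eq_of_ne (by simpa using hc)]
        by_contra h
        exact hc (hg _ h)
    rw [Finsupp.prod_single_index (by simp), if_pos rfl]
    have he : Finsupp.sumFinsuppEquivProdFinsupp.symm (axis c m, axis c n) =
        Finsupp.single (Sum.inl ((), c)) m + Finsupp.single (Sum.inr ((), c)) n := by
      ext (⟨⟨⟩, s⟩ | ⟨⟨⟩, s⟩)
      · simp [Finsupp.single_apply]
      · simp [Finsupp.single_apply]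
    rw [he, coeff_add_X_pow (by simp)]
    have : axis c N = axis c (m + n) ↔ N = m + n := (Finsupp.single_injective _).eq_iff
    simp only [this]
    split_ifs with h <;> simp [h]

namespace H1

/-- The first coordinate of `H_1`. -/
def x : Fin H1.dim := (0 : Fin 3)

/-- The second coordinate of `H_1`. -/
def y : Fin H1.dim := (1 : Fin 3)

/-- The third, central coordinate of `H_1`. -/
def z : Fin H1.dim := (2 : Fin 3)

theorem coord_cases {P : Fin H1.dim → Prop} (hx : P x) (hy : P y) (hz : P z) (c : Fin H1.dim) :
    P c := by
  change Fin 3 at c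
  fin_cases c
  exacts [hx, hy, hz]

@[simp] theorem x_ne_y : x ≠ y := (by decide : (0 : Fin 3) ≠ 1)
@[simp] theorem x_ne_z : x ≠ z := (by decide : (0 : Fin 3) ≠ 2)
@[simp] theorem y_ne_z : y ≠ z := (by decide : (1 : Fin 3) ≠ 2)
@[simp] theorem y_ne_x : y ≠ x := (by decide : (1 : Fin 3) ≠ 0)
@[simp] theorem z_ne_x : z ≠ x := (by decide : (2 : Fin 3) ≠ 0)
@[simp] theorem z_ne_y : z ≠ y := (by decide : (2 : Fin 3) ≠ 1)

theorem expo_ext {g h : H1.Expo Unit} (h0 : g ((), x) = h ((), x))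
    (h1 : g ((), y) = h ((), y)) (h2 : g ((), z) = h ((), z)) : g = h := by
  ext ⟨⟨⟩, c⟩
  exact coord_cases (P := fun c => g ((), c) = h ((), c)) h0 h1 h2 c

theorem prod_expo {M : Type*} [CommMonoid M] (g : H1.Expo Unit) (F : Fin H1.dim → M) :
    (g.prod fun s n => F s.2 ^ n) = F x ^ g ((), x) * F y ^ g ((), y) * F z ^ g ((), z) := by
  rw [Finsupp.prod_fintype _ _ (by simp), Fintype.prod_prod_type, Fintype.prod_unique]
  exact Fin.prod_univ_three fun c : Fin 3 => F c ^ g ((), c)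

theorem coeff_monomials {σ : Type*} [DecidableEq σ] (s t r : σ) (l m n : ℕ) (e : σ →₀ ℕ) :
    (MvPolynomial.X s ^ l * MvPolynomial.X t ^ m * MvPolynomial.X r ^ n :
      MvPolynomial σ ℤ).coeff e =
      if Finsupp.single s l + Finsupp.single t m + Finsupp.single r n = e then 1 else 0 := by
  rw [MvPolynomial.X_pow_eq_monomial, MvPolynomial.X_pow_eq_monomial,
    MvPolynomial.X_pow_eq_monomial, MvPolynomial.monomial_mul, MvPolynomial.monomial_mul,
    MvPolynomial.coeff_monomial]
  simp

/-- The cross term is the left `x` times the right `y`. With only `z` on the left it is zero, and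
every coordinate comes from one side. -/
theorem comulCoeff_z_yx (a b c : ℕ) (g : H1.Expo Unit) :
    comulCoeff (axis z c) (axis y b + axis x a) g =
      if g = axis z c + (axis y b + axis x a) then 1 else 0 := by
  rw [comulCoeff_eq_of_support (fun s => s.2 = z) (fun s => s.2 ≠ z)]
  · refine (congrArg _ (prod_expo g (H1.mul
        (fun c => if c = z then MvPolynomial.X (Sum.inl ((), c)) else 0)
        (fun c => if c ≠ z then MvPolynomial.X (Sum.inr ((), c)) else 0)))).trans ?_
    have e1 : ∀ a b : Fin H1.dim → MvPolynomial ((Unit × Fin H1.dim) ⊕ (Unit × Fin H1.dim)) ℤ,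
      H1.mul a b x = a x + b x := fun _ _ => rfl
    have e2 : ∀ a b : Fin H1.dim → MvPolynomial ((Unit × Fin H1.dim) ⊕ (Unit × Fin H1.dim)) ℤ,
      H1.mul a b y = a y + b y := fun _ _ => rfl
    have e3 : ∀ a b : Fin H1.dim → MvPolynomial ((Unit × Fin H1.dim) ⊕ (Unit × Fin H1.dim)) ℤ,
      H1.mul a b z = a z + b z + a x * b y := fun _ _ => rfl
    rw [e1, e2, e3]
    simp only [x_ne_z, y_ne_z, if_true, if_false, ne_eq, not_true_eq_false, not_false_eq_true, zero_add,
      zero_mul, add_zero]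
    rw [coeff_monomials]
    refine if_congr ⟨fun h => ?_, ?_⟩ rfl rfl
    · have hx := DFunLike.congr_fun h (Sum.inr ((), x))
      have hy := DFunLike.congr_fun h (Sum.inr ((), y))
      have hz := DFunLike.congr_fun h (Sum.inl ((), z))
      simp at hx hy hz
      apply expo_ext <;>
        simp [hx, hy, hz]
    · rintro rfl
      ext (⟨⟨⟩, s⟩ | ⟨⟨⟩, s⟩)
      · revert s
        apply coord_cases <;>
          simp
      · revert s
        apply coord_cases <;>
          simp
  · rintro ⟨⟨⟩, s⟩ hs
    by_contra h
    exact hs (Finsupp.single_eq_of_ne (by simpa using h))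
  · rintro ⟨⟨⟩, s⟩ hs rfl
    simp at hs

/-- The order matters: `x` on the left and `y` on the right would also receive contributions from
powers of `z`. -/
theorem comulCoeff_y_x (a b : ℕ) (g : H1.Expo Unit) :
    comulCoeff (axis y b) (axis x a) g = if g = axis y b + axis x a then 1 else 0 := by
  rw [comulCoeff_eq_of_support (fun s => s.2 = y) (fun s => s.2 = x)]
  · refine (congrArg _ (prod_expo g (H1.mul
        (fun c => if c = y then MvPolynomial.X (Sum.inl ((), c)) else 0)
        (fun c => if c = x then MvPolynomial.X (Sum.inr ((), c)) else 0)))).trans ?_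
    have e1 : ∀ a b : Fin H1.dim → MvPolynomial ((Unit × Fin H1.dim) ⊕ (Unit × Fin H1.dim)) ℤ,
      H1.mul a b x = a x + b x := fun _ _ => rfl
    have e2 : ∀ a b : Fin H1.dim → MvPolynomial ((Unit × Fin H1.dim) ⊕ (Unit × Fin H1.dim)) ℤ,
      H1.mul a b y = a y + b y := fun _ _ => rfl
    have e3 : ∀ a b : Fin H1.dim → MvPolynomial ((Unit × Fin H1.dim) ⊕ (Unit × Fin H1.dim)) ℤ,
      H1.mul a b z = a z + b z + a x * b y := fun _ _ => rfl
    rw [e1, e2, e3]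
    simp only [x_ne_y, y_ne_x, z_ne_x, z_ne_y, if_true, if_false, zero_add, zero_mul, add_zero]
    by_cases h0 : g ((), z) = 0
    -- The missing third factor is written as the zeroth power of a variable to match
    -- `coeff_monomials`.
    · rw [h0, pow_zero, ← pow_zero (MvPolynomial.X (Sum.inl ((), z))), coeff_monomials]
      refine if_congr ⟨fun h => ?_, ?_⟩ rfl rfl
      · have hx := DFunLike.congr_fun h (Sum.inr ((), x))
        have hy := DFunLike.congr_fun h (Sum.inl ((), y))
        simp at hx hy
        apply expo_ext <;>
          simp [hx, hy, h0]
      · rintro rfl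
        ext (⟨⟨⟩, s⟩ | ⟨⟨⟩, s⟩)
        · revert s
          apply coord_cases <;>
            simp
        · revert s
          apply coord_cases <;>
            simp
    · rw [zero_pow h0, mul_zero, MvPolynomial.coeff_zero, if_neg]
      rintro rfl
      simp at h0
  · rintro ⟨⟨⟩, s⟩ hs
    by_contra h
    exact hs (Finsupp.single_eq_of_ne (by simpa using h))
  · rintro ⟨⟨⟩, s⟩ hs
    by_contra h
    exact hs (Finsupp.single_eq_of_ne (by simpa using h))

end H1

end UnipotentGroup
end
-- Base `q` digits and Frobenius twists of exponents.
noncomputable section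

/-- Lucas' theorem, one digit at a time: the last digit of `p ^ (j + 1)` is `0`, so it contributes a
factor `1`. -/
theorem Nat.choose_pow_modEq_div {p : ℕ} (hp : p.Prime) (n j : ℕ) :
    n.choose (p ^ j) ≡ n / p ^ j [MOD p] := by
  have := Fact.mk hp
  induction j generalizing n with
  | zero => simp [Nat.ModEq]
  | succ j ih =>
    refine (Choose.choose_modEq_choose_mod_mul_choose_div_nat (p := p)).trans ?_
    have h1 : p ^ (j + 1) % p = 0 := by rw [pow_succ]; exact Nat.mul_mod_left _ _
    have h2 : p ^ (j + 1) / p = p ^ j := by rw [pow_succ]; exact Nat.mul_div_cancel _ hp.pos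
    rw [h1, h2, Nat.choose_zero_right, one_mul, pow_succ', ← Nat.div_div_eq_div_mul]
    exact ih _

theorem Nat.mod_pow_eq_sum (p n N : ℕ) :
    n % p ^ N = ∑ m ∈ Finset.range N, p ^ m * (n / p ^ m % p) := by
  induction N with
  | zero => simp [Nat.mod_one]
  | succ N ih => rw [Finset.sum_range_succ, ← ih, Nat.mod_pow_succ]

/-- Induction on the leading position: the remaining terms sum to less than one unit of that
position, so nothing is carried. -/
theorem Finset.sum_pow_mul_lt {J : Type*} (q : ℕ) (hq : 0 < q) (ν : J → ℕ) (hν : Function.Injective ν)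
    (a : J → ℕ) (ha : ∀ j, a j < q) (T : Finset J) (M : ℕ) (hM : ∀ j ∈ T, ν j < M) :
    ∑ j ∈ T, q ^ ν j * a j < q ^ M := by
  classical
  revert M
  refine Finset.induction_on_max_value ν T (fun M _ => by simpa using Nat.pow_pos hq) ?_
  · intro j T hj hmax ih M hM
    rw [Finset.sum_insert hj]
    have h1 := ih (ν j) fun i hi => lt_of_le_of_ne (hmax i hi) fun h => hj (hν h ▸ hi)
    calc q ^ ν j * a j + ∑ j ∈ T, q ^ ν j * a j < q ^ ν j * a j + q ^ ν j := by omega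
      _ = q ^ ν j * (a j + 1) := by ring
      _ ≤ q ^ ν j * q := Nat.mul_le_mul_left _ (ha j)
      _ = q ^ (ν j + 1) := by ring
      _ ≤ q ^ M := Nat.pow_le_pow_right hq (hM j (Finset.mem_insert_self _ _))

/-- Uniqueness of base `q` digits, with positions labelled by `ν`. Division by the leading weight
recovers the leading digit, the rest being too small to matter. -/
theorem Finset.eq_of_sum_pow_mul_eq {J : Type*} (q : ℕ) (hq : 0 < q) (ν : J → ℕ)
    (hν : Function.Injective ν)
    (a b : J → ℕ) (ha : ∀ j, a j < q) (hb : ∀ j, b j < q) (T : Finset J)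
    (h : ∑ j ∈ T, q ^ ν j * a j = ∑ j ∈ T, q ^ ν j * b j) : ∀ j ∈ T, a j = b j := by
  classical
  revert h
  refine Finset.induction_on_max_value ν T (fun _ => by simp) ?_
  · intro j T hj hmax ih h
    rw [Finset.sum_insert hj, Finset.sum_insert hj] at h
    have hlt : ∀ i ∈ T, ν i < ν j := fun i hi =>
      lt_of_le_of_ne (hmax i hi) fun h => hj (hν h ▸ hi)
    have h1 := Finset.sum_pow_mul_lt q hq ν hν a ha T (ν j) hlt
    have h2 := Finset.sum_pow_mul_lt q hq ν hν b hb T (ν j) hlt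
    have hpos : 0 < q ^ ν j := Nat.pow_pos hq
    have hj' : a j = b j := by
      have := congrArg (· / q ^ ν j) h
      simpa [Nat.mul_add_div hpos, Nat.div_eq_of_lt h1, Nat.div_eq_of_lt h2] using this
    rw [hj'] at h
    intro i hi
    rcases Finset.mem_insert.1 hi with rfl | hi
    · exact hj'
    · exact ih (by omega) i hi

namespace UnipotentGroup

variable {G : UnipotentGroup} {J : Type}

/-- The effect on exponents of replacing the coordinate `(j, c)` of `G^J` by the `q ^ ν j`-th power
of the coordinate `c` of `G`. -/
def twist (q : ℕ) (ν : J → ℕ) : G.Expo J →+ G.Expo Unit :=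
  Finsupp.liftAddHom fun s => (Finsupp.singleAddHom ((), s.2)).comp (AddMonoidHom.mulLeft (q ^ ν s.1))

@[simp] theorem twist_single (q : ℕ) (ν : J → ℕ) (j : J) (c : Fin G.dim) (n : ℕ) :
    twist q ν (Finsupp.single (j, c) n : G.Expo J) = axis c (q ^ ν j * n) := by
  simp [twist]

theorem twist_apply (q : ℕ) (ν : J → ℕ) (e : G.Expo J) (c : Fin G.dim) {T : Finset J}
    (hT : ∀ s ∈ e.support, s.1 ∈ T) :
    twist q ν e ((), c) = ∑ j ∈ T, q ^ ν j * e (j, c) := by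
  classical
  have h1 : e = ∑ s ∈ T ×ˢ Finset.univ, Finsupp.single s (e s) := by
    conv_lhs => rw [← e.sum_single]
    exact Finsupp.sum_of_support_subset _
      (fun s hs => Finset.mem_product.2 ⟨hT s hs, Finset.mem_univ _⟩) _ (by simp)
  conv_lhs => rw [h1]
  rw [map_sum, Finset.sum_product, Finsupp.finsetSum_apply]
  refine Finset.sum_congr rfl fun j _ => ?_
  rw [Finsupp.finsetSum_apply, Finset.sum_eq_single c]
  · simp
  · intro c' _ hc
    simp [hc]
  · simp

theorem twist_injOn {q : ℕ} (hq : 0 < q) {ν : J → ℕ} (hν : Function.Injective ν) :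
    Set.InjOn (twist q ν : G.Expo J → G.Expo Unit) {e | ∀ s, e s < q} := by
  classical
  intro e he f hf h
  ext ⟨j, c⟩
  -- `j` is inserted because neither exponent need involve that factor.
  let T : Finset J := insert j ((e.support ∪ f.support).image Prod.fst)
  have h1 := twist_apply q ν e c (T := T) fun s hs => Finset.mem_insert_of_mem
    (Finset.mem_image_of_mem _ (Finset.mem_union_left _ hs))
  have h2 := twist_apply q ν f c (T := T) fun s hs => Finset.mem_insert_of_mem
    (Finset.mem_image_of_mem _ (Finset.mem_union_right _ hs))
  rw [h, h2] at h1
  exact Finset.eq_of_sum_pow_mul_eq q hq ν hν (fun j => e (j, c)) (fun j => f (j, c))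
    (fun j => he _) (fun j => hf _) T h1.symm j (Finset.mem_insert_self _ _)

/-- The growth of the characteristic enters here: it eventually exceeds every entry of the finitely
many exponents, which then are genuine digits. -/
theorem eventually_twist_injOn {ι : Type*} {l : Filter ι} {q : ι → ℕ}
    (hq : Filter.Tendsto q l Filter.atTop) {ν : J → ℕ} (hν : Function.Injective ν)
    (S : Finset (G.Expo J)) : ∀ᶠ i in l, Set.InjOn (twist (q i) ν : G.Expo J → G.Expo Unit) S := by
  classical
  let N : ℕ := S.sup fun e => e.support.sup e
  filter_upwards [hq.eventually_gt_atTop N] with i hi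
  refine (twist_injOn (lt_of_le_of_lt (Nat.zero_le _) hi) hν).mono fun e he => ?_
  intro s
  refine lt_of_le_of_lt ?_ hi
  by_cases hs : s ∈ e.support
  · exact (Finset.le_sup (f := e) hs).trans (Finset.le_sup (f := fun e => e.support.sup e) he)
  · rw [Finsupp.notMem_support_iff.1 hs]
    exact Nat.zero_le _

namespace HopfAlg

variable (k : Type u) [Field k]

/-- The homomorphism of Hopf algebras which sends the coordinate `(j, c)` of `G^J` to the
`q ^ ν j`-th power of the coordinate `c` of `G`, where `q` is the characteristic. -/
def frob (q : ℕ) (ν : J → ℕ) : HopfAlg G J k →ₐ[k] HopfAlg G Unit k :=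
  lift fun j c => coord k () c ^ q ^ ν j

theorem frob_mono (q : ℕ) (ν : J → ℕ) (e : G.Expo J) :
    frob k q ν (mono k e) = mono k (twist q ν e) := by
  induction e using Finsupp.induction_linear with
  | zero => rw [map_zero, mono_zero, mono_zero, map_one]
  | add e f he hf => rw [mono_add, map_mul, he, hf, map_add, mono_add]
  | single s n =>
    obtain ⟨j, c⟩ := s
    rw [twist_single, axis, mono_single, mono_single, map_pow, frob, lift_coord, pow_mul]

/-- In characteristic `q` the iterated Frobenius is a ring homomorphism, so it commutes with the
group law, whose coefficients are integers. -/
theorem comul_frob (q : ℕ) [hq : Fact q.Prime] [CharP k q] (ν : J → ℕ) (a : HopfAlg G J k) :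
    Coalgebra.comul (R := k) (frob k q ν a) =
      TensorProduct.map (frob k q ν).toLinearMap (frob k q ν).toLinearMap
        (Coalgebra.comul (R := k) a) := by
  -- Nontriviality makes `k` embed in the tensor square, which therefore has characteristic `q`.
  have : Nontrivial (HopfAlg G Unit k ⊗[k] HopfAlg G Unit k) := by
    refine ⟨1, 0, fun h => ?_⟩
    have := congrArg (lcoeff₂ 0 0) h
    rw [Algebra.TensorProduct.one_def, lcoeff₂_tmul, ← mono_zero, lcoeff_mono] at this
    simp at this
  have : CharP (HopfAlg G Unit k ⊗[k] HopfAlg G Unit k) q :=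
    charP_of_injective_algebraMap (algebraMap k _).injective q
  have h : (comulHom G Unit k).comp (frob k q ν) =
      (Algebra.TensorProduct.map (frob k q ν) (frob k q ν)).comp (comulHom G J k) := by
    refine algHom_ext fun j c => ?_
    simp only [AlgHom.comp_apply, comulHom, frob, lift_coord, map_pow, map_mul'',
      Algebra.TensorProduct.map_tmul, map_one]
    have := map_mul' (iterateFrobenius (HopfAlg G Unit k ⊗[k] HopfAlg G Unit k) q (ν j)) G
      (fun c => coord k () c ⊗ₜ 1) (fun c => 1 ⊗ₜ coord k () c) c
    simp only [iterateFrobenius_def, Algebra.TensorProduct.tmul_pow, one_pow] at this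
    exact this
  exact DFunLike.congr_fun h a

theorem counit_frob (q : ℕ) [hq : Fact q.Prime] (ν : J → ℕ) (a : HopfAlg G J k) :
    Coalgebra.counit (R := k) (frob k q ν a) = Coalgebra.counit (R := k) a := by
  have h : (counitHom G Unit k).comp (frob k q ν) = counitHom G J k := by
    refine algHom_ext fun j c => ?_
    simp [counitHom, frob, hq.1.ne_zero]
  exact DFunLike.congr_fun h a

end HopfAlg

open HopfAlg in
/-- The structure constants of `G` at twisted exponents are those of `G^J`. -/
theorem comulCoeff_twist (k : Type u) [Field k] (q : ℕ) [hq : Fact q.Prime] [CharP k q]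
    (ν : J → ℕ) {T : Finset (G.Expo J)} (hT : Set.InjOn (twist q ν : G.Expo J → G.Expo Unit) T)
    {e f g : G.Expo J} (he : e ∈ T) (hf : f ∈ T)
    (hg : ∀ e f, comulCoeff e f g ≠ 0 → e ∈ T ∧ f ∈ T) :
    (comulCoeff (twist q ν e) (twist q ν f) (twist q ν g) : k) = (comulCoeff e f g : k) := by
  classical
  have hexp : Coalgebra.comul (R := k) (mono k g) =
      ∑ x ∈ T ×ˢ T, (comulCoeff x.1 x.2 g : k) • (mono k x.1 ⊗ₜ[k] mono k x.2) := by
    refine lcoeff₂_ext fun e f => ?_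
    simp only [lcoeff₂_comul_mono, map_sum, map_smul, lcoeff₂_tmul, lcoeff_mono]
    by_cases h : comulCoeff e f g = 0
    · rw [h, Int.cast_zero, eq_comm]
      refine Finset.sum_eq_zero fun x _ => ?_
      split_ifs with h1 h2 <;> simp_all
    · rw [Finset.sum_eq_single (e, f)]
      · simp
      · rintro ⟨e', f'⟩ - hne
        split_ifs with h1 h2 <;> simp_all
      · exact fun h' => absurd (Finset.mem_product.2 (hg e f h)) h'
  -- All terms of the expansion have exponents in `T`; injectivity there keeps them apart after
  -- twisting, so no two coefficients are added up.
  rw [← lcoeff₂_comul_mono, ← frob_mono, comul_frob k q, hexp]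
  simp only [map_sum, map_smul, TensorProduct.map_tmul, AlgHom.toLinearMap_apply, frob_mono,
    lcoeff₂_tmul, lcoeff_mono]
  rw [Finset.sum_eq_single (e, f)]
  · simp
  · rintro ⟨e', f'⟩ hx hne
    obtain ⟨he', hf'⟩ := Finset.mem_product.1 hx
    simp only [hT.eq_iff he' he, hT.eq_iff hf' hf]
    by_cases h1 : e' = e
    · by_cases h2 : f' = f
      · exact absurd (by rw [h1, h2]) hne
      · simp [h2]
    · simp [h1]
  · intro h
    exact absurd (Finset.mem_product.2 ⟨he, hf⟩) h

end UnipotentGroup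
end
-- Bounds on the digits of occurring exponents, and Frobenius pullback.
noncomputable section

namespace FDComod

open UnipotentGroup UnipotentGroup.HopfAlg

variable {G : UnipotentGroup} {J : Type} {k : Type u} [Field k]

theorem coef_comp_of_ite (V : RepPow k G J) {e f g₀ : G.Expo J} {n : ℤ}
    [DecidableEq (G.Expo J)]
    (h : ∀ g, comulCoeff e f g = if g = g₀ then n else 0) :
    coef V e ∘ₗ coef V f = (n : k) • coef V g₀ := by
  obtain ⟨S, hS⟩ := exists_coef V
  rw [coef_comp V hS, Finset.sum_eq_single g₀]
  · rw [h, if_pos rfl]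
  · intro g _ hg
    rw [h, if_neg hg, Int.cast_zero, zero_smul]
  · intro hg
    rw [hS _ hg, smul_zero]

theorem coef_axis_comp (V : RepOne k G) (c : Fin G.dim) (m n : ℕ) :
    coef V (axis c m) ∘ₗ coef V (axis c n) = ((m + n).choose m : k) • coef V (axis c (m + n)) := by
  rw [coef_comp_of_ite V (comulCoeff_axis c m n)]
  simp

/-- For the Heisenberg group the coefficient at `m` is the composite of those at its `z`, `y` and
`x` parts, so it vanishes with any of them. For the additive group `m` lies on the axis already. -/
theorem coef_axis_ne_zero (V : RepOne k G) {m : G.Expo Unit} (hm : coef V m ≠ 0) (c : Fin G.dim) :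
    coef V (axis c (m ((), c))) ≠ 0 := by
  cases G with
  | Ga =>
    have : axis c (m ((), c)) = m := by
      ext ⟨⟨⟩, c'⟩
      obtain rfl : c = c' := Subsingleton.elim (α := Fin 1) c c'
      simp
    rwa [this]
  | H1 =>
    have h1 := coef_comp_of_ite V (H1.comulCoeff_z_yx (m ((), H1.x)) (m ((), H1.y)) (m ((), H1.z)))
    have h2 := coef_comp_of_ite V (H1.comulCoeff_y_x (m ((), H1.x)) (m ((), H1.y)))
    have h3 : axis H1.z (m ((), H1.z)) + (axis H1.y (m ((), H1.y)) + axis H1.x (m ((), H1.x))) =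
        m := by
      apply H1.expo_ext <;> simp
    rw [Int.cast_one, one_smul] at h1 h2
    rw [h3, ← h2] at h1
    revert c
    refine H1.coord_cases ?_ ?_ ?_ <;> intro h <;> rw [h] at h1 <;> apply hm <;> rw [← h1] <;>
      simp

section Digits

variable {q : ℕ} [hq : Fact q.Prime] [CharP k q] (V : RepOne k G) (c : Fin G.dim)

/-- The scalar is `n.choose (q ^ j)`, reduced modulo `q`. -/
theorem coef_axis_pow_comp (j n : ℕ) (hn : q ^ j ≤ n) :
    coef V (axis c (q ^ j)) ∘ₗ coef V (axis c (n - q ^ j)) =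
      ((n / q ^ j : ℕ) : k) • coef V (axis c n) := by
  rw [coef_axis_comp, Nat.add_sub_cancel' hn]
  congr 1
  exact (CharP.cast_eq_iff_mod_eq k q).2 (Nat.choose_pow_modEq_div hq.1 n j)

theorem coef_axis_pow_pow (j r : ℕ) :
    coef V (axis c (q ^ j)) ^ r = (r.factorial : k) • coef V (axis c (r * q ^ j)) := by
  induction r with
  | zero => simp [coef_zero, Module.End.one_eq_id]
  | succ r ih =>
    have h := coef_axis_pow_comp V c (q := q) j ((r + 1) * q ^ j) (Nat.le_mul_of_pos_left _ (by simp))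
    rw [Nat.mul_div_cancel _ (Nat.pow_pos hq.1.pos), Nat.succ_mul, Nat.add_sub_cancel] at h
    rw [pow_succ', ih, Module.End.mul_eq_comp, LinearMap.comp_smul, h, smul_smul, Nat.succ_mul,
      Nat.factorial_succ]
    push_cast
    rw [mul_comm]

/-- The `q`-th power carries the factor `q! = 0`, so the endomorphism is nilpotent. Cayley–Hamilton
then replaces the exponent `q`, which grows with the index, by a bound on the dimension, which does
not. -/
theorem coef_axis_pow_pow_eq_zero (j : ℕ) {d : ℕ} (hd : Module.finrank k V ≤ d) :
    coef V (axis c (q ^ j)) ^ d = 0 := by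
  have h : IsNilpotent (coef V (axis c (q ^ j))) := by
    refine ⟨q, ?_⟩
    rw [coef_axis_pow_pow, (CharP.cast_eq_zero_iff k q _).2 (Nat.dvd_factorial hq.1.pos le_rfl),
      zero_smul]
  have h' := LinearMap.aeval_self_charpoly (coef V (axis c (q ^ j)))
  rw [h.charpoly_eq_X_pow_finrank, map_pow, Polynomial.aeval_X] at h'
  exact pow_eq_zero_of_le hd h'

/-- Splitting off one more factor lowers the `j`-th digit by one. The scalar to be inverted is `n /
q ^ j - s`, nonzero modulo `q` as long as `s` is less than the original digit. -/
theorem exists_coef_axis_eq (n j s : ℕ) (hs : s ≤ n / q ^ j % q) :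
    ∃ u : k, coef V (axis c n) =
      u • ((coef V (axis c (q ^ j)) ^ s) ∘ₗ coef V (axis c (n - s * q ^ j))) := by
  induction s with
  | zero => exact ⟨1, by simp [Module.End.one_eq_id]⟩
  | succ s ih =>
    obtain ⟨u, hu⟩ := ih (by omega)
    have hpos : 0 < q ^ j := Nat.pow_pos hq.1.pos
    have hdiv : (n - s * q ^ j) / q ^ j = n / q ^ j - s := by
      rw [mul_comm, Nat.sub_mul_div]
    have hlt : s < n / q ^ j := lt_of_lt_of_le hs (Nat.mod_le _ _)
    have hne : (((n - s * q ^ j) / q ^ j : ℕ) : k) ≠ 0 := by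
      rw [hdiv, Ne, CharP.cast_eq_zero_iff k q]
      intro hdvd
      have h1 := Nat.mod_lt (n / q ^ j) hq.1.pos
      have h2 := (Nat.modEq_iff_dvd' hlt.le).2 hdvd
      rw [Nat.ModEq, Nat.mod_eq_of_lt (by omega)] at h2
      omega
    have hle : q ^ j ≤ n - s * q ^ j := by
      have := (Nat.le_div_iff_mul_le hpos).1 hlt
      rw [Nat.succ_mul] at this
      omega
    have h := coef_axis_pow_comp V c (q := q) j (n - s * q ^ j) hle
    refine ⟨u * (((n - s * q ^ j) / q ^ j : ℕ) : k)⁻¹, ?_⟩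
    rw [hu, pow_succ, Module.End.mul_eq_comp, LinearMap.comp_assoc, Nat.succ_mul, ← Nat.sub_sub, h,
      LinearMap.comp_smul, smul_smul, mul_assoc, inv_mul_cancel₀ hne, mul_one]

/-- A digit `≥ d` would let the zero endomorphism `coef V (axis c (q ^ j)) ^ d` be split off. -/
theorem coef_axis_digit_lt {n : ℕ} (hn : coef V (axis c n) ≠ 0) (j : ℕ) {d : ℕ}
    (hd : Module.finrank k V ≤ d) : n / q ^ j % q < d := by
  by_contra h
  obtain ⟨u, hu⟩ := exists_coef_axis_eq V c (q := q) n j d (by omega)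
  rw [coef_axis_pow_pow_eq_zero V c j hd, LinearMap.zero_comp, smul_zero] at hu
  exact hn hu

theorem coef_axis_pow_ne_zero {n : ℕ} (hn : coef V (axis c n) ≠ 0) (j : ℕ)
    (hj : n / q ^ j % q ≠ 0) : coef V (axis c (q ^ j)) ≠ 0 := by
  intro h
  obtain ⟨u, hu⟩ := exists_coef_axis_eq V c (q := q) n j 1 (by omega)
  rw [pow_one, h, LinearMap.zero_comp, smul_zero] at hu
  exact hn hu

end Digits

/-- The exponents of the monomials in the coordinates of the factors in `T` with all degrees less
than `d`. -/
def _root_.UnipotentGroup.box (G : UnipotentGroup) {J : Type} (T : Finset J) (d : ℕ) :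
    Finset (G.Expo J) :=
  (T ×ˢ Finset.univ).finsupp fun _ => Finset.range d

/-- The preimage consists of the base `q` digits of `m`. They are less than `d`, and a nonzero one
sits at a position where the axis coefficient is nonzero, hence at some `ν t` with `t ∈ T`. -/
theorem exists_twist_eq {q : ℕ} [hq : Fact q.Prime] [CharP k q] (V : RepOne k G) {d : ℕ}
    (hd : Module.finrank k V ≤ d) {ν : J → ℕ} (hν : Function.Injective ν) (T : Finset J)
    (hT : ∀ c j, coef V (axis c (q ^ j)) ≠ 0 → ∃ t ∈ T, ν t = j) {m : G.Expo Unit}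
    (hm : coef V m ≠ 0) : ∃ e ∈ G.box T d, twist q ν e = m := by
  classical
  let e : G.Expo J := Finsupp.onFinset (T ×ˢ Finset.univ)
    (fun s => if s.1 ∈ T then m ((), s.2) / q ^ ν s.1 % q else 0)
    (fun s hs => Finset.mem_product.2 ⟨by by_contra h; simp [h] at hs, Finset.mem_univ _⟩)
  have he : ∀ j ∈ T, ∀ c, e (j, c) = m ((), c) / q ^ ν j % q := fun j hj c => if_pos hj
  have hsupp : e.support ⊆ T ×ˢ Finset.univ := Finsupp.support_onFinset_subset
  refine ⟨e, ?_, ?_⟩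
  · refine Finset.mem_finsupp_iff.2 ⟨hsupp, fun s hs => ?_⟩
    obtain ⟨hs, -⟩ := Finset.mem_product.1 hs
    refine Finset.mem_range.2 ?_
    rw [← Prod.mk.eta (p := s), he _ hs]
    exact coef_axis_digit_lt V _ (coef_axis_ne_zero V hm _) _ hd
  · ext ⟨⟨⟩, c⟩
    rw [twist_apply q ν e c (T := T) fun s hs => (Finset.mem_product.1 (hsupp hs)).1,
      Finset.sum_congr rfl fun j hj => by rw [he j hj]]
    -- `N` is at once beyond all positions in use and at least the length of the expansion of `m
    -- ((), c)`.
    obtain ⟨N, hN⟩ : ∃ N, (∀ j ∈ T, ν j < N) ∧ m ((), c) < q ^ N := by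
      refine ⟨(T.sup ν + 1) + m ((), c), fun j hj => ?_, ?_⟩
      · have := Finset.le_sup (f := ν) hj
        omega
      · exact lt_of_lt_of_le (Nat.lt_pow_self hq.1.one_lt)
          (Nat.pow_le_pow_right hq.1.pos (Nat.le_add_left _ _))
    have key := Nat.mod_pow_eq_sum q (m ((), c)) N
    rw [Nat.mod_eq_of_lt hN.2] at key
    refine Eq.trans ?_ key.symm
    rw [← Finset.sum_image (s := T) (g := ν) (f := fun j => q ^ j * (m ((), c) / q ^ j % q))
      hν.injOn]
    -- The positions below `N` that are not in `ν(T)` carry the digit `0`.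
    refine Finset.sum_subset (fun i hi => ?_) fun i _ hi => ?_
    · obtain ⟨j, hj, rfl⟩ := Finset.mem_image.1 hi
      exact Finset.mem_range.2 (hN.1 j hj)
    · by_contra h
      obtain ⟨t, ht, rfl⟩ := hT c i (coef_axis_pow_ne_zero V c (coef_axis_ne_zero V hm c) i
        fun h0 => h (by rw [h0, mul_zero]))
      exact hi (Finset.mem_image_of_mem _ ht)

section Frob

variable (q : ℕ) [hq : Fact q.Prime] [CharP k q] (ν : J → ℕ)

/-- The pullback of a representation of `G^J` along the product of Frobenius powers `G → G^J`. -/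
def frobPull (V : RepPow k G J) : RepOne k G where
  carrier := V
  coact := (frob k q ν).toLinearMap.lTensor V ∘ₗ V.coact
  coassoc := by
    have h1 : ∀ x : V ⊗[k] HopfAlg G J k, TensorProduct.assoc k V _ _
        (((frob k q ν).toLinearMap.lTensor V ∘ₗ V.coact).rTensor _
          ((frob k q ν).toLinearMap.lTensor V x)) =
        (TensorProduct.map (frob k q ν).toLinearMap (frob k q ν).toLinearMap).lTensor V
          (TensorProduct.assoc k V _ _ (V.coact.rTensor _ x)) := by
      intro x
      induction x with
      | zero => simp
      | add x y hx hy => simp only [map_add, hx, hy]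
      | tmul v a =>
        simp only [LinearMap.lTensor_tmul, LinearMap.rTensor_tmul, LinearMap.comp_apply]
        generalize V.coact v = x
        induction x with
        | zero => simp
        | add x y hx hy => simp only [map_add, TensorProduct.add_tmul, hx, hy]
        | tmul v b => simp
    have h2 : ∀ x : V ⊗[k] HopfAlg G J k, (Coalgebra.comul (R := k)).lTensor V
        ((frob k q ν).toLinearMap.lTensor V x) =
        (TensorProduct.map (frob k q ν).toLinearMap (frob k q ν).toLinearMap).lTensor V
          ((Coalgebra.comul (R := k)).lTensor V x) := by
      intro x
      induction x with
      | zero => simp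
      | add x y hx hy => simp only [map_add, hx, hy]
      | tmul v a => simp [comul_frob]
    ext v
    simp only [LinearMap.comp_apply, LinearEquiv.coe_coe]
    exact (h1 _).trans ((congrArg _ (coassoc_apply V v)).trans (h2 _).symm)
  counit_coact := by
    ext v
    have h : ∀ x : V ⊗[k] HopfAlg G J k, (Coalgebra.counit (R := k)).lTensor V
        ((frob k q ν).toLinearMap.lTensor V x) = (Coalgebra.counit (R := k)).lTensor V x := by
      intro x
      induction x with
      | zero => simp
      | add x y hx hy => simp only [map_add, hx, hy]
      | tmul v a => simp [counit_frob]
    simp only [LinearMap.comp_apply, LinearEquiv.coe_coe, h]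
    exact counit_apply V v

/-- Without injectivity of `twist`, all exponents with the same image contribute. -/
theorem coef_frobPull (V : RepPow k G J) {S : Finset (G.Expo J)} (hS : ∀ e ∉ S, coef V e = 0)
    (m : G.Expo Unit) [DecidableEq (G.Expo Unit)] :
    coef (frobPull q ν V) m = ∑ e ∈ S, if twist q ν e = m then coef V e else 0 := by
  refine LinearMap.ext fun (v : V) => ?_
  change tcoeff V m ((frob k q ν).toLinearMap.lTensor V (V.coact v)) = _
  rw [coact_eq_sum V hS]
  simp only [map_sum, LinearMap.lTensor_tmul, AlgHom.toLinearMap_apply, frob_mono, tcoeff_tmul,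
    lcoeff_mono]
  refine Eq.trans ?_ (LinearMap.sum_apply S (fun e => if twist q ν e = m then coef V e else 0) v).symm
  refine Finset.sum_congr rfl fun e _ => ?_
  split_ifs <;> simp

theorem coef_frobPull_twist (V : RepPow k G J) {S : Finset (G.Expo J)}
    (hS : ∀ e ∉ S, coef V e = 0) (hinj : Set.InjOn (twist q ν : G.Expo J → G.Expo Unit) S)
    {e : G.Expo J} (he : e ∈ S) : coef (frobPull q ν V) (twist q ν e) = coef V e := by
  classical
  rw [coef_frobPull q ν V hS, Finset.sum_eq_single e]
  · rw [if_pos rfl]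
  · intro f hf hne
    exact if_neg fun h => hne (hinj hf he h)
  · exact fun h => absurd he h

theorem exists_of_coef_frobPull_ne_zero (V : RepPow k G J) {S : Finset (G.Expo J)}
    (hS : ∀ e ∉ S, coef V e = 0) {m : G.Expo Unit} (hm : coef (frobPull q ν V) m ≠ 0) :
    ∃ e ∈ S, twist q ν e = m := by
  classical
  rw [coef_frobPull q ν V hS] at hm
  obtain ⟨e, he, h⟩ := Finset.exists_ne_zero_of_sum_ne_zero hm
  refine ⟨e, he, ?_⟩
  by_contra h'
  exact h (if_neg h')

end Frob

end FDComod
end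
-- Linear algebra over an ultraproduct of fields.
noncomputable section

variable {ι : Type} (U : Ultrafilter ι) {k : ι → Type u} [∀ i, Field (k i)]

/-- If `f` avoided each of the finitely many values up to `d` almost everywhere, it would avoid them
all at once. -/
theorem Ultrafilter.exists_eventually_eq_of_le {f : ι → ℕ} {d : ℕ} (h : ∀ᶠ i in U, f i ≤ d) :
    ∃ r, ∀ᶠ i in U, f i = r := by
  by_contra! hr
  have h1 : ∀ᶠ i in U, ∀ r ∈ Set.Iic d, f i ≠ r :=
    (Filter.eventually_all_finite (Set.finite_Iic d)).2 fun r _ =>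
      hr r
  obtain ⟨i, hi, hi'⟩ := (h.and h1).exists
  exact hi' _ hi rfl

namespace UField

theorem mk_eq_mk {a b : ∀ i, k i} : mk U a = mk U b ↔ ∀ᶠ i in U, a i = b i := by
  refine Ideal.Quotient.eq.trans ?_
  change (∀ᶠ i in U, (a - b) i = 0) ↔ _
  simp only [Pi.sub_apply, sub_eq_zero]

theorem mk_zero : mk U (fun i => (0 : k i)) = 0 := rfl

theorem mk_intCast (z : ℤ) : mk U (fun i => (z : k i)) = (z : UField U k) :=
  map_intCast (Ideal.Quotient.mk (uNullIdeal U k)) z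

/-- A representative of an element of the ultraproduct. -/
def rep (a : UField U k) : ∀ i, k i := Classical.choose (Ideal.Quotient.mk_surjective a)

@[simp] theorem mk_rep (a : UField U k) : mk U (rep U a) = a :=
  Classical.choose_spec (Ideal.Quotient.mk_surjective a)

end UField

namespace UVec

variable {V W X : ι → Type u} [∀ i, AddCommGroup (V i)] [∀ i, Module (k i) (V i)]
  [∀ i, AddCommGroup (W i)] [∀ i, Module (k i) (W i)]
  [∀ i, AddCommGroup (X i)] [∀ i, Module (k i) (X i)]

theorem mk_sum {κ : Type*} (s : Finset κ) (v : κ → ∀ i, V i) :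
    mk U k (fun i => ∑ j ∈ s, v j i) = ∑ j ∈ s, mk U k (v j) := by
  induction s using Finset.cons_induction with
  | empty => simp only [Finset.sum_empty]; rfl
  | cons j s hj ih =>
    simp only [Finset.sum_cons]
    rw [← ih, UVec.mk_add]

variable {U} in
/-- A representative of an element of the ultraproduct. -/
def rep (a : UVec U k V) : ∀ i, V i := Classical.choose (Submodule.Quotient.mk_surjective _ a)

@[simp] theorem mk_rep (a : UVec U k V) : mk U k (rep a) = a :=
  Classical.choose_spec (Submodule.Quotient.mk_surjective _ a)

/-- The ultraproduct of a family of linear maps. -/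
def lmap (f : ∀ i, V i →ₗ[k i] W i) : UVec U k V →ₗ[UField U k] UVec U k W where
  toFun := UVec.map U k fun i => f i
  map_add' := by
    refine UVec.ind U fun v => UVec.ind U fun w => ?_
    exact congrArg (UVec.mk U k) (funext fun i => map_add (f i) (v i) (w i))
  map_smul' := by
    refine UField.ind U fun a => UVec.ind U fun v => ?_
    exact congrArg (UVec.mk U k) (funext fun i => map_smul (f i) (a i) (v i))

@[simp] theorem lmap_mk (f : ∀ i, V i →ₗ[k i] W i) (v : ∀ i, V i) :
    lmap U f (mk U k v) = mk U k fun i => f i (v i) := rfl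

/-- Maps that differ almost everywhere are told apart by the class of a family of witnesses. This
equivalence carries identities from the ultraproduct down to almost every index and back; no bound
on dimensions is needed. -/
theorem lmap_eq_lmap {f g : ∀ i, V i →ₗ[k i] W i} :
    lmap U f = lmap U g ↔ ∀ᶠ i in U, f i = g i := by
  classical
  constructor
  · intro h
    by_contra hne
    rw [← Ultrafilter.eventually_not] at hne
    have hv : ∀ i, ∃ v : V i, f i ≠ g i → f i v ≠ g i v := by
      intro i
      by_cases hi : f i = g i
      · exact ⟨0, fun h => absurd hi h⟩
      · obtain ⟨v, hv⟩ := not_forall.1 fun h => hi (LinearMap.ext h)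
        exact ⟨v, fun _ => hv⟩
    choose v hv using hv
    have h1 := LinearMap.congr_fun h (mk U k v)
    rw [lmap_mk, lmap_mk, mk_eq_mk] at h1
    obtain ⟨i, hi, hi'⟩ := (hne.and h1).exists
    exact hv i hi hi'
  · intro h
    refine LinearMap.ext (UVec.ind U fun v => ?_)
    rw [lmap_mk, lmap_mk, mk_eq_mk]
    filter_upwards [h] with i hi
    rw [hi]

theorem lmap_comp (g : ∀ i, W i →ₗ[k i] X i) (f : ∀ i, V i →ₗ[k i] W i) :
    lmap U g ∘ₗ lmap U f = lmap U fun i => g i ∘ₗ f i :=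
  LinearMap.ext (UVec.ind U fun _ => rfl)

theorem lmap_id : lmap U (fun i => (LinearMap.id : V i →ₗ[k i] V i)) = LinearMap.id :=
  LinearMap.ext (UVec.ind U fun _ => rfl)

theorem lmap_zero : lmap U (fun i => (0 : V i →ₗ[k i] W i)) = 0 :=
  LinearMap.ext (UVec.ind U fun _ => rfl)

theorem lmap_smul (a : ∀ i, k i) (f : ∀ i, V i →ₗ[k i] W i) :
    lmap U (fun i => a i • f i) = UField.mk U a • lmap U f :=
  LinearMap.ext (UVec.ind U fun _ => rfl)

theorem lmap_sum {κ : Type*} (s : Finset κ) (f : κ → ∀ i, V i →ₗ[k i] W i) :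
    lmap U (fun i => ∑ j ∈ s, f j i) = ∑ j ∈ s, lmap U (f j) := by
  refine LinearMap.ext (UVec.ind U fun v => ?_)
  simp only [lmap_mk, LinearMap.sum_apply, mk_sum]

variable {U} in
/-- Almost everywhere bases give a basis of the ultraproduct. -/
def basis {κ : Type} [Fintype κ] (b : ∀ i, κ → V i)
    (hb : ∀ᶠ i in U, ∃ B : Module.Basis κ (k i) (V i), ⇑B = b i) :
    Module.Basis κ (UField U k) (UVec U k V) :=
  have hsum : ∀ a : κ → ∀ i, k i, ∑ j, UField.mk U (a j) • mk U k (fun i => b i j) =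
      mk U k fun i => ∑ j, a j i • b i j := fun a => by
    rw [mk_sum]; rfl
  Module.Basis.mk (v := fun j => mk U k fun i => b i j)
    (by
      rw [Fintype.linearIndependent_iff]
      intro a ha j
      have h1 : ∑ j, UField.mk U (UField.rep U (a j)) • mk U k (fun i => b i j) = mk U k 0 := by
        simp only [UField.mk_rep]
        exact ha
      rw [hsum, mk_eq_mk] at h1
      rw [← UField.mk_rep U (a j), ← UField.mk_zero, UField.mk_eq_mk]
      filter_upwards [h1, hb] with i hi hB
      obtain ⟨B, hB⟩ := hB
      rw [← hB] at hi
      exact Fintype.linearIndependent_iff.1 B.linearIndependent _ hi j)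
    (by
      rintro v -
      revert v
      refine UVec.ind U fun v => ?_
      have hv : ∀ i, ∃ a : κ → k i, (∃ B : Module.Basis κ (k i) (V i), ⇑B = b i) →
          v i = ∑ j, a j • b i j := by
        intro i
        by_cases h : ∃ B : Module.Basis κ (k i) (V i), ⇑B = b i
        · obtain ⟨B, hB⟩ := h
          exact ⟨fun j => B.repr (v i) j, fun _ => by rw [← hB]; exact (B.sum_repr _).symm⟩
        · exact ⟨0, fun h' => absurd h' h⟩
      choose a ha using hv
      have : mk U k v = mk U k fun i => ∑ j, a i j • b i j := by
        rw [mk_eq_mk]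
        filter_upwards [hb] with i hi
        exact ha i hi
      rw [this, ← hsum fun j i => a i j]
      exact Submodule.sum_mem _ fun j _ => Submodule.smul_mem _ _
        (Submodule.subset_span ⟨j, rfl⟩))

@[simp] theorem basis_apply {κ : Type} [Fintype κ] (b : ∀ i, κ → V i)
    (hb : ∀ᶠ i in U, ∃ B : Module.Basis κ (k i) (V i), ⇑B = b i) (j : κ) :
    basis b hb j = mk U k fun i => b i j := by
  unfold basis
  exact Module.Basis.mk_apply _ _ j

variable {U} in
/-- The dimensions are almost everywhere bounded. -/
def Bounded (U : Ultrafilter ι) (k : ι → Type u) [∀ i, Field (k i)] (V : ι → Type u)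
    [∀ i, AddCommGroup (V i)] [∀ i, Module (k i) (V i)] : Prop :=
  ∃ d : ℕ, ∀ᶠ i in U, Module.finrank (k i) (V i) ≤ d

variable {U} in
theorem Bounded.exists_basis [∀ i, Module.Finite (k i) (V i)] (h : Bounded U k V) :
    ∃ (r : ℕ) (b : ∀ i, Fin r → V i),
      ∀ᶠ i in U, ∃ B : Module.Basis (Fin r) (k i) (V i), ⇑B = b i := by
  classical
  obtain ⟨d, hd⟩ := h
  obtain ⟨r, hr⟩ := U.exists_eventually_eq_of_le hd
  have hb : ∀ i, ∃ b : Fin r → V i, Module.finrank (k i) (V i) = r →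
      ∃ B : Module.Basis (Fin r) (k i) (V i), ⇑B = b := by
    intro i
    by_cases hi : Module.finrank (k i) (V i) = r
    · exact ⟨Module.finBasisOfFinrankEq _ _ hi, fun _ => ⟨_, rfl⟩⟩
    · exact ⟨0, fun h => absurd h hi⟩
  choose b hb using hb
  refine ⟨r, b, ?_⟩
  filter_upwards [hr] with i hi
  exact hb i hi

variable {U} in
-- With a finite basis a linear map is determined by finitely many images, and representatives of
-- these define the family.
theorem Bounded.exists_lmap [∀ i, Module.Finite (k i) (V i)] (h : Bounded U k V)
    (f : UVec U k V →ₗ[UField U k] UVec U k W) : ∃ g : ∀ i, V i →ₗ[k i] W i, lmap U g = f := by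
  obtain ⟨r, b, hb⟩ := h.exists_basis
  have hg : ∀ i, ∃ g : V i →ₗ[k i] W i, (∃ B : Module.Basis (Fin r) (k i) (V i), ⇑B = b i) →
      ∀ j, g (b i j) = rep (f (mk U k fun i => b i j)) i := by
    intro i
    by_cases h : ∃ B : Module.Basis (Fin r) (k i) (V i), ⇑B = b i
    · obtain ⟨B, hB⟩ := h
      exact ⟨B.constr (k i) fun j => rep (f (mk U k fun i => b i j)) i,
        fun _ j => by rw [← hB, B.constr_basis]⟩
    · exact ⟨0, fun h' => absurd h' h⟩
  choose g hg using hg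
  refine ⟨g, (basis b hb).ext fun j => ?_⟩
  rw [basis_apply, lmap_mk, ← mk_rep U (f _), mk_eq_mk]
  filter_upwards [hb] with i hi
  exact hg i hi j

variable (k V W) in
/-- The canonical map from the tensor product of ultraproducts to the ultraproduct of the tensor
products. -/
def tensorMap : UVec U k V ⊗[UField U k] UVec U k W →ₗ[UField U k]
    UVec U k fun i => V i ⊗[k i] W i :=
  TensorProduct.lift (LinearMap.mk₂ (UField U k) (UVec.map₂ U k fun i v w => v ⊗ₜ[k i] w)
    (by
      refine UVec.ind U fun v => UVec.ind U fun w => UVec.ind U fun x => ?_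
      exact congrArg (mk U k) (funext fun i => TensorProduct.add_tmul _ _ _))
    (by
      refine UField.ind U fun a => UVec.ind U fun v => UVec.ind U fun w => ?_
      exact congrArg (mk U k) (funext fun i => (TensorProduct.smul_tmul' _ _ _).symm))
    (by
      refine UVec.ind U fun v => UVec.ind U fun w => UVec.ind U fun x => ?_
      exact congrArg (mk U k) (funext fun i => TensorProduct.tmul_add _ _ _))
    (by
      refine UField.ind U fun a => UVec.ind U fun v => UVec.ind U fun w => ?_
      exact congrArg (mk U k) (funext fun i => TensorProduct.tmul_smul _ _ _)))

@[simp] theorem tensorMap_mk (v : ∀ i, V i) (w : ∀ i, W i) :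
    tensorMap U k V W (mk U k v ⊗ₜ mk U k w) = mk U k fun i => v i ⊗ₜ w i := rfl

variable {U} in
/-- The ultraproduct of tensor products of boundedly finite-dimensional spaces. -/
def tensorEquiv [∀ i, Module.Finite (k i) (V i)] [∀ i, Module.Finite (k i) (W i)]
    (hV : Bounded U k V) (hW : Bounded U k W) :
    UVec U k V ⊗[UField U k] UVec U k W ≃ₗ[UField U k] UVec U k fun i => V i ⊗[k i] W i :=
  LinearEquiv.ofBijective (tensorMap U k V W) (by
    obtain ⟨r, b, hb⟩ := hV.exists_basis
    obtain ⟨s, c, hc⟩ := hW.exists_basis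
    have hbc : ∀ᶠ i in U, ∃ B : Module.Basis (Fin r × Fin s) (k i) (V i ⊗[k i] W i),
        ⇑B = fun x => b i x.1 ⊗ₜ[k i] c i x.2 := by
      filter_upwards [hb, hc] with i hi hi'
      obtain ⟨B, hB⟩ := hi
      obtain ⟨C, hC⟩ := hi'
      exact ⟨B.tensorProduct C, by ext x; rw [← hB, ← hC, Module.Basis.tensorProduct_apply']⟩
    -- The canonical map matches the product basis with the ultraproduct of the product bases.
    have : tensorMap U k V W = (((basis b hb).tensorProduct (basis c hc)).equiv
        (basis (fun i (x : Fin r × Fin s) => b i x.1 ⊗ₜ[k i] c i x.2) hbc)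
          (Equiv.refl _)).toLinearMap := by
      refine ((basis b hb).tensorProduct (basis c hc)).ext fun x => ?_
      rw [LinearEquiv.coe_coe, Module.Basis.equiv_apply, Module.Basis.tensorProduct_apply']
      simp
    rw [this]
    exact LinearEquiv.bijective _)

variable (k) in
/-- The ultraproduct of the fields as a space over itself. -/
def unitEquiv : UField U k ≃ₗ[UField U k] UVec U k k :=
  LinearEquiv.ofBijective (LinearMap.toSpanSingleton _ _ (mk U k fun i => (1 : k i))) (by
    constructor
    · refine UField.ind U fun a => UField.ind U fun b => ?_
      simp only [LinearMap.toSpanSingleton_apply, mk_smul, mk_eq_mk, UField.mk_eq_mk, smul_eq_mul,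
        mul_one, imp_self]
    · refine UVec.ind U fun a => ⟨UField.mk U a, ?_⟩
      simp only [LinearMap.toSpanSingleton_apply, mk_smul, smul_eq_mul, mul_one])

theorem unitEquiv_mk (a : ∀ i, k i) : unitEquiv U k (UField.mk U a) = mk U k a := by
  change UField.mk U a • mk U k (fun i => (1 : k i)) = _
  simp only [mk_smul, smul_eq_mul, mul_one]

end UVec
end
-- Objects of finite type and the fully faithful functor to representations of `G^J`.
noncomputable section

open UnipotentGroup UnipotentGroup.HopfAlg FDComod

/-- The fields have positive characteristic, which tends to infinity along the ultrafilter. -/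
class LargeChar {ι : Type} (U : Ultrafilter ι) (k : ι → Type u) [∀ i, Field (k i)] : Prop where
  prime : ∀ i, (ringChar (k i)).Prime
  tendsto : Filter.Tendsto (fun i => ringChar (k i)) U Filter.atTop

section

variable {ι : Type} (U : Ultrafilter ι) (k : ι → Type u) [∀ i, Field (k i)]
  (G : UnipotentGroup) {J : Type} (ν : J → ℕ)

/-- The objects `[X i]` such that almost every `X i` is defined by finitely many coefficients with
exponents twisted from a finite set of exponents for `G^J`. -/
def finiteType : ObjectProperty (RestrRep U k G) := fun X =>
  ∃ S : Finset (G.Expo J), ∀ᶠ i in U, ∀ m, coef (X.obj.obj i : RepOne (k i) G) m ≠ 0 →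
    ∃ e ∈ S, twist (ringChar (k i)) ν e = m

variable {U k G}

/-- The ultraproduct of the underlying spaces. -/
abbrev RestrRep.carrier (X : RestrRep U k G) : Type u :=
  UVec U k fun i => ((X.obj.obj i : RepOne (k i) G) : Type u)

instance (X : RestrRep U k G) : Module.Finite (UField U k) X.carrier :=
  UVec.finite U X.property

/-- The coefficients of the representation of `G^J` on the ultraproduct. -/
def RestrRep.coef (X : RestrRep U k G) (e : G.Expo J) : X.carrier →ₗ[UField U k] X.carrier :=
  UVec.lmap U fun i => FDComod.coef (X.obj.obj i : RepOne (k i) G) (twist (ringChar (k i)) ν e)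

/-- The linear map underlying a morphism. -/
def RestrRep.lin {X Y : RestrRep U k G} (f : X ⟶ Y) : X.carrier →ₗ[UField U k] Y.carrier :=
  ((ultraFibre U k fun i => G.HopfAlg Unit (k i)).map f).hom.hom

/-- The class of a family of morphisms. -/
abbrev RestrRep.homMk {X Y : RestrRep U k G} (f : ∀ i, X.obj.obj i ⟶ Y.obj.obj i) : X ⟶ Y :=
  ObjectProperty.homMk (UCat.homMk f)

theorem RestrRep.hom_ind {X Y : RestrRep U k G} {p : (X ⟶ Y) → Prop}
    (h : ∀ f, p (RestrRep.homMk f)) (f : X ⟶ Y) : p f := by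
  obtain ⟨f⟩ := f
  exact UCat.hom_ind (p := fun f => p ⟨f⟩) h f

theorem RestrRep.lin_homMk {X Y : RestrRep U k G} (f : ∀ i, X.obj.obj i ⟶ Y.obj.obj i) :
    RestrRep.lin (RestrRep.homMk f) = UVec.lmap U fun i => (f i).lin :=
  LinearMap.ext (UVec.ind U fun _ => rfl)

theorem RestrRep.lin_id (X : RestrRep U k G) : RestrRep.lin (𝟙 X) = LinearMap.id :=
  LinearMap.ext (UVec.ind U fun _ => rfl)

theorem RestrRep.lin_comp {X Y Z : RestrRep U k G} (f : X ⟶ Y) (g : Y ⟶ Z) :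
    RestrRep.lin (f ≫ g) = RestrRep.lin g ∘ₗ RestrRep.lin f :=
  congrArg (fun h => h.hom.hom) ((ultraFibre U k fun i => G.HopfAlg Unit (k i)).map_comp f g)

theorem RestrRep.lin_injective {X Y : RestrRep U k G} :
    Function.Injective (RestrRep.lin : (X ⟶ Y) → _) := by
  intro f g
  revert f; refine RestrRep.hom_ind fun f => ?_
  revert g; refine RestrRep.hom_ind fun g => ?_
  intro h
  rw [RestrRep.lin_homMk, RestrRep.lin_homMk, UVec.lmap_eq_lmap] at h
  refine congrArg ObjectProperty.homMk (UCat.homMk_eq.2 ?_)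
  filter_upwards [h] with i hi
  exact FDComod.hom_ext hi

theorem RestrRep.coef_comm {X Y : RestrRep U k G} (f : X ⟶ Y) (e : G.Expo J) (v : X.carrier) :
    RestrRep.lin f (X.coef ν e v) = Y.coef ν e (RestrRep.lin f v) := by
  revert f; refine RestrRep.hom_ind fun f => ?_
  revert v; refine UVec.ind U fun v => ?_
  rw [RestrRep.lin_homMk]
  exact congrArg (UVec.mk U k) (funext fun i => FDComod.coef_comm (f i) _ (v i))

theorem RestrRep.coef_zero (X : RestrRep U k G) : X.coef ν 0 = LinearMap.id := by
  rw [RestrRep.coef, ← UVec.lmap_id]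
  congr 1
  funext i
  rw [map_zero]
  exact FDComod.coef_zero _

variable [hU : LargeChar U k] [hν : Fact (Function.Injective ν)]

instance (i : ι) : CharP (k i) (ringChar (k i)) := ringChar.charP _

theorem eventually_injOn (S : Finset (G.Expo J)) : ∀ᶠ i in U,
    Set.InjOn (twist (ringChar (k i)) ν : G.Expo J → G.Expo Unit) S :=
  eventually_twist_injOn (LargeChar.tendsto (U := U) (k := k)) hν.1 S

variable {ν} in
-- Eventually `twist` is injective on `insert e S`, so the twist of `e` is none of the occurring
-- exponents.
theorem RestrRep.coef_eq_zero {X : RestrRep U k G} {S : Finset (G.Expo J)}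
    (hS : ∀ᶠ i in U, ∀ m, FDComod.coef (X.obj.obj i : RepOne (k i) G) m ≠ 0 →
      ∃ e ∈ S, twist (ringChar (k i)) ν e = m) {e : G.Expo J} (he : e ∉ S) :
    X.coef ν e = 0 := by
  classical
  rw [RestrRep.coef, ← UVec.lmap_zero, UVec.lmap_eq_lmap]
  filter_upwards [hS, eventually_injOn ν (U := U) (k := k) (insert e S)] with i hi hinj
  by_contra h
  obtain ⟨f, hf, hfe⟩ := hi _ h
  have := hinj (by simp [hf]) (by simp) hfe
  exact he (this ▸ hf)

variable {ν} in
-- Index by index this is the relation for `G`, whose sum runs over twists of `S`, with constants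
-- identified by `comulCoeff_twist`. Injectivity is required on `S`, on `e` and `f`, and on the
-- exponents `T` occurring in the comultiplication of the monomials of `S`.
theorem RestrRep.coef_comp {X : RestrRep U k G} {S : Finset (G.Expo J)}
    (hS : ∀ᶠ i in U, ∀ m, FDComod.coef (X.obj.obj i : RepOne (k i) G) m ≠ 0 →
      ∃ e ∈ S, twist (ringChar (k i)) ν e = m) (e f : G.Expo J) :
    X.coef ν e ∘ₗ X.coef ν f =
      ∑ g ∈ S, (comulCoeff e f g : UField U k) • X.coef ν g := by
  classical
  obtain ⟨T, hT⟩ := finite_comulCoeff S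
  simp only [RestrRep.coef, ← UField.mk_intCast, ← UVec.lmap_smul]
  rw [UVec.lmap_comp, ← UVec.lmap_sum, UVec.lmap_eq_lmap]
  filter_upwards [hS, eventually_injOn ν (U := U) (k := k) (insert e (insert f (T ∪ S)))]
    with i hi hinj
  have := Fact.mk (LargeChar.prime (U := U) (k := k) i)
  have h0 : ∀ m ∉ S.image (twist (ringChar (k i)) ν),
      FDComod.coef (X.obj.obj i : RepOne (k i) G) m = 0 := by
    intro m hm
    by_contra h
    obtain ⟨e, he, rfl⟩ := hi m h
    exact hm (Finset.mem_image_of_mem _ he)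
  rw [FDComod.coef_comp _ h0, Finset.sum_image
    (hinj.mono (by intro x hx; simp [Finset.mem_coe.1 hx]))]
  refine Finset.sum_congr rfl fun g hg => ?_
  rw [comulCoeff_twist (k i) _ ν hinj (by simp) (by simp)]
  intro e' f' h
  have := hT g hg e' f' h
  simp [this]

/-- The representation of `G^J` on the ultraproduct of the underlying spaces. -/
def RestrRep.rep (X : RestrRep U k G) (hX : finiteType U k G ν X) :
    RepPow (UField U k) G J :=
  ofCoef X.carrier (X.coef ν) hX.choose
    (fun _ he => RestrRep.coef_eq_zero hX.choose_spec he) (X.coef_zero ν)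
    (fun e f => RestrRep.coef_comp hX.choose_spec e f)

theorem RestrRep.coef_rep (X : RestrRep U k G) (hX : finiteType U k G ν X) (e : G.Expo J) :
    FDComod.coef (X.rep ν hX) e = X.coef ν e := by
  unfold RestrRep.rep
  apply coef_ofCoef

variable (U k G)

/-- The functor to representations of `G^J` over the ultraproduct of the fields. -/
def toRep : (finiteType U k G ν).FullSubcategory ⥤ RepPow (UField U k) G J where
  obj X := X.obj.rep ν X.property
  map {X Y} f := homOfCoef (RestrRep.lin f.hom : X.obj.carrier →ₗ[UField U k] Y.obj.carrier) (by
    intro e v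
    rw [RestrRep.coef_rep, RestrRep.coef_rep]
    exact RestrRep.coef_comm ν f.hom e v)
  map_id X := FDComod.hom_ext (RestrRep.lin_id X.obj)
  map_comp f g := FDComod.hom_ext (RestrRep.lin_comp f.hom g.hom)

variable {U k G ν}

theorem coef_toRep (X : (finiteType U k G ν).FullSubcategory) (e : G.Expo J) :
    FDComod.coef ((toRep U k G ν).obj X) e = X.obj.coef ν e :=
  X.obj.coef_rep ν X.property e

instance : (toRep U k G ν).Faithful where
  map_injective h := ObjectProperty.hom_ext _
    (RestrRep.lin_injective (congrArg FDComod.Hom.lin h))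

instance : (toRep U k G ν).Additive where
  map_add {X Y f g} := FDComod.hom_ext (by
    obtain ⟨f⟩ := f
    revert f; refine RestrRep.hom_ind fun f => ?_
    obtain ⟨g⟩ := g
    revert g; refine RestrRep.hom_ind fun g => ?_
    exact LinearMap.ext (UVec.ind U fun _ => rfl))

instance : (toRep U k G ν).Linear (UField U k) where
  map_smul {X Y} f a := FDComod.hom_ext (by
    obtain ⟨f⟩ := f
    revert f; refine RestrRep.hom_ind fun f => ?_
    revert a; refine UField.ind U fun a => ?_
    exact LinearMap.ext (UVec.ind U fun _ => rfl))

instance : (toRep U k G ν).Full where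
  map_surjective {X Y} f := by
    classical
    obtain ⟨S, hS⟩ := X.property
    obtain ⟨S', hS'⟩ := Y.property
    obtain ⟨g, hg⟩ := UVec.Bounded.exists_lmap (U := U) X.obj.property f.lin
    -- Only exponents in the finite set `S ∪ S'` matter, so a single almost-everywhere statement can
    -- cover all of them.
    have hcomm : ∀ᶠ i in U, ∀ e ∈ S ∪ S',
        g i ∘ₗ FDComod.coef (X.obj.obj.obj i : RepOne (k i) G) (twist (ringChar (k i)) ν e) =
        FDComod.coef (Y.obj.obj.obj i : RepOne (k i) G) (twist (ringChar (k i)) ν e) ∘ₗ g i := by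
      refine (Filter.eventually_all_finset _).2 fun e _ => ?_
      rw [← UVec.lmap_eq_lmap, ← UVec.lmap_comp, ← UVec.lmap_comp, hg]
      ext v
      have := FDComod.coef_comm f e v
      rw [coef_toRep, coef_toRep] at this
      exact this
    have hg' : ∀ i, ∃ h : X.obj.obj.obj i ⟶ Y.obj.obj.obj i,
        (∀ m v, g i (FDComod.coef (X.obj.obj.obj i : RepOne (k i) G) m v) =
          FDComod.coef (Y.obj.obj.obj i : RepOne (k i) G) m (g i v)) → h.lin = g i := by
      intro i
      by_cases h : ∀ m v, g i (FDComod.coef (X.obj.obj.obj i : RepOne (k i) G) m v) =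
          FDComod.coef (Y.obj.obj.obj i : RepOne (k i) G) m (g i v)
      · exact ⟨homOfCoef (g i) h, fun _ => rfl⟩
      -- Default at the negligible set of indices where `g i` is no morphism.
      · exact ⟨0, fun h' => absurd h' h⟩
    choose h hh using hg'
    refine ⟨ObjectProperty.homMk (RestrRep.homMk h), FDComod.hom_ext ?_⟩
    refine (RestrRep.lin_homMk h).trans (Eq.trans ?_ hg)
    rw [UVec.lmap_eq_lmap]
    filter_upwards [hS, hS', hcomm] with i h1 h2 h3
    refine hh i fun m v => ?_
    by_cases hm : ∃ e ∈ S ∪ S', twist (ringChar (k i)) ν e = m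
    · obtain ⟨e, he, rfl⟩ := hm
      exact LinearMap.congr_fun (h3 e he) v
    · have e1 : FDComod.coef (X.obj.obj.obj i : RepOne (k i) G) m = 0 := by
        by_contra h
        obtain ⟨e, he, hem⟩ := h1 m h
        exact hm ⟨e, Finset.mem_union_left _ he, hem⟩
      have e2 : FDComod.coef (Y.obj.obj.obj i : RepOne (k i) G) m = 0 := by
        by_contra h
        obtain ⟨e, he, hem⟩ := h2 m h
        exact hm ⟨e, Finset.mem_union_right _ he, hem⟩
      rw [e1, e2]
      simp

end
end
-- Essential surjectivity, and tensor products at twisted exponents.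
noncomputable section

open UnipotentGroup UnipotentGroup.HopfAlg FDComod

theorem UVec.lmap_bijective {ι : Type} (U : Ultrafilter ι) {k : ι → Type u} [∀ i, Field (k i)]
    {V W : ι → Type u} [∀ i, AddCommGroup (V i)] [∀ i, Module (k i) (V i)]
    [∀ i, AddCommGroup (W i)] [∀ i, Module (k i) (W i)] (f : ∀ i, V i →ₗ[k i] W i)
    (hf : ∀ᶠ i in U, Function.Bijective (f i)) : Function.Bijective (UVec.lmap U f) := by
  constructor
  · refine UVec.ind U fun v => UVec.ind U fun w => ?_
    rw [lmap_mk, lmap_mk, mk_eq_mk, mk_eq_mk]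
    intro h
    filter_upwards [h, hf] with i hi hb
    exact hb.1 hi
  · refine UVec.ind U fun w => ?_
    have hv : ∀ i, ∃ v, Function.Bijective (f i) → f i v = w i := by
      intro i
      by_cases h : Function.Bijective (f i)
      · obtain ⟨v, hv⟩ := h.2 (w i)
        exact ⟨v, fun _ => hv⟩
      · exact ⟨0, fun h' => absurd h' h⟩
    choose v hv using hv
    refine ⟨UVec.mk U k v, ?_⟩
    rw [lmap_mk, mk_eq_mk]
    filter_upwards [hf] with i hi
    exact hv i hi

section

variable {ι : Type} {U : Ultrafilter ι} {k : ι → Type u} [∀ i, Field (k i)]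
  {G : UnipotentGroup} {J : Type}

/-- The matrices of the finitely many nonzero coefficients lift to families over the `k i`. The
relations that are not automatic are finitely many equations with integer constants, so they hold
almost everywhere. -/
theorem exists_family_coef (W : RepPow (UField U k) G J) {S : Finset (G.Expo J)}
    (hS : ∀ e ∉ S, FDComod.coef W e = 0) :
    ∃ (r : ℕ) (θ : UVec U k (fun i => Fin r → k i) ≃ₗ[UField U k] W)
      (c : G.Expo J → ∀ i, (Fin r → k i) →ₗ[k i] (Fin r → k i)),
      (∀ e ∉ S, ∀ i, c e i = 0) ∧ (∀ e v, θ (UVec.lmap U (c e) v) = FDComod.coef W e (θ v)) ∧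
      (∀ᶠ i in U, c 0 i = LinearMap.id) ∧
      ∀ᶠ i in U, ∀ e f, c e i ∘ₗ c f i = ∑ g ∈ S, (comulCoeff e f g : k i) • c g i := by
  classical
  let r := Module.finrank (UField U k) W
  let B := Module.finBasis (UField U k) W
  have hb : ∀ᶠ i in U, ∃ B : Module.Basis (Fin r) (k i) (Fin r → k i),
      ⇑B = fun j => Pi.single j 1 :=
    .of_forall fun i => ⟨Pi.basisFun _ _, by ext1 j; exact Pi.basisFun_apply _ _ j⟩
  let θ : UVec U k (fun i => Fin r → k i) ≃ₗ[UField U k] W :=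
    (UVec.basis _ hb).equiv B (Equiv.refl _)
  have hbd : UVec.Bounded U k fun i => Fin r → k i := ⟨r, .of_forall fun i => by simp⟩
  have hc : ∀ e, ∃ c : ∀ i, (Fin r → k i) →ₗ[k i] (Fin r → k i), (e ∉ S → ∀ i, c i = 0) ∧
      UVec.lmap U c = θ.symm.toLinearMap ∘ₗ FDComod.coef W e ∘ₗ θ.toLinearMap := by
    intro e
    by_cases he : e ∈ S
    · obtain ⟨c, hc⟩ := hbd.exists_lmap
        (θ.symm.toLinearMap ∘ₗ FDComod.coef W e ∘ₗ θ.toLinearMap)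
      exact ⟨c, fun h => absurd he h, hc⟩
    · exact ⟨fun i => 0, fun _ i => rfl, by
        rw [hS e he, UVec.lmap_zero, LinearMap.zero_comp, LinearMap.comp_zero]⟩
  choose c hc0 hc using hc
  refine ⟨r, θ, c, hc0, fun e v => ?_, ?_, ?_⟩
  · rw [hc]; simp
  · rw [← UVec.lmap_eq_lmap, hc, FDComod.coef_zero, UVec.lmap_id]
    ext v
    simp
  · obtain ⟨T, hT⟩ := finite_comulCoeff S
    have h1 : ∀ᶠ i in U, ∀ e ∈ T ∪ S, ∀ f ∈ T ∪ S,
        c e i ∘ₗ c f i = ∑ g ∈ S, (comulCoeff e f g : k i) • c g i := by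
      refine (Filter.eventually_all_finset _).2 fun e _ =>
        (Filter.eventually_all_finset _).2 fun f _ => ?_
      rw [← UVec.lmap_eq_lmap, ← UVec.lmap_comp, UVec.lmap_sum]
      simp only [UVec.lmap_smul, UField.mk_intCast, hc]
      ext v
      have := LinearMap.congr_fun (FDComod.coef_comp W hS e f) (θ v)
      simp only [LinearMap.comp_apply, LinearMap.sum_apply, LinearMap.smul_apply] at this
      simp [this]
    filter_upwards [h1] with i hi e f
    -- For the infinitely many other pairs both sides vanish: a factor on the left has exponent
    -- outside `S`, and the constants on the right are zero by the choice of `T`.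
    by_cases h : e ∈ T ∪ S ∧ f ∈ T ∪ S
    · exact hi e h.1 f h.2
    · have hl : c e i ∘ₗ c f i = 0 := by
        by_cases he : e ∈ S
        · rw [hc0 f (fun hf => h ⟨Finset.mem_union_right _ he, Finset.mem_union_right _ hf⟩) i,
            LinearMap.comp_zero]
        · rw [hc0 e he i, LinearMap.zero_comp]
      rw [hl, eq_comm]
      refine Finset.sum_eq_zero fun g hg => ?_
      by_cases h0 : comulCoeff e f g = 0
      · rw [h0, Int.cast_zero, zero_smul]
      · have := hT g hg e f h0
        exact absurd ⟨Finset.mem_union_left _ this.1, Finset.mem_union_left _ this.2⟩ h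

variable {ν : J → ℕ}

-- As `twist` is additive and injective on the exponents in play, decomposing `twist q ν g` into
-- twisted summands amounts to decomposing `g`: no carries occur.
open Classical in
theorem UnipotentGroup.sum_antidiagonal_twist {M : Type*} [AddCommMonoid M] (q : ℕ)
    {S S' : Finset (G.Expo J)} (F : G.Expo Unit × G.Expo Unit → M)
    (hF : ∀ x, F x ≠ 0 → ∃ e ∈ S, ∃ f ∈ S', twist q ν e = x.1 ∧ twist q ν f = x.2) (g : G.Expo J)
    (hinj : Set.InjOn (twist q ν : G.Expo J → G.Expo Unit)
      ((Finset.HasAntidiagonal.antidiagonal g).image Prod.fst ∪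
        (Finset.HasAntidiagonal.antidiagonal g).image Prod.snd : Finset (G.Expo J)))
    (hinj' : Set.InjOn (twist q ν : G.Expo J → G.Expo Unit)
      (insert g (Finset.image₂ (· + ·) S S') : Finset (G.Expo J)))
    {A : Finset (G.Expo Unit × G.Expo Unit)} (hA : ∀ x, x ∈ A ↔ x.1 + x.2 = twist q ν g) :
    ∑ x ∈ A, F x =
      ∑ a ∈ Finset.HasAntidiagonal.antidiagonal g, F (twist q ν a.1, twist q ν a.2) := by
  let T : G.Expo J × G.Expo J → G.Expo Unit × G.Expo Unit :=
    fun a => (twist q ν a.1, twist q ν a.2)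
  have hT : Set.InjOn T (Finset.HasAntidiagonal.antidiagonal g : Finset _) := by
    intro a ha b hb hab
    have h1 := congrArg Prod.fst hab
    have h2 := congrArg Prod.snd hab
    refine Prod.ext (hinj ?_ ?_ h1) (hinj ?_ ?_ h2)
    · exact Finset.mem_union_left _ (Finset.mem_image_of_mem _ ha)
    · exact Finset.mem_union_left _ (Finset.mem_image_of_mem _ hb)
    · exact Finset.mem_union_right _ (Finset.mem_image_of_mem _ ha)
    · exact Finset.mem_union_right _ (Finset.mem_image_of_mem _ hb)
  rw [← Finset.sum_image (f := F) hT]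
  symm
  refine Finset.sum_subset ?_ ?_
  · intro x hx
    obtain ⟨a, ha, rfl⟩ := Finset.mem_image.1 hx
    rw [hA, ← map_add, Finset.HasAntidiagonal.mem_antidiagonal.1 ha]
  · intro x hx hx'
    by_contra hne
    obtain ⟨e, he, f, hf, hex, hfx⟩ := hF x hne
    have hef : e + f = g := by
      refine hinj' (Finset.mem_insert_of_mem (Finset.mem_image₂_of_mem he hf))
        (Finset.mem_insert_self _ _) ?_
      rw [map_add, hex, hfx]
      exact (hA x).1 hx
    exact hx' (Finset.mem_image.2 ⟨(e, f), Finset.HasAntidiagonal.mem_antidiagonal.2 hef,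
      Prod.ext hex hfx⟩)

open Classical in
theorem FDComod.coef_tensor_twist {k : Type u} [Field k] (V W : RepOne k G) (q : ℕ)
    {S S' : Finset (G.Expo J)} (hS : ∀ m, FDComod.coef V m ≠ 0 → ∃ e ∈ S, twist q ν e = m)
    (hS' : ∀ m, FDComod.coef W m ≠ 0 → ∃ e ∈ S', twist q ν e = m) (g : G.Expo J)
    (hinj : Set.InjOn (twist q ν : G.Expo J → G.Expo Unit)
      ((Finset.HasAntidiagonal.antidiagonal g).image Prod.fst ∪
        (Finset.HasAntidiagonal.antidiagonal g).image Prod.snd : Finset (G.Expo J)))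
    (hinj' : Set.InjOn (twist q ν : G.Expo J → G.Expo Unit)
      (insert g (Finset.image₂ (· + ·) S S') : Finset (G.Expo J))) (v : V) (w : W) :
    FDComod.coef (tensor V W) (twist q ν g) (v ⊗ₜ[k] w) =
      ∑ a ∈ Finset.HasAntidiagonal.antidiagonal g,
        FDComod.coef V (twist q ν a.1) v ⊗ₜ[k] FDComod.coef W (twist q ν a.2) w := by
  have h1 := FDComod.coef_tensor V W (twist q ν g) v w
  have h2 := sum_antidiagonal_twist (M := V ⊗[k] W) (ν := ν) q (S := S) (S' := S')
    (fun x => FDComod.coef V x.1 v ⊗ₜ[k] FDComod.coef W x.2 w) (fun x hx => by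
      have h1 : FDComod.coef V x.1 ≠ 0 := by
        intro h; rw [h] at hx; simp at hx
      have h2 : FDComod.coef W x.2 ≠ 0 := by
        intro h; rw [h] at hx; simp at hx
      obtain ⟨e, he, hex⟩ := hS _ h1
      obtain ⟨f, hf, hfx⟩ := hS' _ h2
      exact ⟨e, he, f, hf, hex, hfx⟩) g hinj hinj'
      (fun x => Finset.HasAntidiagonal.mem_antidiagonal)
  exact h1.trans h2

variable [hU : LargeChar U k] [hν : Fact (Function.Injective ν)]

/-- The lifted matrices define a representation of `G^J` over almost every `k i`; its pullback along
Frobenius powers has exactly these matrices as coefficients at twisted exponents. -/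
instance : (toRep U k G ν).EssSurj where
  mem_essImage W := by
    classical
    obtain ⟨S, hS⟩ := exists_coef W
    obtain ⟨r, θ, c, hc, hθ, h0, hmul⟩ := exists_family_coef W hS
    -- The conditions valid only almost everywhere are premises inside the existential, so that an
    -- object can be chosen at every index; the trivial representation is the default.
    have hX : ∀ i, ∃ (X : RepOne (k i) G) (t : (Fin r → k i) →ₗ[k i] X),
        c 0 i = LinearMap.id →
        (∀ e f, c e i ∘ₗ c f i = ∑ g ∈ S, (comulCoeff e f g : k i) • c g i) →
        Set.InjOn (twist (ringChar (k i)) ν : G.Expo J → G.Expo Unit) S →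
        Function.Bijective t ∧
        (∀ e ∈ S, ∀ v, t (c e i v) = FDComod.coef X (twist (ringChar (k i)) ν e) (t v)) ∧
        ∀ m, FDComod.coef X m ≠ 0 → ∃ e ∈ S, twist (ringChar (k i)) ν e = m := by
      intro i
      by_cases h : c 0 i = LinearMap.id ∧
        ∀ e f, c e i ∘ₗ c f i = ∑ g ∈ S, (comulCoeff e f g : k i) • c g i
      · have := Fact.mk (LargeChar.prime (U := U) (k := k) i)
        let Y := ofCoef (Fin r → k i) (fun e => c e i) S (fun e he => hc e he i) h.1 h.2
        have hY : ∀ e, FDComod.coef Y e = c e i := fun e => coef_ofCoef _ _ _ _ _ _ e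
        have hYS : ∀ e ∉ S, FDComod.coef Y e = 0 := fun e he => (hY e).trans (hc e he i)
        refine ⟨frobPull (ringChar (k i)) ν Y, LinearMap.id (R := k i) (M := Fin r → k i),
          fun _ _ hinj => ⟨Function.bijective_id, fun e he v => ?_, fun m hm =>
            exists_of_coef_frobPull_ne_zero _ ν Y hYS hm⟩⟩
        rw [coef_frobPull_twist _ ν Y hYS hinj he, hY]
        rfl
      · exact ⟨triv _ _, 0, fun h1 h2 => absurd ⟨h1, h2⟩ h⟩
    choose X t ht using hX
    have hev := (h0.and hmul).and (eventually_injOn (U := U) (k := k) ν S)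
    let X' : (finiteType U k G ν).FullSubcategory := ⟨⟨⟨X⟩, r, by
      filter_upwards [hev] with i hi
      rw [← (LinearEquiv.ofBijective (t i) (ht i hi.1.1 hi.1.2 hi.2).1).finrank_eq]
      simp⟩, S, by
      filter_upwards [hev] with i hi
      exact (ht i hi.1.1 hi.1.2 hi.2).2.2⟩
    let τ : UVec U k (fun i => Fin r → k i) ≃ₗ[UField U k] X'.obj.carrier :=
      LinearEquiv.ofBijective (UVec.lmap U t) (UVec.lmap_bijective U t (by
        filter_upwards [hev] with i hi
        exact (ht i hi.1.1 hi.1.2 hi.2).1))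
    have hτ : ∀ e v, τ (UVec.lmap U (c e) v) = X'.obj.coef ν e (τ v) := by
      intro e
      by_cases he : e ∈ S
      · refine UVec.ind U fun v => (UVec.mk_eq_mk U).2 ?_
        filter_upwards [hev] with i hi
        exact (ht i hi.1.1 hi.1.2 hi.2).2.1 e he (v i)
      · intro v
        rw [RestrRep.coef_eq_zero (S := S) _ he]
        · have : UVec.lmap U (c e) = 0 := by
            rw [← UVec.lmap_zero]
            exact congrArg _ (funext fun i => hc e he i)
          rw [this]
          simp
        · filter_upwards [hev] with i hi
          exact (ht i hi.1.1 hi.1.2 hi.2).2.2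
    refine ⟨X', ⟨isoOfCoef (V := (toRep U k G ν).obj X') (W := W) (τ.symm.trans θ) ?_⟩⟩
    intro e v
    rw [coef_toRep]
    obtain ⟨v, rfl⟩ := τ.surjective v
    change θ (τ.symm (X'.obj.coef ν e (τ v))) = FDComod.coef W e (θ (τ.symm (τ v)))
    rw [← hτ, τ.symm_apply_apply, τ.symm_apply_apply, hθ]

instance : (toRep U k G ν).IsEquivalence where

open Classical in
theorem FDComod.exists_of_coef_tensor_ne_zero {k : Type u} [Field k] {G : UnipotentGroup} {J : Type}
    (V W : RepPow k G J) {m : G.Expo J} (h : FDComod.coef (tensor V W) m ≠ 0) :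
    ∃ a b, a + b = m ∧ FDComod.coef V a ≠ 0 ∧ FDComod.coef W b ≠ 0 := by
  by_contra hc
  refine h (TensorProduct.ext' fun v w => (coef_tensor V W m v w).trans ?_)
  refine Finset.sum_eq_zero fun x hx => ?_
  have hx := Finset.HasAntidiagonal.mem_antidiagonal.1 hx
  by_cases h1 : FDComod.coef V x.1 = 0
  · rw [h1, LinearMap.zero_apply, TensorProduct.zero_tmul]
    rfl
  · by_cases h2 : FDComod.coef W x.2 = 0
    · rw [h2, LinearMap.zero_apply, TensorProduct.tmul_zero]
      rfl
    · exact absurd ⟨x.1, x.2, hx, h1, h2⟩ hc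

instance : (finiteType U k G ν).IsMonoidal where
  prop_unit := by
    classical
    refine ⟨{0}, .of_forall fun i m hm => ⟨0, by simp, ?_⟩⟩
    by_contra h
    rw [map_zero] at h
    refine hm (LinearMap.ext fun (a : k i) => (coef_triv m a).trans ?_)
    rw [if_neg fun h' => h h'.symm]
    rfl
  prop_tensor X Y hX hY := by
    classical
    obtain ⟨S, hS⟩ := hX
    obtain ⟨S', hS'⟩ := hY
    -- Exponents of a tensor product are sums of exponents of the factors, and `twist` is additive.
    refine ⟨Finset.image₂ (· + ·) S S', ?_⟩
    filter_upwards [hS, hS'] with i hi hi' m hm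
    obtain ⟨a, b, rfl, ha, hb⟩ := FDComod.exists_of_coef_tensor_ne_zero _ _ hm
    obtain ⟨e, he, rfl⟩ := hi a ha
    obtain ⟨f, hf, rfl⟩ := hi' b hb
    exact ⟨e + f, Finset.mem_image₂_of_mem he hf, map_add _ _ _⟩

end
end
-- The symmetric monoidal structure on the functor.
noncomputable section

open UnipotentGroup UnipotentGroup.HopfAlg FDComod

section

variable {ι : Type} {U : Ultrafilter ι} {k : ι → Type u} [∀ i, Field (k i)]
  {G : UnipotentGroup}

/-- The ultraproduct of a tensor product. -/
def RestrRep.tensorEquiv (X Y : RestrRep U k G) :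
    X.carrier ⊗[UField U k] Y.carrier ≃ₗ[UField U k] (X ⊗ Y).carrier :=
  UVec.tensorEquiv (U := U) X.property Y.property

variable {J : Type} {ν : J → ℕ} [hU : LargeChar U k] [hν : Fact (Function.Injective ν)]

-- Componentwise this is `coef_tensor_twist`; its injectivity hypotheses concern finite sets fixed
-- in advance, so they hold almost everywhere.
open Classical in
theorem RestrRep.tensorEquiv_coef {X Y : RestrRep U k G} (hX : finiteType U k G ν X)
    (hY : finiteType U k G ν Y) (g : G.Expo J) (v : X.carrier) (w : Y.carrier) :
    RestrRep.tensorEquiv X Y (∑ a ∈ Finset.HasAntidiagonal.antidiagonal g,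
      X.coef ν a.1 v ⊗ₜ[UField U k] Y.coef ν a.2 w) =
    (X ⊗ Y).coef ν g (RestrRep.tensorEquiv X Y (v ⊗ₜ w)) := by
  obtain ⟨S, hS⟩ := hX
  obtain ⟨S', hS'⟩ := hY
  revert v; refine UVec.ind U fun v => ?_
  revert w; refine UVec.ind U fun w => ?_
  have h1 := UVec.mk_sum (k := k) (V := fun i => (X.obj.obj i : Type u) ⊗[k i] (Y.obj.obj i : Type u)) U
    (Finset.HasAntidiagonal.antidiagonal g) fun a i =>
    FDComod.coef (X.obj.obj i : RepOne (k i) G) (twist (ringChar (k i)) ν a.1) (v i) ⊗ₜ[k i]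
      FDComod.coef (Y.obj.obj i : RepOne (k i) G) (twist (ringChar (k i)) ν a.2) (w i)
  have h2 : ∀ᶠ i in U, (∑ a ∈ Finset.HasAntidiagonal.antidiagonal g,
      FDComod.coef (X.obj.obj i : RepOne (k i) G) (twist (ringChar (k i)) ν a.1) (v i) ⊗ₜ[k i]
      FDComod.coef (Y.obj.obj i : RepOne (k i) G) (twist (ringChar (k i)) ν a.2) (w i)) =
      FDComod.coef (tensor (X.obj.obj i) (Y.obj.obj i) : RepOne (k i) G)
        (twist (ringChar (k i)) ν g) (v i ⊗ₜ[k i] w i) := by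
    filter_upwards [hS, hS', eventually_injOn (U := U) (k := k) ν _,
      eventually_injOn (U := U) (k := k) ν _] with i hi hi' hinj hinj'
    exact (FDComod.coef_tensor_twist _ _ _ hi hi' g hinj hinj' (v i) (w i)).symm
  rw [map_sum]
  exact h1.symm.trans ((UVec.mk_eq_mk U).2 h2)

/-- The trivial representation involves only the exponent `0`, and eventually `twist` sends `e` to
`0` only if `e = 0`. -/
theorem unitEquiv_coef (e : G.Expo J) (a : UField U k) :
    UVec.unitEquiv U k (FDComod.coef (triv (UField U k) (G.HopfAlg J (UField U k))) e a) =
      (𝟙_ (RestrRep U k G)).coef ν e (UVec.unitEquiv U k a) := by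
  classical
  revert a
  refine UField.ind U fun a => ?_
  rw [coef_triv, UVec.unitEquiv_mk]
  have h : ∀ᶠ i in U, (if e = 0 then a i else 0) =
      FDComod.coef (triv (k i) (G.HopfAlg Unit (k i))) (twist (ringChar (k i)) ν e) (a i) := by
    filter_upwards [eventually_injOn (U := U) (k := k) ν {e, 0}] with i hinj
    rw [coef_triv]
    refine if_congr ?_ rfl rfl
    have := hinj.eq_iff (x := e) (y := 0) (by simp) (by simp)
    rw [map_zero] at this
    exact this.symm
  refine Eq.trans ?_ ((UVec.mk_eq_mk U).2 h)
  split_ifs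
  · exact UVec.unitEquiv_mk U a
  · exact map_zero _

variable (U k G ν) in
/-- The functor to representations of `G^J` is compatible with the units. -/
def toRepUnit : 𝟙_ (RepPow (UField U k) G J) ≅
    (toRep U k G ν).obj (𝟙_ (finiteType U k G ν).FullSubcategory) :=
  isoOfCoef (V := triv _ _) (W := (toRep U k G ν).obj (𝟙_ _)) (UVec.unitEquiv U k) (by
    intro e a
    rw [coef_toRep]
    exact unitEquiv_coef e a)

/-- The functor to representations of `G^J` is compatible with tensor products. -/
def toRepTensor (X Y : (finiteType U k G ν).FullSubcategory) :
    (toRep U k G ν).obj X ⊗ (toRep U k G ν).obj Y ≅ (toRep U k G ν).obj (X ⊗ Y) :=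
  isoOfCoef (V := tensor ((toRep U k G ν).obj X) ((toRep U k G ν).obj Y))
    (W := (toRep U k G ν).obj (X ⊗ Y)) (RestrRep.tensorEquiv X.obj Y.obj) (by
    classical
    intro e z
    rw [coef_toRep]
    refine LinearMap.congr_fun (f := (RestrRep.tensorEquiv X.obj Y.obj).toLinearMap ∘ₗ
      FDComod.coef (tensor ((toRep U k G ν).obj X) ((toRep U k G ν).obj Y)) e)
      (g := (X.obj ⊗ Y.obj).coef ν e ∘ₗ (RestrRep.tensorEquiv X.obj Y.obj).toLinearMap) ?_ z
    refine TensorProduct.ext' fun v w => ?_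
    refine Eq.trans ?_ (RestrRep.tensorEquiv_coef X.property Y.property e v w)
    refine congrArg (RestrRep.tensorEquiv X.obj Y.obj) ?_
    refine (FDComod.coef_tensor _ _ e v w).trans ?_
    simp only [coef_toRep]
    rfl)

/-- The functor to representations of `G^J` is monoidal. -/
def toRepCoreMonoidal : (toRep U k G ν).CoreMonoidal where
  εIso := toRepUnit U k G ν
  μIso := toRepTensor
  μIso_hom_natural_left {X Y} f X' := FDComod.hom_ext (by
    obtain ⟨f⟩ := f
    revert f; refine RestrRep.hom_ind fun f => ?_
    refine TensorProduct.ext' (UVec.ind U fun v => UVec.ind U fun w => ?_)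
    rfl)
  μIso_hom_natural_right {X Y} X' f := FDComod.hom_ext (by
    obtain ⟨f⟩ := f
    revert f; refine RestrRep.hom_ind fun f => ?_
    refine TensorProduct.ext' (UVec.ind U fun v => UVec.ind U fun w => ?_)
    rfl)
  associativity X Y Z := FDComod.hom_ext (by
    refine TensorProduct.ext_threefold (UVec.ind U fun v => UVec.ind U fun w => UVec.ind U fun x => ?_)
    rfl)
  left_unitality X := FDComod.hom_ext (by
    refine TensorProduct.ext' (UField.ind U fun a => UVec.ind U fun w => ?_)
    -- `unitEquiv` sends `a` to `a • 1`, hence the factor `1` to cancel.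
    exact congrArg (UVec.mk U k) (funext fun i => congrArg (· • w i) (mul_one (a i)).symm))
  right_unitality X := FDComod.hom_ext (by
    refine TensorProduct.ext' (UVec.ind U fun w => UField.ind U fun a => ?_)
    exact congrArg (UVec.mk U k) (funext fun i => congrArg (· • w i) (mul_one (a i)).symm))

instance : (toRep U k G ν).Monoidal := toRepCoreMonoidal.toMonoidal

instance : (toRep U k G ν).Braided where
  braided X Y := by
    refine FDComod.hom_ext (TensorProduct.ext' (UVec.ind U fun v => UVec.ind U fun w => ?_))
    rfl

end
end
-- Kernels and cokernels; representations of `G^J` form an abelian category.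
noncomputable section

namespace CategoryTheory.Limits

variable {C : Type*} [Category* C] [HasZeroMorphisms C] {D : Type*} [Category* D]
  [HasZeroMorphisms D]

/-- `i` is a kernel of `f`. -/
structure IsKer {K X Y : C} (i : K ⟶ X) (f : X ⟶ Y) : Prop where
  zero : i ≫ f = 0
  mono : Mono i
  fac : ∀ {T : C} (g : T ⟶ X), g ≫ f = 0 → ∃ l, l ≫ i = g

/-- `p` is a cokernel of `f`. -/
structure IsCoker {X Y Q : C} (f : X ⟶ Y) (p : Y ⟶ Q) : Prop where
  zero : f ≫ p = 0
  epi : Epi p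
  fac : ∀ {T : C} (g : Y ⟶ T), f ≫ g = 0 → ∃ l, p ≫ l = g

/-- The kernel fork of a kernel is a limit. -/
def IsKer.isLimit {K X Y : C} {i : K ⟶ X} {f : X ⟶ Y} (h : IsKer i f) :
    IsLimit (KernelFork.ofι i h.zero) :=
  haveI := h.mono
  KernelFork.IsLimit.ofι' i h.zero fun g hg => ⟨(h.fac g hg).choose, (h.fac g hg).choose_spec⟩

/-- The cokernel cofork of a cokernel is a colimit. -/
def IsCoker.isColimit {X Y Q : C} {f : X ⟶ Y} {p : Y ⟶ Q} (h : IsCoker f p) :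
    IsColimit (CokernelCofork.ofπ p h.zero) :=
  haveI := h.epi
  CokernelCofork.IsColimit.ofπ' p h.zero
    fun g hg => ⟨(h.fac g hg).choose, (h.fac g hg).choose_spec⟩

theorem IsKer.hasKernel {K X Y : C} {i : K ⟶ X} {f : X ⟶ Y} (h : IsKer i f) : HasKernel f :=
  ⟨⟨⟨_, h.isLimit⟩⟩⟩

theorem IsCoker.hasCokernel {X Y Q : C} {f : X ⟶ Y} {p : Y ⟶ Q} (h : IsCoker f p) :
    HasCokernel f :=
  ⟨⟨⟨_, h.isColimit⟩⟩⟩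

theorem IsKer.preservesLimit (F : C ⥤ D) [F.PreservesZeroMorphisms] {K X Y : C} {i : K ⟶ X}
    {f : X ⟶ Y} (h : IsKer i f) (h' : IsKer (F.map i) (F.map f)) :
    PreservesLimit (parallelPair f 0) F :=
  preservesLimit_of_preserves_limit_cone h.isLimit
    ((KernelFork.isLimitMapConeEquiv (KernelFork.ofι i h.zero) F).symm h'.isLimit)

theorem IsCoker.preservesColimit (F : C ⥤ D) [F.PreservesZeroMorphisms] {X Y Q : C} {f : X ⟶ Y}
    {p : Y ⟶ Q} (h : IsCoker f p) (h' : IsCoker (F.map f) (F.map p)) :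
    PreservesColimit (parallelPair f 0) F :=
  preservesColimit_of_preserves_colimit_cocone h.isColimit
    ((CokernelCofork.isColimitMapCoconeEquiv (CokernelCofork.ofπ p h.zero) F).symm h'.isColimit)

theorem IsKer.of_map (F : C ⥤ D) [F.PreservesZeroMorphisms] [F.Full] [F.Faithful] {K X Y : C}
    {i : K ⟶ X} {f : X ⟶ Y} (h : IsKer (F.map i) (F.map f)) : IsKer i f where
  zero := F.map_injective (by rw [F.map_comp, h.zero, F.map_zero])
  mono := haveI := h.mono; F.mono_of_mono_map inferInstance
  fac g hg := by
    obtain ⟨l, hl⟩ := h.fac (F.map g) (by rw [← F.map_comp, hg, F.map_zero])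
    exact ⟨F.preimage l, F.map_injective (by simp [hl])⟩

theorem IsCoker.of_map (F : C ⥤ D) [F.PreservesZeroMorphisms] [F.Full] [F.Faithful] {X Y Q : C}
    {f : X ⟶ Y} {p : Y ⟶ Q} (h : IsCoker (F.map f) (F.map p)) : IsCoker f p where
  zero := F.map_injective (by rw [F.map_comp, h.zero, F.map_zero])
  epi := haveI := h.epi; F.epi_of_epi_map inferInstance
  fac g hg := by
    obtain ⟨l, hl⟩ := h.fac (F.map g) (by rw [← F.map_comp, hg, F.map_zero])
    exact ⟨F.preimage l, F.map_injective (by simp [hl])⟩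

end CategoryTheory.Limits

namespace FDComod

open UnipotentGroup UnipotentGroup.HopfAlg

variable {k : Type u} [Field k] {G : UnipotentGroup} {J : Type}

section

variable {K X Y Q : RepPow k G J}

/-- The linear factorisation automatically commutes with the coefficients, since this may be tested
after the injective map `i`. -/
theorem isKer_of_exact {i : K ⟶ X} {f : X ⟶ Y} (hi : Function.Injective i.lin)
    (h : Function.Exact i.lin f.lin) : IsKer i f where
  zero := FDComod.hom_ext h.linearMap_comp_eq_zero
  mono := ⟨fun g g' hg => FDComod.hom_ext (LinearMap.ext fun v => hi
    (LinearMap.congr_fun (congrArg FDComod.Hom.lin hg) v))⟩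
  fac {T} g hg := by
    have hr : ∀ v, g.lin v ∈ LinearMap.range i.lin := fun v =>
      (h (g.lin v)).1 (LinearMap.congr_fun (congrArg FDComod.Hom.lin hg) v)
    let l : T →ₗ[k] K := (LinearEquiv.ofInjective i.lin hi).symm.toLinearMap ∘ₗ
      g.lin.codRestrict _ hr
    have hl : ∀ v, i.lin (l v) = g.lin v := fun v =>
      congrArg Subtype.val ((LinearEquiv.ofInjective i.lin hi).apply_symm_apply ⟨g.lin v, hr v⟩)
    refine ⟨homOfCoef l fun e v => hi ?_, FDComod.hom_ext (LinearMap.ext hl)⟩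
    rw [hl, coef_comm, coef_comm, hl]

theorem isCoker_of_exact {f : X ⟶ Y} {p : Y ⟶ Q} (hp : Function.Surjective p.lin)
    (h : Function.Exact f.lin p.lin) : IsCoker f p where
  zero := FDComod.hom_ext h.linearMap_comp_eq_zero
  epi := ⟨fun g g' hg => FDComod.hom_ext (LinearMap.ext fun v => by
    obtain ⟨v, rfl⟩ := hp v
    exact LinearMap.congr_fun (congrArg FDComod.Hom.lin hg) v)⟩
  fac {T} g hg := by
    have hk : LinearMap.ker p.lin ≤ LinearMap.ker g.lin := by
      intro v hv
      obtain ⟨x, rfl⟩ := (h v).1 hv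
      exact LinearMap.congr_fun (congrArg FDComod.Hom.lin hg) x
    let l : Q →ₗ[k] T := (LinearMap.ker p.lin).liftQ g.lin hk ∘ₗ
      (p.lin.quotKerEquivOfSurjective hp).symm.toLinearMap
    have hl : ∀ v, l (p.lin v) = g.lin v := fun v => by
      have : (p.lin.quotKerEquivOfSurjective hp).symm (p.lin v) = (LinearMap.ker p.lin).mkQ v :=
        (LinearEquiv.symm_apply_eq _).2 rfl
      exact (congrArg ((LinearMap.ker p.lin).liftQ g.lin hk) this).trans
        (Submodule.liftQ_apply _ _ _)
    refine ⟨homOfCoef l fun e v => ?_, FDComod.hom_ext (LinearMap.ext hl)⟩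
    obtain ⟨v, rfl⟩ := hp v
    rw [← coef_comm, hl, hl, coef_comm]

/-- The subcomodule on a subspace stable under the coefficients. -/
def sub (X : RepPow k G J) (N : Submodule k X) (hN : ∀ e, ∀ v ∈ N, coef X e v ∈ N) :
    RepPow k G J :=
  ofCoef N (fun e => (coef X e).restrict (hN e)) (exists_coef X).choose
    (fun e he => LinearMap.ext fun v => Subtype.ext
      (LinearMap.congr_fun ((exists_coef X).choose_spec e he) v.1))
    (LinearMap.ext fun v => Subtype.ext (LinearMap.congr_fun (coef_zero X) v.1))
    (fun e f => LinearMap.ext fun v => Subtype.ext (by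
      have := LinearMap.congr_fun (coef_comp X (exists_coef X).choose_spec e f) v.1
      simpa [LinearMap.sum_apply] using this))

/-- The inclusion of a subcomodule. -/
def subι (X : RepPow k G J) (N : Submodule k X) (hN : ∀ e, ∀ v ∈ N, coef X e v ∈ N) :
    X.sub N hN ⟶ X :=
  homOfCoef (V := X.sub N hN) N.subtype fun e v => by
    unfold sub
    rw [coef_ofCoef]
    rfl

/-- The quotient by a subspace stable under the coefficients. -/
def quot (X : RepPow k G J) (N : Submodule k X) (hN : ∀ e, ∀ v ∈ N, coef X e v ∈ N) :
    RepPow k G J :=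
  ofCoef (X ⧸ N) (fun e => N.mapQ N (coef X e) (hN e)) (exists_coef X).choose
    (fun e he => N.linearMap_qext (LinearMap.ext fun v => congrArg N.mkQ
      (LinearMap.congr_fun ((exists_coef X).choose_spec e he) v)))
    (N.linearMap_qext (LinearMap.ext fun v => congrArg N.mkQ
      (LinearMap.congr_fun (coef_zero X) v)))
    (fun e f => N.linearMap_qext (LinearMap.ext fun v => by
      have := congrArg N.mkQ
        (LinearMap.congr_fun (coef_comp X (exists_coef X).choose_spec e f) v)
      simpa [LinearMap.sum_apply] using this))

/-- The projection to a quotient comodule. -/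
def quotπ (X : RepPow k G J) (N : Submodule k X) (hN : ∀ e, ∀ v ∈ N, coef X e v ∈ N) :
    X ⟶ X.quot N hN :=
  homOfCoef (W := X.quot N hN) N.mkQ fun e v => by
    unfold quot
    rw [coef_ofCoef]
    rfl

theorem coef_mem_ker (f : X ⟶ Y) (e : G.Expo J) (v : X) (hv : v ∈ LinearMap.ker f.lin) :
    coef X e v ∈ LinearMap.ker f.lin := by
  rw [LinearMap.mem_ker] at hv ⊢
  rw [coef_comm, hv, map_zero]

theorem coef_mem_range (f : X ⟶ Y) (e : G.Expo J) (v : Y) (hv : v ∈ LinearMap.range f.lin) :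
    coef Y e v ∈ LinearMap.range f.lin := by
  obtain ⟨x, rfl⟩ := hv
  exact ⟨coef X e x, coef_comm f e x⟩

theorem exact_subι (f : X ⟶ Y) :
    Function.Exact (X.subι (LinearMap.ker f.lin) (coef_mem_ker f)).lin f.lin :=
  LinearMap.exact_subtype_ker_map f.lin

theorem subι_injective (N : Submodule k X) (hN : ∀ e, ∀ v ∈ N, coef X e v ∈ N) :
    Function.Injective (X.subι N hN).lin := Subtype.val_injective

theorem exact_quotπ (f : X ⟶ Y) :
    Function.Exact f.lin (Y.quotπ (LinearMap.range f.lin) (coef_mem_range f)).lin :=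
  LinearMap.exact_map_mkQ_range f.lin

theorem quotπ_surjective (N : Submodule k X) (hN : ∀ e, ∀ v ∈ N, coef X e v ∈ N) :
    Function.Surjective (X.quotπ N hN).lin := N.mkQ_surjective

theorem isKer_subι (f : X ⟶ Y) : IsKer (X.subι (LinearMap.ker f.lin) (coef_mem_ker f)) f :=
  isKer_of_exact (subι_injective _ _) (exact_subι f)

theorem isCoker_quotπ (f : X ⟶ Y) :
    IsCoker f (Y.quotπ (LinearMap.range f.lin) (coef_mem_range f)) :=
  isCoker_of_exact (quotπ_surjective _ _) (exact_quotπ f)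

/-- The linear kernel is a subcomodule, and cancelling `f` shows that its inclusion is zero. -/
theorem lin_injective_of_mono (f : X ⟶ Y) [Mono f] : Function.Injective f.lin := by
  rw [← LinearMap.ker_eq_bot, LinearMap.ker_eq_bot']
  intro v hv
  have h : X.subι (LinearMap.ker f.lin) (coef_mem_ker f) = 0 := by
    rw [← cancel_mono f, (isKer_subι f).zero, zero_comp]
  exact LinearMap.congr_fun (congrArg FDComod.Hom.lin h) ⟨v, hv⟩

theorem lin_surjective_of_epi (f : X ⟶ Y) [Epi f] : Function.Surjective f.lin := by
  intro v
  have h : Y.quotπ (LinearMap.range f.lin) (coef_mem_range f) = 0 := by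
    rw [← cancel_epi f, (isCoker_quotπ f).zero, comp_zero]
  exact (Submodule.Quotient.mk_eq_zero (LinearMap.range f.lin)).1
    (LinearMap.congr_fun (congrArg FDComod.Hom.lin h) v)

end

instance : HasKernels (RepPow k G J) := ⟨fun f => (isKer_subι f).hasKernel⟩

instance : HasCokernels (RepPow k G J) := ⟨fun f => (isCoker_quotπ f).hasCokernel⟩

instance : IsNormalMonoCategory (RepPow k G J) where
  normalMonoOfMono {_ Y} f _ := ⟨{
    Z := Y.quot (LinearMap.range f.lin) (coef_mem_range f)
    g := Y.quotπ _ _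
    w := (isCoker_quotπ f).zero
    isLimit := (isKer_of_exact (lin_injective_of_mono f) (exact_quotπ f)).isLimit }⟩

instance : IsNormalEpiCategory (RepPow k G J) where
  normalEpiOfEpi {X _} f _ := ⟨{
    W := X.sub (LinearMap.ker f.lin) (coef_mem_ker f)
    g := X.subι _ _
    w := (isKer_subι f).zero
    isColimit := (isCoker_of_exact (lin_surjective_of_epi f) (exact_subι f)).isColimit }⟩

instance : HasZeroObject (RepPow k G J) := by
  let Z : RepPow k G J := ofCoef PUnit (fun _ => LinearMap.id) ∅
    (fun _ _ => LinearMap.ext fun _ => rfl) rfl (fun _ _ => LinearMap.ext fun _ => rfl)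
  have h : 𝟙 Z = 0 := FDComod.hom_ext (LinearMap.ext fun _ => rfl)
  exact ⟨Z, (IsZero.iff_id_eq_zero Z).2 h⟩

open Classical in
/-- The direct sum of two representations. -/
def prod (X Y : RepPow k G J) : RepPow k G J :=
  ofCoef (X × Y) (fun e => (coef X e).prodMap (coef Y e))
    ((exists_coef X).choose ∪ (exists_coef Y).choose)
    (fun e he => by
      rw [(exists_coef X).choose_spec e fun h => he (Finset.mem_union_left _ h),
        (exists_coef Y).choose_spec e fun h => he (Finset.mem_union_right _ h)]
      rfl)
    (by rw [coef_zero, coef_zero]; rfl)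
    (fun e f => by
      have h1 : ∀ e ∉ (exists_coef X).choose ∪ (exists_coef Y).choose, coef X e = 0 :=
        fun e he => (exists_coef X).choose_spec e fun h => he (Finset.mem_union_left _ h)
      have h2 : ∀ e ∉ (exists_coef X).choose ∪ (exists_coef Y).choose, coef Y e = 0 :=
        fun e he => (exists_coef Y).choose_spec e fun h => he (Finset.mem_union_right _ h)
      rw [LinearMap.prodMap_comp, coef_comp X h1, coef_comp Y h2]
      refine LinearMap.ext fun v => Prod.ext ?_ ?_
      · simp [LinearMap.sum_apply, Prod.fst_sum]
      · simp [LinearMap.sum_apply, Prod.snd_sum])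

theorem coef_prod (X Y : RepPow k G J) (e : G.Expo J) :
    coef (X.prod Y) e = (coef X e).prodMap (coef Y e) := by
  unfold prod
  apply coef_ofCoef

instance : HasBinaryBiproducts (RepPow k G J) where
  has_binary_biproduct X Y := hasBinaryBiproduct_of_total
    { pt := X.prod Y
      fst := homOfCoef (V := X.prod Y) (LinearMap.fst k X Y) fun e v => by rw [coef_prod]; rfl
      snd := homOfCoef (V := X.prod Y) (LinearMap.snd k X Y) fun e v => by rw [coef_prod]; rfl
      inl := homOfCoef (W := X.prod Y) (LinearMap.inl k X Y) fun e v => by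
        rw [coef_prod]; exact Prod.ext rfl (map_zero (coef Y e)).symm
      inr := homOfCoef (W := X.prod Y) (LinearMap.inr k X Y) fun e v => by
        rw [coef_prod]; exact Prod.ext (map_zero (coef X e)).symm rfl
      inl_fst := FDComod.hom_ext (LinearMap.ext fun _ => rfl)
      inl_snd := FDComod.hom_ext (LinearMap.ext fun _ => rfl)
      inr_fst := FDComod.hom_ext (LinearMap.ext fun _ => rfl)
      inr_snd := FDComod.hom_ext (LinearMap.ext fun _ => rfl) }
    (FDComod.hom_ext (LinearMap.ext fun v => Prod.ext (add_zero v.1) (zero_add v.2)))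

instance : HasFiniteProducts (RepPow k G J) :=
  hasFiniteProducts_of_has_binary_and_terminal

instance : Abelian (RepPow k G J) where

end FDComod
end
-- Dual comodules, rigidity and the forgetful fibre functor.
noncomputable section

namespace FDComod

open Module

section Matrix

variable {k : Type u} [Field k] {A : Type u} [CommRing A] [Bialgebra k A] {ι : Type*} [Fintype ι]

/-- The entry of the matrix formula of a comodule in a basis. -/
def entry (V : FDComod k A) (b : Basis ι k V) (r s : ι) : A :=
  TensorProduct.lid k A ((b.coord r).rTensor A (V.coact (b s)))

theorem sum_basis_tmul {V : Type*} [AddCommGroup V] [Module k V] (b : Basis ι k V) {B : Type*}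
    [AddCommGroup B] [Module k B] (x : V ⊗[k] B) :
    ∑ r, b r ⊗ₜ[k] TensorProduct.lid k B ((b.coord r).rTensor B x) = x := by
  induction x with
  | zero => simp
  | add x y hx hy => simp only [map_add, TensorProduct.tmul_add, Finset.sum_add_distrib, hx, hy]
  | tmul v a =>
    simp only [LinearMap.rTensor_tmul, TensorProduct.lid_tmul, ← TensorProduct.smul_tmul,
      ← TensorProduct.sum_tmul, Basis.coord_apply, b.sum_repr]

theorem coact_basis (V : FDComod k A) (b : Basis ι k V) (s : ι) :
    V.coact (b s) = ∑ r, b r ⊗ₜ[k] V.entry b r s :=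
  (sum_basis_tmul b _).symm

theorem lid_coord_sum {V : Type*} [AddCommGroup V] [Module k V] [DecidableEq ι]
    (b : Basis ι k V) {B : Type*} [AddCommGroup B] [Module k B] (x : ι → B) (r : ι) :
    TensorProduct.lid k B ((b.coord r).rTensor B (∑ t, b t ⊗ₜ[k] x t)) = x r := by
  simp [Finsupp.single_apply]

theorem comul_entry (V : FDComod k A) (b : Basis ι k V) (r s : ι) :
    Coalgebra.comul (R := k) (V.entry b r s) = ∑ t, V.entry b r t ⊗ₜ[k] V.entry b t s := by
  classical
  have h := V.coassoc_apply (b s)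
  rw [coact_basis] at h
  simp only [map_sum, LinearMap.rTensor_tmul, LinearMap.lTensor_tmul, coact_basis,
    TensorProduct.sum_tmul, TensorProduct.assoc_tmul] at h
  rw [Finset.sum_comm] at h
  simp only [← TensorProduct.tmul_sum] at h
  have := congrArg (fun x => TensorProduct.lid k _ ((b.coord r).rTensor _ x)) h
  simp only [lid_coord_sum] at this
  exact this.symm

theorem counit_entry [DecidableEq ι] (V : FDComod k A) (b : Basis ι k V) (r s : ι) :
    Coalgebra.counit (R := k) (V.entry b r s) = if r = s then 1 else 0 := by
  have h := V.counit_apply (b s)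
  rw [coact_basis] at h
  simp only [map_sum, LinearMap.lTensor_tmul, TensorProduct.rid_tmul] at h
  have := congrArg (b.coord r) h
  simpa [Finsupp.single_apply, eq_comm] using this

/-- The comodule with a given matrix formula. -/
def ofMatrix (V : Type u) [AddCommGroup V] [Module k V] [Module.Finite k V] [DecidableEq ι]
    (b : Basis ι k V) (a : ι → ι → A)
    (ha : ∀ r s, Coalgebra.comul (R := k) (a r s) = ∑ t, a r t ⊗ₜ[k] a t s)
    (ha' : ∀ r s, Coalgebra.counit (R := k) (a r s) = if r = s then 1 else 0) : FDComod k A where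
  carrier := V
  coact := b.constr k fun s => ∑ r, b r ⊗ₜ[k] a r s
  coassoc := b.ext fun s => by
    simp only [LinearMap.comp_apply, Basis.constr_basis, map_sum, LinearMap.rTensor_tmul,
      LinearMap.lTensor_tmul, TensorProduct.sum_tmul, LinearEquiv.coe_coe,
      TensorProduct.assoc_tmul, ha, TensorProduct.tmul_sum]
    exact Finset.sum_comm
  counit_coact := b.ext fun s => by
    simp [ha']

end Matrix

section Dual

variable {k : Type u} [Field k] {A : Type u} [CommRing A] [HopfAlgebra k A]

open HopfAlgebra

theorem sum_antipode_mul_entry {ι : Type*} [Fintype ι] [DecidableEq ι] (V : FDComod k A)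
    (b : Basis ι k V) (r s : ι) :
    ∑ t, antipode k (V.entry b r t) * V.entry b t s = if r = s then 1 else 0 := by
  have h := mul_antipode_rTensor_comul_apply (R := k) (V.entry b r s)
  rw [comul_entry, counit_entry] at h
  simpa using h

theorem sum_mul_antipode_entry {ι : Type*} [Fintype ι] [DecidableEq ι] (V : FDComod k A)
    (b : Basis ι k V) (r s : ι) :
    ∑ t, V.entry b r t * antipode k (V.entry b t s) = if r = s then 1 else 0 := by
  have h := mul_antipode_lTensor_comul_apply (R := k) (V.entry b r s)
  rw [comul_entry, counit_entry] at h
  simpa using h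

/-- Uniqueness of inverses in a matrix ring: with `a' = S(a)`, the matrix `Δ(a')` is a left inverse
of `Δ(a) = (a ⊗ 1)(1 ⊗ a)`, while `(1 ⊗ a')(a' ⊗ 1)` is a right inverse. -/
theorem comul_antipode_entry {ι : Type*} [Fintype ι] (V : FDComod k A)
    (b : Basis ι k V) (r s : ι) :
    Coalgebra.comul (R := k) (antipode k (V.entry b r s)) =
      ∑ t, antipode k (V.entry b t s) ⊗ₜ[k] antipode k (V.entry b r t) := by
  classical
  let a : Matrix ι ι A := Matrix.of fun r s => V.entry b r s
  let a' : Matrix ι ι A := Matrix.of fun r s => antipode k (V.entry b r s)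
  have h1 : a' * a = 1 := by
    ext r s
    rw [Matrix.mul_apply, Matrix.one_apply]
    exact sum_antipode_mul_entry V b r s
  have h2 : a * a' = 1 := by
    ext r s
    rw [Matrix.mul_apply, Matrix.one_apply]
    exact sum_mul_antipode_entry V b r s
  let Δ : A →+* A ⊗[k] A := (Bialgebra.comulAlgHom k A : A →+* A ⊗[k] A)
  let i₁ : A →+* A ⊗[k] A :=
    ((Algebra.TensorProduct.includeLeft : A →ₐ[k] A ⊗[k] A) : A →+* A ⊗[k] A)
  let i₂ : A →+* A ⊗[k] A :=
    ((Algebra.TensorProduct.includeRight : A →ₐ[k] A ⊗[k] A) : A →+* A ⊗[k] A)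
  have hΔ : Δ.mapMatrix a = i₁.mapMatrix a * i₂.mapMatrix a := by
    ext r s
    rw [Matrix.mul_apply]
    refine (comul_entry V b r s).trans (Finset.sum_congr rfl fun t _ => ?_)
    change _ = (V.entry b r t ⊗ₜ[k] (1 : A)) * ((1 : A) ⊗ₜ[k] V.entry b t s)
    rw [Algebra.TensorProduct.tmul_mul_tmul, one_mul, mul_one]
  have e : Δ.mapMatrix a' = i₂.mapMatrix a' * i₁.mapMatrix a' := by
    refine left_inv_eq_right_inv (a := Δ.mapMatrix a) (by rw [← map_mul, h1, map_one]) ?_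
    rw [hΔ, mul_assoc, ← mul_assoc (i₂.mapMatrix a), ← map_mul, h2, map_one, one_mul, ← map_mul,
      h2, map_one]
  have := congrFun (congrFun e r) s
  rw [Matrix.mul_apply] at this
  refine this.trans (Finset.sum_congr rfl fun t _ => ?_)
  change ((1 : A) ⊗ₜ[k] antipode k (V.entry b r t)) * (antipode k (V.entry b t s) ⊗ₜ[k] (1 : A)) = _
  rw [Algebra.TensorProduct.tmul_mul_tmul, one_mul, mul_one]

open Classical in
/-- The dual comodule. -/
def dual (V : FDComod k A) : FDComod k A :=
  ofMatrix (Dual k V) (Basis.ofVectorSpace k V).dualBasis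
    (fun r s => antipode k (V.entry (Basis.ofVectorSpace k V) s r))
    (fun r s => comul_antipode_entry V _ s r)
    (fun r s => by rw [counit_antipode, counit_entry]; exact if_congr eq_comm rfl rfl)

theorem dual_coact (V : FDComod k A) (s) :
    (V.dual.coact ((Basis.ofVectorSpace k V).coord s) : Dual k V ⊗[k] A) =
      ∑ r, (Basis.ofVectorSpace k V).coord r ⊗ₜ[k]
        antipode k (V.entry (Basis.ofVectorSpace k V) s r) := by
  classical
  have h := (Basis.ofVectorSpace k V).dualBasis.constr_basis k (fun s =>
    ∑ r, (Basis.ofVectorSpace k V).dualBasis r ⊗ₜ[k]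
      antipode k (V.entry (Basis.ofVectorSpace k V) s r)) s
  refine (congrArg V.dual.coact (congrFun (Basis.coe_dualBasis _) s).symm).trans (h.trans ?_)
  rw [Basis.coe_dualBasis]

/-- The evaluation of a comodule. -/
def evaluation (V : FDComod k A) : tensor V.dual V ⟶ triv k A where
  lin := contractLeft k V
  comm := by
    classical
    refine TensorProduct.ext ((Basis.ofVectorSpace k V).dualBasis.ext fun r =>
      (Basis.ofVectorSpace k V).ext fun s => ?_)
    rw [Basis.coe_dualBasis]
    have h := sum_antipode_mul_entry V (Basis.ofVectorSpace k V) r s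
    generalize hb : Basis.ofVectorSpace k V = b at *
    -- Contraction turns the two coactions into the matrix product `S(a) * a = 1`.
    have h1 : (contractLeft k V (b.coord r ⊗ₜ b s)) ⊗ₜ[k] (1 : A) = (contractLeft k V).rTensor A
        (mulMap k A (Dual k V) V ((∑ t, b.coord t ⊗ₜ[k] antipode k (V.entry b r t)) ⊗ₜ
          ∑ t, b t ⊗ₜ[k] V.entry b t s)) := by
      simp only [TensorProduct.sum_tmul, TensorProduct.tmul_sum, map_sum, mulMap_tmul]
      simp only [LinearMap.rTensor_tmul, contractLeft_apply, Basis.coord_apply, Basis.repr_self,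
        Finsupp.single_apply, TensorProduct.ite_tmul, Finset.sum_ite_eq,
        Finset.mem_univ, if_true, ← TensorProduct.tmul_sum, h]
      simp [eq_comm, TensorProduct.tmul_ite]
    refine h1.trans ?_
    subst hb
    rw [← coact_basis, ← dual_coact]
    rfl

theorem tensorCoact_dual (V : FDComod k A) (i) :
    (tensorCoact V V.dual (Basis.ofVectorSpace k V i ⊗ₜ[k] (Basis.ofVectorSpace k V).coord i) :
      (V ⊗[k] Dual k V) ⊗[k] A) =
    ∑ r, ∑ t, (Basis.ofVectorSpace k V r ⊗ₜ[k] (Basis.ofVectorSpace k V).coord t) ⊗ₜ[k]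
      (V.entry (Basis.ofVectorSpace k V) r i *
        antipode k (V.entry (Basis.ofVectorSpace k V) i t)) := by
  refine (congrArg₂ (fun x y => mulMap k A V (Dual k V) (x ⊗ₜ y)) (coact_basis V _ i)
    (dual_coact V i)).trans ?_
  simp only [TensorProduct.sum_tmul, TensorProduct.tmul_sum, map_sum, mulMap_tmul]
  exact Finset.sum_comm

theorem sum_entry_mul_antipode (V : FDComod k A) {ι : Type*} [Fintype ι] (b : Basis ι k V) :
    ∑ i, ∑ r, ∑ t, (b r ⊗ₜ[k] b.coord t) ⊗ₜ[k] (V.entry b r i * antipode k (V.entry b i t)) =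
      (∑ i, b i ⊗ₜ[k] b.coord i) ⊗ₜ[k] (1 : A) := by
  classical
  rw [Finset.sum_comm, TensorProduct.sum_tmul]
  refine Finset.sum_congr rfl fun r _ => ?_
  rw [Finset.sum_comm]
  simp only [← TensorProduct.tmul_sum, sum_mul_antipode_entry, TensorProduct.tmul_ite,
    Finset.sum_ite_eq, Finset.mem_univ, if_true]

/-- The coevaluation of a comodule. -/
def coevaluation (V : FDComod k A) : triv k A ⟶ tensor V V.dual where
  lin := _root_.coevaluation k V
  comm := by
    refine LinearMap.ext_ring ?_
    change tensorCoact V V.dual (_root_.coevaluation k V 1) =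
      (_root_.coevaluation k V 1) ⊗ₜ[k] (1 : A)
    rw [coevaluation_apply_one]
    refine (map_sum (tensorCoact V V.dual) _ _).trans ?_
    exact (Finset.sum_congr rfl fun i _ => tensorCoact_dual V i).trans
      (sum_entry_mul_antipode V _)

instance (V : FDComod k A) : HasRightDual V where
  rightDual := V.dual
  exact :=
    { coevaluation' := coevaluation V
      evaluation' := evaluation V
      coevaluation_evaluation' := FDComod.hom_ext (contractLeft_assoc_coevaluation k V)
      evaluation_coevaluation' := FDComod.hom_ext (contractLeft_assoc_coevaluation' k V) }

instance : RightRigidCategory (FDComod k A) where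

instance : RigidCategory (FDComod k A) := BraidedCategory.rigidCategoryOfRightRigidCategory

end Dual

section Forget

variable (k : Type u) [Field k] (A : Type u) [CommRing A] [Bialgebra k A]

/-- The forgetful functor to finite-dimensional vector spaces. -/
def forgetFG : FDComod k A ⥤ FGModuleCat.{u} k where
  obj V := FGModuleCat.of k V
  map f := FGModuleCat.ofHom f.lin

instance : (forgetFG k A).Faithful where
  map_injective h := FDComod.hom_ext (congrArg (fun f => f.hom.hom) h)

instance : (forgetFG k A).Additive where

instance : (forgetFG k A).Linear k where

/-- The forgetful functor is monoidal. -/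
def forgetFGCoreMonoidal : (forgetFG k A).CoreMonoidal where
  εIso := Iso.refl (FGModuleCat.of k k)
  μIso V W := Iso.refl (FGModuleCat.of k (V ⊗[k] W))
  μIso_hom_natural_left _ _ := FGModuleCat.hom_ext (TensorProduct.ext' fun _ _ => rfl)
  μIso_hom_natural_right _ _ := FGModuleCat.hom_ext (TensorProduct.ext' fun _ _ => rfl)
  associativity _ _ _ := FGModuleCat.hom_ext (TensorProduct.ext_threefold fun _ _ _ => rfl)
  left_unitality _ := FGModuleCat.hom_ext (TensorProduct.ext' fun _ _ => rfl)
  right_unitality _ := FGModuleCat.hom_ext (TensorProduct.ext' fun _ _ => rfl)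

instance : (forgetFG k A).Monoidal := (forgetFGCoreMonoidal k A).toMonoidal

instance : (forgetFG k A).Braided where
  braided _ _ := FGModuleCat.hom_ext (TensorProduct.ext' fun _ _ => rfl)

end Forget

end FDComod

section FGModuleCat

variable {k : Type u} [Field k]

theorem FGModuleCat.isKer_of_exact {K X Y : FGModuleCat.{u} k} {i : K ⟶ X} {f : X ⟶ Y}
    (hi : Function.Injective i.hom.hom) (h : Function.Exact i.hom.hom f.hom.hom) : IsKer i f where
  zero := FGModuleCat.hom_ext h.linearMap_comp_eq_zero
  mono := ⟨fun g g' hg => FGModuleCat.hom_ext (LinearMap.ext fun v => hi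
    (LinearMap.congr_fun (congrArg (fun f => f.hom.hom) hg) v))⟩
  fac {T} g hg := by
    have hr : ∀ v, g.hom.hom v ∈ LinearMap.range i.hom.hom := fun v =>
      (h (g.hom.hom v)).1 (LinearMap.congr_fun (congrArg (fun f => f.hom.hom) hg) v)
    let l : T →ₗ[k] K := (LinearEquiv.ofInjective i.hom.hom hi).symm.toLinearMap ∘ₗ
      g.hom.hom.codRestrict _ hr
    exact ⟨FGModuleCat.ofHom l, FGModuleCat.hom_ext (LinearMap.ext fun v => congrArg Subtype.val
      ((LinearEquiv.ofInjective i.hom.hom hi).apply_symm_apply ⟨g.hom.hom v, hr v⟩))⟩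

theorem FGModuleCat.isCoker_of_exact {X Y Q : FGModuleCat.{u} k} {f : X ⟶ Y} {p : Y ⟶ Q}
    (hp : Function.Surjective p.hom.hom) (h : Function.Exact f.hom.hom p.hom.hom) :
    IsCoker f p where
  zero := FGModuleCat.hom_ext h.linearMap_comp_eq_zero
  epi := ⟨fun g g' hg => FGModuleCat.hom_ext (LinearMap.ext fun v => by
    obtain ⟨v, rfl⟩ := hp v
    exact LinearMap.congr_fun (congrArg (fun f => f.hom.hom) hg) v)⟩
  fac {T} g hg := by
    have hk : LinearMap.ker p.hom.hom ≤ LinearMap.ker g.hom.hom := by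
      intro v hv
      obtain ⟨x, rfl⟩ := (h v).1 hv
      exact LinearMap.congr_fun (congrArg (fun f => f.hom.hom) hg) x
    let l : Q →ₗ[k] T := (LinearMap.ker p.hom.hom).liftQ g.hom.hom hk ∘ₗ
      (p.hom.hom.quotKerEquivOfSurjective hp).symm.toLinearMap
    refine ⟨FGModuleCat.ofHom l, FGModuleCat.hom_ext (LinearMap.ext fun v => ?_)⟩
    have : (p.hom.hom.quotKerEquivOfSurjective hp).symm (p.hom.hom v) =
      (LinearMap.ker p.hom.hom).mkQ v := (LinearEquiv.symm_apply_eq _).2 rfl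
    exact (congrArg ((LinearMap.ker p.hom.hom).liftQ g.hom.hom hk) this).trans
        (Submodule.liftQ_apply _ _ _)

end FGModuleCat

namespace FDComod

open UnipotentGroup

variable (k : Type u) [Field k] (G : UnipotentGroup) (J : Type)

instance : PreservesFiniteLimits (forgetFG k (G.HopfAlg J k)) := by
  have : ∀ {X Y : RepPow k G J} (f : X ⟶ Y),
      PreservesLimit (parallelPair f 0) (forgetFG k (G.HopfAlg J k)) := fun f =>
    (isKer_subι f).preservesLimit _ (FGModuleCat.isKer_of_exact
      (subι_injective _ (coef_mem_ker f)) (exact_subι f))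
  exact Functor.preservesFiniteLimits_of_preservesKernels _

instance : PreservesFiniteColimits (forgetFG k (G.HopfAlg J k)) := by
  have : ∀ {X Y : RepPow k G J} (f : X ⟶ Y),
      PreservesColimit (parallelPair f 0) (forgetFG k (G.HopfAlg J k)) := fun f =>
    (isCoker_quotπ f).preservesColimit _
      (FGModuleCat.isCoker_of_exact (quotπ_surjective _ (coef_mem_range f)) (exact_quotπ f))
  exact Functor.preservesFiniteColimits_of_preservesCokernels _

end FDComod
end
-- Exactness of the inclusion and the tannakian structure on objects of finite type.
noncomputable section

open UnipotentGroup UnipotentGroup.HopfAlg FDComod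

section

variable {ι : Type} {U : Ultrafilter ι} {k : ι → Type u} [∀ i, Field (k i)]
  {G : UnipotentGroup}

theorem RestrRep.homMk_eq {X Y : RestrRep U k G} {f g : ∀ i, X.obj.obj i ⟶ Y.obj.obj i} :
    (RestrRep.homMk f : X ⟶ Y) = RestrRep.homMk g ↔ ∀ᶠ i in U, f i = g i :=
  ⟨fun h => UCat.homMk_eq.1 (congrArg (fun f => f.hom) h),
    fun h => congrArg ObjectProperty.homMk (UCat.homMk_eq.2 h)⟩

/-- Factorisations are chosen index by index, with `0` wherever the composite with `f j` fails to
vanish. -/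
theorem RestrRep.isKer_homMk {K X Y : RestrRep U k G} {i : ∀ j, K.obj.obj j ⟶ X.obj.obj j}
    {f : ∀ j, X.obj.obj j ⟶ Y.obj.obj j} (h : ∀ j, IsKer (i j) (f j)) :
    IsKer (RestrRep.homMk i : K ⟶ X) (RestrRep.homMk f : X ⟶ Y) where
  zero := (RestrRep.homMk_eq (g := fun _ => 0)).2 (.of_forall fun j => (h j).zero)
  mono := ⟨fun {T} g g' => by
    revert g; refine RestrRep.hom_ind fun g => ?_
    revert g'; refine RestrRep.hom_ind fun g' => ?_
    intro hg
    have hg := (RestrRep.homMk_eq (X := T) (Y := X) (f := fun j => g j ≫ i j)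
      (g := fun j => g' j ≫ i j)).1 hg
    refine RestrRep.homMk_eq.2 ?_
    filter_upwards [hg] with j hj
    exact ((h j).mono).right_cancellation _ _ hj⟩
  fac {T} g := by
    revert g; refine RestrRep.hom_ind fun g => ?_
    intro hg
    have hg := (RestrRep.homMk_eq (X := T) (Y := Y) (f := fun j => g j ≫ f j)
      (g := fun j => 0)).1 hg
    have hl : ∀ j, ∃ l : T.obj.obj j ⟶ K.obj.obj j, g j ≫ f j = 0 → l ≫ i j = g j := by
      intro j
      by_cases h0 : g j ≫ f j = 0
      · obtain ⟨l, hl⟩ := (h j).fac (g j) h0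
        exact ⟨l, fun _ => hl⟩
      · exact ⟨0, fun h' => absurd h' h0⟩
    choose l hl using hl
    refine ⟨RestrRep.homMk l, (RestrRep.homMk_eq (f := fun j => l j ≫ i j)).2 ?_⟩
    filter_upwards [hg] with j hj
    exact hl j hj

theorem RestrRep.isCoker_homMk {X Y Q : RestrRep U k G} {f : ∀ j, X.obj.obj j ⟶ Y.obj.obj j}
    {p : ∀ j, Y.obj.obj j ⟶ Q.obj.obj j} (h : ∀ j, IsCoker (f j) (p j)) :
    IsCoker (RestrRep.homMk f : X ⟶ Y) (RestrRep.homMk p : Y ⟶ Q) where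
  zero := (RestrRep.homMk_eq (g := fun _ => 0)).2 (.of_forall fun j => (h j).zero)
  epi := ⟨fun {T} g g' => by
    revert g; refine RestrRep.hom_ind fun g => ?_
    revert g'; refine RestrRep.hom_ind fun g' => ?_
    intro hg
    have hg := (RestrRep.homMk_eq (X := Y) (Y := T) (f := fun j => p j ≫ g j)
      (g := fun j => p j ≫ g' j)).1 hg
    refine RestrRep.homMk_eq.2 ?_
    filter_upwards [hg] with j hj
    exact ((h j).epi).left_cancellation _ _ hj⟩
  fac {T} g := by
    revert g; refine RestrRep.hom_ind fun g => ?_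
    intro hg
    have hg := (RestrRep.homMk_eq (X := X) (Y := T) (f := fun j => f j ≫ g j)
      (g := fun j => 0)).1 hg
    have hl : ∀ j, ∃ l : Q.obj.obj j ⟶ T.obj.obj j, f j ≫ g j = 0 → p j ≫ l = g j := by
      intro j
      by_cases h0 : f j ≫ g j = 0
      · obtain ⟨l, hl⟩ := (h j).fac (g j) h0
        exact ⟨l, fun _ => hl⟩
      · exact ⟨0, fun h' => absurd h' h0⟩
    choose l hl using hl
    refine ⟨RestrRep.homMk l, (RestrRep.homMk_eq (f := fun j => p j ≫ l j)).2 ?_⟩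
    filter_upwards [hg] with j hj
    exact hl j hj

variable {J : Type} {ν : J → ℕ}

/-- Coefficients of a subobject vanish wherever those of the ambient object do, so the same finite
set serves. -/
theorem finiteType_of_injective {X Y : RestrRep U k G} (f : ∀ i, X.obj.obj i ⟶ Y.obj.obj i)
    (hf : ∀ i, Function.Injective (f i).lin) (hY : finiteType U k G ν Y) :
    finiteType U k G ν X := by
  obtain ⟨S, hS⟩ := hY
  refine ⟨S, ?_⟩
  filter_upwards [hS] with i hi m hm
  refine hi m fun h0 => hm (LinearMap.ext fun v => hf i ?_)
  rw [FDComod.coef_comm, h0]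
  exact (map_zero (f i).lin).symm

theorem finiteType_of_surjective {X Y : RestrRep U k G} (f : ∀ i, X.obj.obj i ⟶ Y.obj.obj i)
    (hf : ∀ i, Function.Surjective (f i).lin) (hX : finiteType U k G ν X) :
    finiteType U k G ν Y := by
  obtain ⟨S, hS⟩ := hX
  refine ⟨S, ?_⟩
  filter_upwards [hS] with i hi m hm
  refine hi m fun h0 => hm (LinearMap.ext fun w => ?_)
  obtain ⟨v, rfl⟩ := hf i w
  rw [← FDComod.coef_comm, h0]
  exact map_zero (f i).lin

/-- The componentwise kernel has finite type and is a kernel already in the restricted ultraproduct;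
exactness of the inclusion rests on this. -/
theorem exists_isKer {X Y : (finiteType U k G ν).FullSubcategory} (f : X ⟶ Y) :
    ∃ (K : (finiteType U k G ν).FullSubcategory) (i : K ⟶ X),
      IsKer ((finiteType U k G ν).ι.map i) ((finiteType U k G ν).ι.map f) := by
  obtain ⟨f⟩ := f
  revert f; refine RestrRep.hom_ind fun f => ?_
  let K : RestrRep U k G := ⟨⟨fun j => sub (X.obj.obj.obj j) _ (coef_mem_ker (f j))⟩, by
    obtain ⟨d, hd⟩ := X.obj.property
    refine ⟨d, ?_⟩
    filter_upwards [hd] with j hj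
    exact (LinearMap.finrank_le_finrank_of_injective
      (subι_injective _ (coef_mem_ker (f j)))).trans hj⟩
  exact ⟨⟨K, finiteType_of_injective (X := K) (fun j => subι _ _ (coef_mem_ker (f j)))
    (fun j => subι_injective _ _) X.property⟩, ⟨RestrRep.homMk fun j => subι _ _ _⟩,
    RestrRep.isKer_homMk fun j => isKer_subι (f j)⟩

theorem exists_isCoker {X Y : (finiteType U k G ν).FullSubcategory} (f : X ⟶ Y) :
    ∃ (Q : (finiteType U k G ν).FullSubcategory) (p : Y ⟶ Q),
      IsCoker ((finiteType U k G ν).ι.map f) ((finiteType U k G ν).ι.map p) := by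
  obtain ⟨f⟩ := f
  revert f; refine RestrRep.hom_ind fun f => ?_
  let Q : RestrRep U k G := ⟨⟨fun j => quot (Y.obj.obj.obj j) _ (coef_mem_range (f j))⟩, by
    obtain ⟨d, hd⟩ := Y.obj.property
    refine ⟨d, ?_⟩
    filter_upwards [hd] with j hj
    exact (LinearMap.finrank_le_finrank_of_surjective
      (quotπ_surjective _ (coef_mem_range (f j)))).trans hj⟩
  exact ⟨⟨Q, finiteType_of_surjective (Y := Q) (fun j => quotπ _ _ (coef_mem_range (f j)))
    (fun j => quotπ_surjective _ _) Y.property⟩, ⟨RestrRep.homMk fun j => quotπ _ _ _⟩,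
    RestrRep.isCoker_homMk fun j => isCoker_quotπ (f j)⟩

variable [hU : LargeChar U k] [hν : Fact (Function.Injective ν)]

instance : HasFiniteProducts (finiteType U k G ν).FullSubcategory :=
  ⟨fun _ => Adjunction.hasLimitsOfShape_of_equivalence (toRep U k G ν)⟩

variable (U k G ν) in
/-- The objects of finite type form an abelian category. -/
@[reducible]
def abelianFiniteType : Abelian (finiteType U k G ν).FullSubcategory :=
  abelianOfEquivalence (toRep U k G ν)

theorem isAbelianCat_finiteType : IsAbelianCat (finiteType U k G ν).FullSubcategory :=
  let := abelianFiniteType U k G ν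
  ⟨inferInstance, inferInstance, inferInstance, inferInstance, inferInstance⟩

/-- An object with zero identity is a zero object in the larger category too; any injective `ν`
would do. -/
theorem hasZeroObject_restrRep : HasZeroObject (RestrRep U k G) := by
  have : Fact (Function.Injective (id : ℕ → ℕ)) := ⟨Function.injective_id⟩
  let := abelianFiniteType U k G (id : ℕ → ℕ)
  obtain ⟨Z, hZ⟩ := HasZeroObject.zero (C := (finiteType U k G (id : ℕ → ℕ)).FullSubcategory)
  refine ⟨(finiteType U k G (id : ℕ → ℕ)).ι.obj Z, (IsZero.iff_id_eq_zero _).2 ?_⟩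
  rw [← CategoryTheory.Functor.map_id, (IsZero.iff_id_eq_zero _).1 hZ, Functor.map_zero]

variable (U k G ν)

theorem preservesFiniteLimits_ι : PreservesFiniteLimits (finiteType U k G ν).ι := by
  let := abelianFiniteType U k G ν
  have := hasZeroObject_restrRep (U := U) (k := k) (G := G)
  have : ∀ {X Y : (finiteType U k G ν).FullSubcategory} (f : X ⟶ Y),
      PreservesLimit (parallelPair f 0) (finiteType U k G ν).ι := fun f => by
    obtain ⟨K, i, h⟩ := exists_isKer f
    exact (IsKer.of_map _ h).preservesLimit _ h
  exact Functor.preservesFiniteLimits_of_preservesKernels _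

theorem preservesFiniteColimits_ι : PreservesFiniteColimits (finiteType U k G ν).ι := by
  let := abelianFiniteType U k G ν
  have := hasZeroObject_restrRep (U := U) (k := k) (G := G)
  have : ∀ {X Y : (finiteType U k G ν).FullSubcategory} (f : X ⟶ Y),
      PreservesColimit (parallelPair f 0) (finiteType U k G ν).ι := fun f => by
    obtain ⟨K, i, h⟩ := exists_isCoker f
    exact (IsCoker.of_map _ h).preservesColimit _ h
  exact Functor.preservesFiniteColimits_of_preservesCokernels _

/-- By construction `toRep` only adds a coaction to the ultraproduct of spaces, so `ω` inherits its
properties from the forgetful functor. -/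
theorem ι_comp_ultraFibre :
    (finiteType U k G ν).ι ⋙ ultraFibre U k (fun i => G.HopfAlg Unit (k i)) =
      toRep U k G ν ⋙ forgetFG (UField U k) (G.HopfAlg J (UField U k)) := rfl

/-- The unit object is a line over the ultraproduct of the fields, and an endomorphism of a line is
multiplication by a scalar. -/
theorem scalars_bijective : Function.Bijective fun a : UField U k =>
    (a • 𝟙 (𝟙_ (finiteType U k G ν).FullSubcategory) :
      End (𝟙_ (finiteType U k G ν).FullSubcategory)) := by
  let φ : UField U k ≃ₗ[UField U k] (𝟙_ (RestrRep U k G)).carrier := UVec.unitEquiv U k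
  have hlin : ∀ a : UField U k, ((toRep U k G ν).map
      (a • 𝟙 (𝟙_ (finiteType U k G ν).FullSubcategory))).lin = a • LinearMap.id := by
    intro a
    rw [Functor.map_smul, CategoryTheory.Functor.map_id]
    rfl
  constructor
  · intro a b h
    have h := congrArg (fun f => ((toRep U k G ν).map f).lin) h
    simp only [hlin] at h
    have h1 : a • φ 1 = b • φ 1 := LinearMap.congr_fun h (φ 1)
    rw [← map_smul, ← map_smul] at h1
    simpa using φ.injective h1
  · intro f
    let l : (𝟙_ (RestrRep U k G)).carrier →ₗ[UField U k] (𝟙_ (RestrRep U k G)).carrier :=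
      ((toRep U k G ν).map f).lin
    refine ⟨φ.symm (l (φ 1)), (toRep U k G ν).map_injective (FDComod.hom_ext ?_)⟩
    refine (hlin _).trans ?_
    refine LinearMap.ext (f := φ.symm (l (φ 1)) • LinearMap.id) (g := l) fun v => ?_
    obtain ⟨a, rfl⟩ := φ.surjective v
    have h1 : φ a = a • φ 1 := by rw [← map_smul, smul_eq_mul, mul_one]
    have h2 : l (φ 1) = φ.symm (l (φ 1)) • φ 1 := by
      rw [← map_smul, smul_eq_mul, mul_one, φ.apply_symm_apply]
    rw [h1]
    refine ((smul_comm _ a _).trans (congrArg (a • ·) h2.symm)).trans (l.map_smul a (φ 1)).symm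

theorem isField_end : IsField (End (𝟙_ (finiteType U k G ν).FullSubcategory)) := by
  let e : UField U k ≃* End (𝟙_ (finiteType U k G ν).FullSubcategory) :=
    { Equiv.ofBijective _ (scalars_bijective U k G ν) with
      map_mul' a b := by
        -- Multiplication in `End` reverses composition, which is harmless for commuting scalars.
        refine Eq.trans ?_ (End.mul_def _ _).symm
        refine Eq.trans ?_ (Linear.smul_comp _ _ _ b _ _).symm
        refine Eq.trans ?_ (congrArg (b • ·) (Category.id_comp _).symm)
        rw [Equiv.toFun_as_coe, Equiv.ofBijective_apply, mul_comm]
        exact (Linear.homModule (R := UField U k) (𝟙_ (finiteType U k G ν).FullSubcategory)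
          (𝟙_ (finiteType U k G ν).FullSubcategory)).mul_smul b a (𝟙 _) }
  exact e.symm.isField (Field.toIsField _)

theorem isNeutralTannakian_finiteType :
    IsNeutralTannakian (UField U k) (finiteType U k G ν).FullSubcategory
      ((finiteType U k G ν).ι ⋙ ultraFibre U k fun i => G.HopfAlg Unit (k i)) where
  tannakian :=
    { abelian := isAbelianCat_finiteType
      biadditive :=
        -- Bi-additivity is reflected by faithful functors: from vector spaces to comodules, then to
        -- objects of finite type.
        have : MonoidalPreadditive (RepPow (UField U k) G J) :=
          monoidalPreadditive_of_faithful (forgetFG (UField U k) (G.HopfAlg J (UField U k)))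
        monoidalPreadditive_of_faithful (toRep U k G ν)
      rigid := ⟨rigidCategoryOfEquivalence (F := toRep U k G ν) (toRep U k G ν).asEquivalence.toAdjunction⟩
      isField := isField_end U k G ν }
  scalars := scalars_bijective U k G ν
  fibre := by
    rw [ι_comp_ultraFibre]
    exact ⟨inferInstance, inferInstance, comp_preservesFiniteLimits _ _,
      comp_preservesFiniteColimits _ _, inferInstance, ⟨inferInstance⟩⟩

theorem tensorEquivalent_finiteType :
    TensorEquivalent (UField U k) (finiteType U k G ν).FullSubcategory
      (RepPow (UField U k) G J) :=
  ⟨toRep U k G ν, inferInstance, inferInstance, inferInstance, ⟨inferInstance⟩⟩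

end
end
-- Comparison of height with finite type, and the conclusion.
noncomputable section

open UnipotentGroup UnipotentGroup.HopfAlg FDComod

/-- `coeffMap` and `coef` agree by definition. The positions `m` that occur are those below the
height, whence the shift by one. -/
theorem RepOne.height_le_iff {k : Type u} [Field k] {G : UnipotentGroup} (V : RepOne k G)
    (n : ℕ) : V.height ≤ n ↔
      ∀ (c : Fin G.dim) (m : ℕ), coef V (axis c (ringChar k ^ m)) ≠ 0 → m + 1 ≤ n := by
  unfold RepOne.height
  simp only [iSup_le_iff, Nat.cast_le]
  exact ⟨fun h c m hm => h m ⟨c, hm⟩, fun h m ⟨c, hm⟩ => h c m hm⟩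

section

variable {ι : Type} {U : Ultrafilter ι} {k : ι → Type u} [∀ i, Field (k i)]
  {G : UnipotentGroup}

theorem RestrRep.height_le_iff (X : RestrRep U k G) (n : ℕ) :
    X.height ≤ n ↔ ∀ᶠ i in U, RepOne.height (X.obj.obj i : RepOne (k i) G) ≤ n := by
  constructor
  · intro h
    -- Only a strict bound on the limsup passes to almost every index; by integrality `< n + 1`
    -- gives back `≤ n`.
    have h1 : X.height < ((n + 1 : ℕ) : ℕ∞) :=
      lt_of_le_of_lt h (Nat.cast_lt.2 (Nat.lt_succ_self n))
    filter_upwards [Filter.eventually_lt_of_limsup_lt h1] with i hi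
    exact ENat.lt_natCast_add_one_iff.1 hi
  · intro h
    exact Filter.limsup_le_of_le (by isBoundedDefault) h

variable {J : Type} {ν : J → ℕ} [hU : LargeChar U k] [hν : Fact (Function.Injective ν)]

theorem finiteType_of_height_le {X : RestrRep U k G} {n : ℕ} (h : X.height ≤ n) (T : Finset J)
    (hT : ∀ m < n, ∃ t ∈ T, ν t = m) : finiteType U k G ν X := by
  obtain ⟨d, hd⟩ := X.property
  -- `d` bounds the digits and `T` supplies the positions, both independently of the index.
  refine ⟨G.box T d, ?_⟩
  filter_upwards [hd, (X.height_le_iff n).1 h] with i hi hn m hm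
  have := Fact.mk (LargeChar.prime (U := U) (k := k) i)
  exact exists_twist_eq _ hi hν.1 T
    (fun c j hj => hT j ((RepOne.height_le_iff _ n).1 hn c j hj)) hm

/-- The number `q ^ m` has a single nonzero digit, at position `m`. Since `m` is not known to be a
value of `ν`, the exponent is first moved along `ν` to `G^ℕ`, where `single (m, c) 1` exists and
digits can be compared. -/
theorem UnipotentGroup.exists_of_twist_eq_axis {q : ℕ} (hq : 1 < q) {ν : J → ℕ}
    (hν : Function.Injective ν) {e : G.Expo J} (he : ∀ s, e s < q) {c : Fin G.dim} {m : ℕ}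
    (h : twist q ν e = axis c (q ^ m)) : ∃ j, (j, c) ∈ e.support ∧ ν j = m := by
  classical
  let E : G.Expo ℕ := Finsupp.mapDomain (Prod.map ν id) e
  have hinj : Function.Injective (Prod.map ν (id : Fin G.dim → Fin G.dim)) :=
    hν.prodMap Function.injective_id
  have h1 : twist q (id : ℕ → ℕ) E = twist q ν e := by
    have : (twist q (id : ℕ → ℕ)).comp
        (Finsupp.mapDomain.addMonoidHom (Prod.map ν (id : Fin G.dim → Fin G.dim))) =
        (twist q ν : G.Expo J →+ G.Expo Unit) := by
      refine Finsupp.addHom_ext fun s n => ?_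
      obtain ⟨j, c⟩ := s
      refine (congrArg (twist q (id : ℕ → ℕ)) Finsupp.mapDomain_single).trans ?_
      exact (twist_single q id (ν j) c n).trans (twist_single q ν j c n).symm
    exact DFunLike.congr_fun this e
  have hE : ∀ s, E s < q := by
    intro s
    by_cases hs : s ∈ Set.range (Prod.map ν (id : Fin G.dim → Fin G.dim))
    · obtain ⟨s, rfl⟩ := hs
      rw [Finsupp.mapDomain_apply hinj]
      exact he s
    · rw [Finsupp.mapDomain_of_notMem_range _ _ hs]
      exact zero_lt_one.trans hq
  have h2 : E = Finsupp.single (m, c) 1 := by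
    refine twist_injOn (zero_lt_one.trans hq) Function.injective_id hE (fun s => ?_) ?_
    · rw [Finsupp.single_apply]
      split_ifs
      · exact hq
      · exact zero_lt_one.trans hq
    · rw [h1, h, twist_single, mul_one]
      rfl
  have h3 : E (m, c) ≠ 0 := by simp [h2]
  have h4 : (m, c) ∈ Set.range (Prod.map ν (id : Fin G.dim → Fin G.dim)) := by
    by_contra hs
    exact h3 (Finsupp.mapDomain_of_notMem_range _ _ hs)
  obtain ⟨⟨j, c'⟩, hj⟩ := h4
  rw [← hj, Finsupp.mapDomain_apply hinj] at h3
  obtain ⟨rfl, rfl⟩ := Prod.ext_iff.1 hj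
  exact ⟨j, Finsupp.mem_support_iff.2 h3, rfl⟩

/-- Once the characteristic exceeds all entries of the exponents in `S`, a monomial `x ^ (p ^ m)`
can only come from a factor `j` with `ν j = m` that occurs in `S`. -/
theorem height_le_of_finiteType {X : RestrRep U k G} {S : Finset (G.Expo J)}
    (hS : ∀ᶠ i in U, ∀ m, coef (X.obj.obj i : RepOne (k i) G) m ≠ 0 →
      ∃ e ∈ S, twist (ringChar (k i)) ν e = m) {n : ℕ}
    (hn : ∀ e ∈ S, ∀ s ∈ e.support, ν s.1 < n) : X.height ≤ n := by
  rw [RestrRep.height_le_iff]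
  let N : ℕ := S.sup fun e => e.support.sup e
  filter_upwards [hS, (LargeChar.tendsto (U := U) (k := k)).eventually_gt_atTop N] with i hi hN
  rw [RepOne.height_le_iff]
  intro c m hm
  obtain ⟨e, he, hem⟩ := hi _ hm
  have hlt : ∀ s, e s < ringChar (k i) := fun s => lt_of_le_of_lt (by
    by_cases hs : s ∈ e.support
    · exact (Finset.le_sup (f := e) hs).trans (Finset.le_sup (f := fun e => e.support.sup e) he)
    · rw [Finsupp.notMem_support_iff.1 hs]
      exact Nat.zero_le _) hN
  obtain ⟨j, hj, rfl⟩ := exists_of_twist_eq_axis (LargeChar.prime (U := U) (k := k) i).one_lt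
    hν.1 hlt hem
  exact hn e he _ hj

theorem finiteHeight_eq_finiteType : finiteHeight U k G = finiteType U k G (id : ℕ → ℕ) := by
  have : Fact (Function.Injective (id : ℕ → ℕ)) := ⟨Function.injective_id⟩
  ext X
  constructor
  · intro h
    obtain ⟨n, hn⟩ := ENat.ne_top_iff_exists.1 (ne_of_lt h)
    exact finiteType_of_height_le hn.symm.le (Finset.range n)
      fun m hm => ⟨m, Finset.mem_range.2 hm, rfl⟩
  · rintro ⟨S, hS⟩
    let n : ℕ := S.sup fun e => e.support.sup fun s => s.1
    refine lt_of_le_of_lt (height_le_of_finiteType (n := n + 1) hS fun e he s hs =>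
      Nat.lt_succ_of_le ?_) (ENat.natCast_lt_top _)
    exact (Finset.le_sup (f := fun s : ℕ × Fin G.dim => s.1) hs).trans
      (Finset.le_sup (f := fun e : G.Expo ℕ => e.support.sup fun s => s.1) he)

theorem heightLE_eq_finiteType (n : ℕ) :
    heightLE U k G n = finiteType U k G (Fin.val : Fin n → ℕ) := by
  have : Fact (Function.Injective (Fin.val : Fin n → ℕ)) := ⟨Fin.val_injective⟩
  ext X
  constructor
  · intro h
    exact finiteType_of_height_le h Finset.univ fun m hm => ⟨⟨m, hm⟩, Finset.mem_univ _, rfl⟩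
  · rintro ⟨S, hS⟩
    exact height_le_of_finiteType hS fun e _ s _ => s.1.2

end

/-- A non-principal ultrafilter on `ℕ` refines the cofinite filter, along which a strictly
increasing sequence tends to infinity. -/
theorem largeChar_of_strictMono {k : ℕ → Type u} [∀ i, Field (k i)]
    (hpos : ∀ i, 0 < ringChar (k i)) (hmono : StrictMono fun i => ringChar (k i))
    {U : Ultrafilter ℕ} (hU : ∀ i : ℕ, U ≠ pure i) : LargeChar U k where
  prime i := ((CharP.char_is_prime_or_zero (k i) (ringChar (k i))).resolve_right (hpos i).ne')
  tendsto := by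
    have h : (U : Filter ℕ) ≤ Filter.cofinite :=
      (Ultrafilter.le_cofinite_or_eq_pure U).resolve_right fun ⟨i, hi⟩ => hU i hi
    rw [Nat.cofinite_eq_atTop] at h
    exact hmono.tendsto_atTop.mono_left h

/-- Stated for a property equal to `finiteType`, so that one substitution transports the monoidal
structure and everything depending on it. -/
theorem neutralTannakian_of_eq_finiteType {ι : Type} {U : Ultrafilter ι} {k : ι → Type u}
    [∀ i, Field (k i)] {G : UnipotentGroup} {J : Type} {ν : J → ℕ} [LargeChar U k]
    (hν : Function.Injective ν) {P : ObjectProperty (RestrRep U k G)}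
    (hP : P = finiteType U k G ν) :
    ∃ _ : P.IsMonoidal, PreservesFiniteLimits P.ι ∧ PreservesFiniteColimits P.ι ∧
      IsNeutralTannakian (UField U k) P.FullSubcategory
        (P.ι ⋙ ultraFibre U k fun i => G.HopfAlg Unit (k i)) ∧
      TensorEquivalent (UField U k) P.FullSubcategory (RepPow (UField U k) G J) := by
  subst hP
  have := Fact.mk hν
  exact ⟨inferInstance, preservesFiniteLimits_ι U k G ν, preservesFiniteColimits_ι U k G ν,
    isNeutralTannakian_finiteType U k G ν, tensorEquivalent_finiteType U k G ν⟩

theorem mainTheorem3 (G : UnipotentGroup) (k : ℕ → Type u) [∀ i, Field (k i)]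
    (hpos : ∀ i, 0 < ringChar (k i)) (hmono : StrictMono fun i => ringChar (k i))
    (U : Ultrafilter ℕ) (hU : ∀ i : ℕ, U ≠ pure i) :
    (∃ _ : (finiteHeight U k G).IsMonoidal,
      PreservesFiniteLimits (finiteHeight U k G).ι ∧
      PreservesFiniteColimits (finiteHeight U k G).ι ∧
      IsNeutralTannakian (UField U k) (HeightRestrRep U k G)
        ((finiteHeight U k G).ι ⋙ ultraFibre U k fun i => G.HopfAlg Unit (k i)) ∧
      TensorEquivalent (UField U k) (HeightRestrRep U k G) (RepPow (UField U k) G ℕ)) ∧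
    ∀ n : ℕ, ∃ _ : (heightLE U k G n).IsMonoidal,
      TensorEquivalent (UField U k) (HeightLERep U k G n)
        (RepPow (UField U k) G (Fin n)) := by
  have := largeChar_of_strictMono hpos hmono hU
  refine ⟨neutralTannakian_of_eq_finiteType Function.injective_id finiteHeight_eq_finiteType,
    fun n => ?_⟩
  obtain ⟨h, -, -, -, hn⟩ :=
    neutralTannakian_of_eq_finiteType Fin.val_injective (heightLE_eq_finiteType (U := U) (k := k) (G := G) n)
  exact ⟨h, hn⟩

end
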